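/- Let $d,p$ be nonnegative integers with $d+p\ge 1$, let $\lambda>0$, $a\in\mathbf R^{d+p}$ and $\underline y\le\bar y$ in $\mathbf R^{d+p}$, and let $$\Phi=\{(y,w)\in[\underline y,\bar y]\times\mathbf R \mid w=\mathcal T_\lambda(a^Ty)\},\qquad \mathcal T_\lambda(t)=\begin{cases}t-\lambda & t>\lambda\\ 0&|t|\le\lambda\\ t+\lambda & t<-\lambda.\end{cases}$$ The separation problem for $\mathbf{conv}(\Phi)$ is solvable in $O(d+p)$ time. That is, there are one algorithm (a program for a real random access machine, where each arithmetic operation or comparison of two real numbers, each memory access, and each addition, subtraction or comparison of two natural numbers takes unit time) and one constant $C$ such that, for all $d,p,\lambda,a,\underline y,\bar y$ as above and every point $(\hat y,\hat w)\in\mathbf R^{d+p}\times\mathbf R$, the algorithm halts after at most $C\,(d+p)$ steps and <br>(i) decides whether $(\hat y,\hat w)\in\mathbf{conv}(\Phi)$; <br>(ii) if $(\hat y,\hat w)\notin\mathbf{conv}(\Phi)$, returns a linear inequality $\alpha^Ty+\gamma w\le\beta$ that holds on $\mathbf{conv}(\Phi)$ and is violated by $(\hat y,\hat w)$. If moreover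 $\hat y\in[\underline y,\bar y]$, then the returned inequality has $|\gamma|=1$ and is a most violated one: no inequality $\alpha'^Ty+\gamma'w\le\beta'$ with $|\gamma'|=1$ that holds on $\mathbf{conv}(\Phi)$ has $\alpha'^T\hat y+\gamma'\hat w-\beta'>\alpha^T\hat y+\gamma\hat w-\beta$. -/

import Mathlib

open Matrix

/-! ### Soft-thresholding and its graph over a box -/

/-- The soft-thresholding operator with constant `lam`. -/
noncomputable def softThreshold (lam t : ℝ) : ℝ :=
  if lam < t then t - lam else if t < -lam then t + lam else 0

/-- The set `Φ` of all `(y, w)` with `lo ≤ y ≤ hi` and `w` the soft-thresholding of `aᵀ y`. -/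
def softGraph {n : ℕ} (lam : ℝ) (a lo hi : Fin n → ℝ) : Set ((Fin n → ℝ) × ℝ) :=
  {q | q.1 ∈ Set.Icc lo hi ∧ q.2 = softThreshold lam (a ⬝ᵥ q.1)}

/-! ### Linear inequalities in `(y, w)` -/

/-- The linear inequality `coefY ᵀ y + coefW * w ≤ rhs`. -/
structure LinIneq (n : ℕ) where
  coefY : Fin n → ℝ
  coefW : ℝ
  rhs : ℝ

/-- The amount by which a point violates the inequality (positive exactly when it violates it). -/
def LinIneq.violation {n : ℕ} (c : LinIneq n) (q : (Fin n → ℝ) × ℝ) : ℝ :=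
  c.coefY ⬝ᵥ q.1 + c.coefW * q.2 - c.rhs

/-- The inequality holds at every point of `S`. -/
def LinIneq.ValidOn {n : ℕ} (c : LinIneq n) (S : Set ((Fin n → ℝ) × ℝ)) : Prop :=
  ∀ q ∈ S, c.violation q ≤ 0

/-! ### A real random access machine with a step count

Programs are finite texts. The machine has registers (addressed by constants of the program) and
memory cells (addressed through the contents of a natural-number register), in each case of two
sorts: natural numbers and real numbers. Each elementary instruction, each evaluation of a test and
each procedure call costs one step. Natural numbers can be added, subtracted and compared; real
numbers can be added, subtracted, multiplied, divided and compared. The only constants available to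
a program are natural numbers, and there is no conversion from real to natural numbers. -/

namespace RealRAM

/-- The contents of all registers and all memory cells. -/
structure State where
  natReg : ℕ → ℕ
  realReg : ℕ → ℝ
  natMem : ℕ → ℕ
  realMem : ℕ → ℝ

/-- Elementary instructions; `i`, `j`, `k` are register numbers. -/
inductive Op where
  /-- natural register `i` becomes the constant `c` -/
  | natConst (i c : ℕ)
  /-- natural register `i` becomes register `j` plus register `k` -/
  | natAdd (i j k : ℕ)
  /-- natural register `i` becomes register `j` minus register `k` (at least `0`) -/
  | natSub (i j k : ℕ)
  /-- natural register `i` becomes the natural memory cell whose address is in register `j` -/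
  | natLoad (i j : ℕ)
  /-- the natural memory cell whose address is in register `i` becomes natural register `j` -/
  | natStore (i j : ℕ)
  /-- real register `i` becomes the natural constant `c` -/
  | realConst (i c : ℕ)
  /-- real register `i` becomes register `j` plus register `k` -/
  | realAdd (i j k : ℕ)
  /-- real register `i` becomes register `j` minus register `k` -/
  | realSub (i j k : ℕ)
  /-- real register `i` becomes register `j` times register `k` -/
  | realMul (i j k : ℕ)
  /-- real register `i` becomes register `j` divided by register `k` (`0` if register `k` is `0`) -/
  | realDiv (i j k : ℕ)
  /-- real register `i` becomes the real memory cell whose address is in natural register `j` -/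
  | realLoad (i j : ℕ)
  /-- the real memory cell whose address is in natural register `i` becomes real register `j` -/
  | realStore (i j : ℕ)

/-- The effect of an elementary instruction. -/
noncomputable def Op.apply : Op → State → State
  | .natConst i c, s => { s with natReg := Function.update s.natReg i c }
  | .natAdd i j k, s =>
      { s with natReg := Function.update s.natReg i (s.natReg j + s.natReg k) }
  | .natSub i j k, s =>
      { s with natReg := Function.update s.natReg i (s.natReg j - s.natReg k) }
  | .natLoad i j, s =>
      { s with natReg := Function.update s.natReg i (s.natMem (s.natReg j)) }
  | .natStore i j, s =>
      { s with natMem := Function.update s.natMem (s.natReg i) (s.natReg j) }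
  | .realConst i c, s => { s with realReg := Function.update s.realReg i (c : ℝ) }
  | .realAdd i j k, s =>
      { s with realReg := Function.update s.realReg i (s.realReg j + s.realReg k) }
  | .realSub i j k, s =>
      { s with realReg := Function.update s.realReg i (s.realReg j - s.realReg k) }
  | .realMul i j k, s =>
      { s with realReg := Function.update s.realReg i (s.realReg j * s.realReg k) }
  | .realDiv i j k, s =>
      { s with realReg := Function.update s.realReg i (s.realReg j / s.realReg k) }
  | .realLoad i j, s =>
      { s with realReg := Function.update s.realReg i (s.realMem (s.natReg j)) }
  | .realStore i j, s =>
      { s with realMem := Function.update s.realMem (s.natReg i) (s.realReg j) }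

/-- Tests: comparisons of two registers of the same sort. -/
inductive Test where
  | natLt (i j : ℕ)
  | natLe (i j : ℕ)
  | realLt (i j : ℕ)
  | realLe (i j : ℕ)

/-- The truth value of a test. -/
def Test.Holds : Test → State → Prop
  | .natLt i j, s => s.natReg i < s.natReg j
  | .natLe i j, s => s.natReg i ≤ s.natReg j
  | .realLt i j, s => s.realReg i < s.realReg j
  | .realLe i j, s => s.realReg i ≤ s.realReg j

/-- Structured commands. -/
inductive Cmd where
  | skip
  | op (o : Op)
  | seq (c₁ c₂ : Cmd)
  | cond (b : Test) (c₁ c₂ : Cmd)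
  | loop (b : Test) (c : Cmd)
  | call (k : ℕ)

/-- `Exec procs c s t s'`: started in state `s`, the command `c` halts in state `s'` after exactly
`t` steps. `loop b c` repeats `c` while `b` holds; `call k` runs the `k`-th procedure, on the same
state (procedures have no local registers). -/
inductive Exec (procs : List Cmd) : Cmd → State → ℕ → State → Prop where
  | skip (s : State) : Exec procs .skip s 1 s
  | op (o : Op) (s : State) : Exec procs (.op o) s 1 (o.apply s)
  | seq {c₁ c₂ : Cmd} {s s' s'' : State} {t₁ t₂ : ℕ}
      (h₁ : Exec procs c₁ s t₁ s') (h₂ : Exec procs c₂ s' t₂ s'') :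
      Exec procs (.seq c₁ c₂) s (t₁ + t₂) s''
  | condTrue {b : Test} {c₁ c₂ : Cmd} {s s' : State} {t : ℕ}
      (hb : b.Holds s) (h : Exec procs c₁ s t s') : Exec procs (.cond b c₁ c₂) s (t + 1) s'
  | condFalse {b : Test} {c₁ c₂ : Cmd} {s s' : State} {t : ℕ}
      (hb : ¬ b.Holds s) (h : Exec procs c₂ s t s') : Exec procs (.cond b c₁ c₂) s (t + 1) s'
  | loopDone {b : Test} {c : Cmd} {s : State}
      (hb : ¬ b.Holds s) : Exec procs (.loop b c) s 1 s
  | loopStep {b : Test} {c : Cmd} {s s' s'' : State} {t₁ t₂ : ℕ}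
      (hb : b.Holds s) (h₁ : Exec procs c s t₁ s') (h₂ : Exec procs (.loop b c) s' t₂ s'') :
      Exec procs (.loop b c) s (t₁ + t₂ + 1) s''
  | call {k : ℕ} {c : Cmd} {s s' : State} {t : ℕ}
      (hk : procs[k]? = some c) (h : Exec procs c s t s') : Exec procs (.call k) s (t + 1) s'

/-- A program: a main command together with finitely many (possibly mutually recursive)
procedures. -/
structure Program where
  main : Cmd
  procs : List Cmd

/-- Started in state `s`, the program halts in state `s'` after exactly `t` steps. -/
def Program.HaltsIn (P : Program) (s : State) (t : ℕ) (s' : State) : Prop :=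
  Exec P.procs P.main s t s'

/-- The machine is deterministic, so that the running time and the output are well defined. -/
theorem Exec.deterministic {procs : List Cmd} {c : Cmd} {s s₁ s₂ : State} {t₁ t₂ : ℕ}
    (h₁ : Exec procs c s t₁ s₁) (h₂ : Exec procs c s t₂ s₂) : t₁ = t₂ ∧ s₁ = s₂ := by
  induction h₁ generalizing t₂ s₂ with
  | skip s => cases h₂; exact ⟨rfl, rfl⟩
  | op o s => cases h₂; exact ⟨rfl, rfl⟩
  | seq _ _ ih₁ ih₂ =>
    cases h₂ with
    | seq g₁ g₂ =>
      obtain ⟨rfl, rfl⟩ := ih₁ g₁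
      obtain ⟨rfl, rfl⟩ := ih₂ g₂
      exact ⟨rfl, rfl⟩
  | condTrue hb _ ih =>
    cases h₂ with
    | condTrue _ g => obtain ⟨rfl, rfl⟩ := ih g; exact ⟨rfl, rfl⟩
    | condFalse hb' _ => exact absurd hb hb'
  | condFalse hb _ ih =>
    cases h₂ with
    | condTrue hb' _ => exact absurd hb' hb
    | condFalse _ g => obtain ⟨rfl, rfl⟩ := ih g; exact ⟨rfl, rfl⟩
  | loopDone hb =>
    cases h₂ with
    | loopDone _ => exact ⟨rfl, rfl⟩
    | loopStep hb' _ _ => exact absurd hb' hb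
  | loopStep hb _ _ ih₁ ih₂ =>
    cases h₂ with
    | loopDone hb' => exact absurd hb hb'
    | loopStep _ g₁ g₂ =>
      obtain ⟨rfl, rfl⟩ := ih₁ g₁
      obtain ⟨rfl, rfl⟩ := ih₂ g₂
      exact ⟨rfl, rfl⟩
  | call hk _ ih =>
    cases h₂ with
    | call hk' g =>
      rw [hk] at hk'
      cases hk'
      obtain ⟨rfl, rfl⟩ := ih g
      exact ⟨rfl, rfl⟩

end RealRAM

/-! ### Input and output of a separation procedure -/

/-- The vector `x`, read at a natural number (`0` beyond its length). -/
def readVec {n : ℕ} (x : Fin n → ℝ) (k : ℕ) : ℝ := if h : k < n then x ⟨k, h⟩ else 0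

/-- The initial state: `d` and `p` in the natural registers `0` and `1`, `lam` and `w` in the real
registers `0` and `1`, the vectors `a`, `lo`, `hi`, `y` one after the other in the real memory from
address `0` on, and `0` everywhere else. -/
def separationInput (d p : ℕ) (lam : ℝ) (a lo hi y : Fin (d + p) → ℝ) (w : ℝ) : RealRAM.State where
  natReg := fun i => if i = 0 then d else if i = 1 then p else 0
  realReg := fun i => if i = 0 then lam else if i = 1 then w else 0
  natMem := fun _ => 0
  realMem := fun k =>
    if k < d + p then readVec a k
    else if k < 2 * (d + p) then readVec lo (k - (d + p))
    else if k < 3 * (d + p) then readVec hi (k - 2 * (d + p))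
    else readVec y (k - 3 * (d + p))

/-- The inequality in the `n` variables `y` and the variable `w` that is written in a final state:
the coefficients of `y` in the real memory from address `0` on, the coefficient of `w` in the real
register `0`, the right-hand side in the real register `1`. -/
def outputIneq (n : ℕ) (s : RealRAM.State) : LinIneq n where
  coefY := fun i => s.realMem i
  coefW := s.realReg 0
  rhs := s.realReg 1

/-- `c` is a most violated inequality at `q` for `S`, among all inequalities
`w ≤ αᵀ y + β` and `w ≥ αᵀ y + β` that are valid on `S`. -/
def LinIneq.IsMostViolated {n : ℕ} (c : LinIneq n) (S : Set ((Fin n → ℝ) × ℝ))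
    (q : (Fin n → ℝ) × ℝ) : Prop :=
  c.ValidOn S ∧ |c.coefW| = 1 ∧
    ∀ c' : LinIneq n, c'.ValidOn S → |c'.coefW| = 1 → c'.violation q ≤ c.violation q

/-- The final state `s` answers the separation problem for the set `S` over the box `[lo, hi]` at
the point `q`: the natural register `0` tells whether `q ∈ S`, and if not, then `s` holds an
inequality that is valid on `S` and violated by `q`, a most violated one if the `y`-part of `q`
respects the bounds. -/
def AnswersSeparation {n : ℕ} (S : Set ((Fin n → ℝ) × ℝ)) (lo hi : Fin n → ℝ)
    (q : (Fin n → ℝ) × ℝ) (s : RealRAM.State) : Prop :=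
  (q ∈ S → s.natReg 0 = 1) ∧
  (q ∉ S → s.natReg 0 = 0 ∧
    (outputIneq n s).ValidOn S ∧ 0 < (outputIneq n s).violation q ∧
    (q.1 ∈ Set.Icc lo hi → (outputIneq n s).IsMostViolated S q))

/-! Write T for soft-thresholding and n = d + p. A point outside the box is cut off by the sum of
the bounds that it violates. For a point y of the box, T is odd, so changing the signs of a and w
exchanges lower and upper bounds. It is therefore enough to find an affine majorant of T(aᵀy) on the
box whose value at y is attained in the hull (`Supports`). Such a bound is automatically most
violated among those with |γ| = 1 (`isMostViolated_of_violation_eq_zero`).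

Put aᵀy = b + Σ Aᵢxᵢ, where b is the least value over the box, xᵢ ∈ [0,1] is the position of yᵢ
measured from the end where aᵢyᵢ is least, and Aᵢ ≥ 0. For μ ∈ [0,1] split y = (1-μ)y₀ + μz, where z
carries the part min(μ, xᵢ) of xᵢ. Since T(s) ≥ s - lam at z and T(s) ≥ min(0, s + lam) at y₀, the
hull reaches at least the smaller of φ(μ) = aᵀy + (1-2μ)lam and ψ(μ) = μ(b - lam) + Σ Aᵢ min(μ, xᵢ)
above y (`exists_mem_convexHull_softGraph`). Dually, θ(b + lam) + Σ κᵢAᵢxᵢ with 0 ≤ θ ≤ κᵢ ≤ 1 is a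
majorant as soon as it dominates s - lam, because it always dominates θ(s + lam)
(`softThreshold_dotProduct_le`). If its value at y is at most φ(μ) and ψ(μ) for some μ, it is tight
(`supports_of_certificate`).

Now φ decreases, and ψ is concave and piecewise linear with breakpoints xᵢ. The best μ is where the
two meet, or else a maximum of ψ. Except for two easy cases with μ = 0, one breakpoint r determines
everything: κᵢ is 1 for xᵢ < r, and the other multipliers follow from slopes at r
(`supports_of_crossing`, `supports_of_not_crossing`). The right slope of ψ at v is b - lam + Σ Aᵢ
over xᵢ > v, and φ(v) - ψ(v) = (1-v)(b + lam) + Σ Aᵢ(xᵢ - v) over xᵢ > v. So `Stop` with K = lam - b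
and c = -(b + lam) says that ψ no longer increases to the right of v or that φ(v) ≤ ψ(v).

The breakpoint is found by prune and search. Mass and moment of the discarded pairs are stored, so
testing a pivot costs one pass over the m active pairs (`Searching.sums_eq`). The pivot comes from
the second smallest members of groups of four: the same procedure, called recursively with weights 5
and K = 2k for k = ⌊m/4⌋, selects among them a value that has at least 6k/5 active pairs on either
side (`IsThreshold.balanced`). The two subproblems have sizes about m/4 and at most about 7m/10,
together less than m, so the time is linear (`runs_search`). -/

namespace RealRAM

/-- Started in `s`, the command halts after at most `T` steps in a state that satisfies `Q`. -/
def Runs (procs : List Cmd) (c : Cmd) (s : State) (T : ℕ) (Q : State → Prop) : Prop :=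
  ∃ t s', Exec procs c s t s' ∧ t ≤ T ∧ Q s'

/-! ### Total correctness with a time bound -/

section Rules

variable {procs : List Cmd} {c c₁ c₂ : Cmd} {b : Test} {s : State} {T T₁ T₂ : ℕ}
  {Q Q' : State → Prop}

theorem Runs.mono (h : Runs procs c s T₁ Q') (hT : T₁ ≤ T) (hQ : ∀ s', Q' s' → Q s') :
    Runs procs c s T Q := by
  obtain ⟨t, s', h, ht, hs⟩ := h
  exact ⟨t, s', h, ht.trans hT, hQ _ hs⟩

theorem Runs.seq (h : Runs procs c₁ s T₁ (fun s' => Runs procs c₂ s' T₂ Q)) :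
    Runs procs (.seq c₁ c₂) s (T₁ + T₂) Q := by
  obtain ⟨t₁, s₁, h₁, ht₁, t₂, s₂, h₂, ht₂, hQ⟩ := h
  exact ⟨_, s₂, .seq h₁ h₂, by omega, hQ⟩

theorem Runs.ite (h₁ : b.Holds s → Runs procs c₁ s T Q) (h₂ : ¬ b.Holds s → Runs procs c₂ s T Q) :
    Runs procs (.cond b c₁ c₂) s (T + 1) Q := by
  by_cases hb : b.Holds s
  · obtain ⟨t, s', h, ht, hQ⟩ := h₁ hb
    exact ⟨_, s', .condTrue hb h, by omega, hQ⟩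
  · obtain ⟨t, s', h, ht, hQ⟩ := h₂ hb
    exact ⟨_, s', .condFalse hb h, by omega, hQ⟩

theorem Runs.loopStep (hb : b.Holds s)
    (h : Runs procs c s T₁ (fun s' => Runs procs (.loop b c) s' T₂ Q)) :
    Runs procs (.loop b c) s (T₁ + T₂ + 1) Q := by
  obtain ⟨t₁, s₁, h₁, ht₁, t₂, s₂, h₂, ht₂, hQ⟩ := h
  exact ⟨_, s₂, .loopStep hb h₁ h₂, by omega, hQ⟩

theorem Runs.loopDone (hb : ¬ b.Holds s) (hQ : Q s) : Runs procs (.loop b c) s 1 Q :=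
  ⟨1, s, .loopDone hb, le_rfl, hQ⟩

theorem Runs.call {k : ℕ} (hk : procs[k]? = some c) (h : Runs procs c s T Q) :
    Runs procs (.call k) s (T + 1) Q := by
  obtain ⟨t, s', h, ht, hQ⟩ := h
  exact ⟨_, s', .call hk h, by omega, hQ⟩

theorem Runs.forLoop (Inv : ℕ → State → Prop) (n T : ℕ)
    (hstep : ∀ i < n, ∀ s, Inv i s → b.Holds s ∧ Runs procs c s T (Inv (i + 1)))
    (hdone : ∀ s, Inv n s → ¬ b.Holds s) (h0 : Inv 0 s) :
    Runs procs (.loop b c) s ((T + 1) * n + 1) (Inv n) := by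
  -- The induction is on the number k of rounds that remain, because the rule for a loop peels off
  -- its first round.
  suffices H : ∀ k i, i + k = n → ∀ s, Inv i s →
      Runs procs (.loop b c) s ((T + 1) * k + 1) (Inv n) from H n 0 (by omega) s h0
  intro k
  induction k with
  | zero =>
    rintro i rfl s hs
    exact (Runs.loopDone (hdone s hs) hs).mono (by omega) (fun _ => id)
  | succ k ih =>
    intro i hi s hs
    obtain ⟨hb, hr⟩ := hstep i (by omega) s hs
    refine (Runs.loopStep hb (hr.mono le_rfl fun s' hs' => ih (i + 1) (by omega) s' hs')).mono ?_
      (fun _ => id)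
    rw [Nat.mul_succ]
    omega

end Rules

/-! ### Programs without loops and calls -/

/-- The effect of a command without loops and calls. -/
noncomputable def Cmd.run : Cmd → State → State
  | .skip, s => s
  | .op o, s => o.apply s
  | .seq c₁ c₂, s => c₂.run (c₁.run s)
  | .cond b c₁ c₂, s => open Classical in if b.Holds s then c₁.run s else c₂.run s
  | .loop _ _, s => s
  | .call _, s => s

/-- A bound for the running time of a command without loops and calls. -/
def Cmd.cost : Cmd → ℕ
  | .skip => 1
  | .op _ => 1
  | .seq c₁ c₂ => c₁.cost + c₂.cost
  | .cond _ c₁ c₂ => max c₁.cost c₂.cost + 1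
  | .loop _ _ => 0
  | .call _ => 0

/-- The command has neither loops nor calls. -/
def Cmd.straight : Cmd → Bool
  | .skip => true
  | .op _ => true
  | .seq c₁ c₂ => c₁.straight && c₂.straight
  | .cond _ c₁ c₂ => c₁.straight && c₂.straight
  | .loop _ _ => false
  | .call _ => false

/-- Replaces the execution relation by the function `Cmd.run`, which `simp` can evaluate; the time
bound becomes the closed term `Cmd.cost`. -/
theorem Runs.of_straight {procs : List Cmd} {c : Cmd} {s : State} {Q : State → Prop}
    (hc : c.straight = true) (hQ : Q (c.run s)) : Runs procs c s c.cost Q := by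
  suffices H : ∀ (c : Cmd), c.straight = true → ∀ s,
      Runs procs c s c.cost (fun s' => s' = c.run s) from
    (H c hc s).mono le_rfl (by rintro _ rfl; exact hQ)
  intro c
  induction c with
  | skip => exact fun _ s => ⟨1, s, .skip s, le_rfl, rfl⟩
  | op o => exact fun _ s => ⟨1, _, .op o s, le_rfl, rfl⟩
  | seq c₁ c₂ ih₁ ih₂ =>
    intro h s
    simp only [Cmd.straight, Bool.and_eq_true] at h
    refine Runs.seq ((ih₁ h.1 s).mono le_rfl ?_)
    rintro _ rfl
    exact ih₂ h.2 _
  | cond b c₁ c₂ ih₁ ih₂ =>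
    intro h s
    simp only [Cmd.straight, Bool.and_eq_true] at h
    refine Runs.ite (fun hb => ?_) (fun hb => ?_)
    · exact (ih₁ h.1 s).mono (le_max_left _ _) (by rintro _ rfl; simp [Cmd.run, hb])
    · exact (ih₂ h.2 s).mono (le_max_right _ _) (by rintro _ rfl; simp [Cmd.run, hb])
  | loop => simp [Cmd.straight]
  | call => simp [Cmd.straight]

/-- Sequential composition of a list of commands. -/
def block : List Cmd → Cmd
  | [] => .skip
  | [c] => c
  | c :: c' :: cs => .seq c (block (c' :: cs))

/-- Sequential composition of a list of elementary instructions. -/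
def ops : List Op → Cmd
  | [] => .skip
  | o :: os => .seq (.op o) (ops os)

@[simp] theorem block_nil : block [] = .skip := rfl
@[simp] theorem block_singleton (c : Cmd) : block [c] = c := rfl
@[simp] theorem block_cons (c c' : Cmd) (cs : List Cmd) :
    block (c :: c' :: cs) = .seq c (block (c' :: cs)) := rfl
@[simp] theorem run_skip (s : State) : Cmd.run .skip s = s := rfl
@[simp] theorem run_seq (c₁ c₂ : Cmd) (s : State) : (Cmd.seq c₁ c₂).run s = c₂.run (c₁.run s) := rfl
@[simp] theorem run_ops_nil (s : State) : (ops []).run s = s := rfl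
@[simp] theorem run_ops_cons (o : Op) (os : List Op) (s : State) :
    (ops (o :: os)).run s = (ops os).run (o.apply s) := rfl

theorem run_cond_of {b : Test} {c₁ c₂ : Cmd} {s : State} (h : b.Holds s) :
    (Cmd.cond b c₁ c₂).run s = c₁.run s := by simp [Cmd.run, h]

theorem run_cond_of_not {b : Test} {c₁ c₂ : Cmd} {s : State} (h : ¬ b.Holds s) :
    (Cmd.cond b c₁ c₂).run s = c₂.run s := by simp [Cmd.run, h]

/-! ### Segments of memory that hold lists of pairs -/

/-- The memory holds the pairs of the list, one after the other from address `p` on. -/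
def Holds (mem : ℕ → ℝ) : ℕ → List (ℝ × ℝ) → Prop
  | _, [] => True
  | p, h :: t => mem p = h.1 ∧ mem (p + 1) = h.2 ∧ Holds mem (p + 2) t

theorem Holds.congr {mem mem' : ℕ → ℝ} {p : ℕ} {L : List (ℝ × ℝ)} (h : Holds mem p L)
    (hm : ∀ k, p ≤ k → k < p + 2 * L.length → mem' k = mem k) : Holds mem' p L := by
  induction L generalizing p with
  | nil => trivial
  | cons q t ih =>
    obtain ⟨h₁, h₂, h₃⟩ := h
    simp only [List.length_cons] at hm
    exact ⟨(hm _ (by omega) (by omega)).trans h₁, (hm _ (by omega) (by omega)).trans h₂,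
      ih h₃ fun k hk hk' => hm k (by omega) (by omega)⟩

theorem holds_map_range {mem : ℕ → ℝ} {p : ℕ} (n : ℕ) {f : ℕ → ℝ × ℝ}
    (h : ∀ j < n, mem (p + 2 * j) = (f j).1 ∧ mem (p + 2 * j + 1) = (f j).2) :
    Holds mem p ((List.range n).map f) := by
  induction n generalizing p f with
  | zero => trivial
  | succ n ih =>
    rw [List.range_succ_eq_map, List.map_cons, List.map_map]
    refine ⟨(h 0 (by omega)).1, (h 0 (by omega)).2, ih fun j hj => ?_⟩
    have := h (j + 1) (by omega)
    rw [show p + 2 * (j + 1) = p + 2 + 2 * j by ring] at this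
    exact this

/-! ### Masses and moments -/

/-- The total weight of the pairs with position above `v`. -/
noncomputable def massAbove (L : List (ℝ × ℝ)) (v : ℝ) : ℝ :=
  (L.map fun p => if v < p.1 then p.2 else 0).sum

/-- The total weight of the pairs with position `v` or above. -/
noncomputable def massFrom (L : List (ℝ × ℝ)) (v : ℝ) : ℝ :=
  (L.map fun p => if v ≤ p.1 then p.2 else 0).sum

/-- The first moment of the pairs with position above `v`. -/
noncomputable def momentAbove (L : List (ℝ × ℝ)) (v : ℝ) : ℝ :=
  (L.map fun p => if v < p.1 then p.2 * p.1 else 0).sum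

/-- Total weight. -/
noncomputable def mass (L : List (ℝ × ℝ)) : ℝ := (L.map fun p => p.2).sum

/-- First moment. -/
noncomputable def moment (L : List (ℝ × ℝ)) : ℝ := (L.map fun p => p.2 * p.1).sum

/-! ### Scanning a segment -/

/-- One step of `scan`. -/
def scanBody : Cmd := block [
  ops [.realLoad 30 23, .natConst 28 1, .natAdd 23 23 28, .realLoad 31 23, .natAdd 23 23 28,
    .natSub 22 22 28],
  .cond (.realLt 25 30) (ops [.realAdd 26 26 31, .realMul 32 31 30, .realAdd 27 27 32]) .skip,
  .cond (.realLe 25 30) (ops [.realAdd 28 28 31]) .skip]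

/-- Adds the mass and the moment above the real register `25` and the mass from there on to the real
registers `26`, `27` and `28`. The number of pairs is in the natural register `22`, their address
in `23`, and `26` is `0`. -/
def scan : Cmd := .loop (.natLt 26 22) scanBody

theorem runs_scan (procs : List Cmd) (L : List (ℝ × ℝ)) (s : State)
    (h0 : s.natReg 26 = 0) (hn : s.natReg 22 = L.length) (hL : Holds s.realMem (s.natReg 23) L) :
    Runs procs scan s (20 * L.length + 1) (fun s' =>
      s'.realMem = s.realMem ∧ s'.natMem = s.natMem ∧
      (∀ i, i ∉ [22, 23, 28] → s'.natReg i = s.natReg i) ∧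
      (∀ i, i ∉ [26, 27, 28, 30, 31, 32] → s'.realReg i = s.realReg i) ∧
      s'.realReg 26 = s.realReg 26 + massAbove L (s.realReg 25) ∧
      s'.realReg 27 = s.realReg 27 + momentAbove L (s.realReg 25) ∧
      s'.realReg 28 = s.realReg 28 + massFrom L (s.realReg 25)) := by
  induction L generalizing s with
  | nil =>
    refine Runs.loopDone (by simp [Test.Holds, h0, hn]) ?_
    simp [massAbove, momentAbove, massFrom]
  | cons q t ih =>
    obtain ⟨h₁, h₂, h₃⟩ := hL
    simp only [List.length_cons] at hn
    refine (Runs.loopStep (T₁ := scanBody.cost) (T₂ := 20 * t.length + 1)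
      (by simp [Test.Holds, h0, hn]) (Runs.of_straight rfl ?_)).mono ?_ (fun _ => id)
    -- The new state is hidden behind a variable, so that only the listed equations are used and the
    -- evaluated program does not reappear in later goals. The same device serves for every block
    -- below.
    · have key : ∃ s', scanBody.run s = s' ∧ s'.realMem = s.realMem ∧ s'.natMem = s.natMem ∧
          (∀ i, i ∉ [22, 23, 28] → s'.natReg i = s.natReg i) ∧
          (∀ i, i ∉ [26, 27, 28, 30, 31, 32] → s'.realReg i = s.realReg i) ∧
          s'.natReg 22 = t.length ∧ s'.natReg 23 = s.natReg 23 + 2 ∧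
          s'.realReg 26 = s.realReg 26 + (if s.realReg 25 < q.1 then q.2 else 0) ∧
          s'.realReg 27 = s.realReg 27 + (if s.realReg 25 < q.1 then q.2 * q.1 else 0) ∧
          s'.realReg 28 = s.realReg 28 + (if s.realReg 25 ≤ q.1 then q.2 else 0) := by
        refine ⟨_, rfl, ?_⟩
        by_cases hlt : s.realReg 25 < q.1 <;> by_cases hle : s.realReg 25 ≤ q.1 <;>
        simp +contextual [scanBody, Cmd.run, Op.apply, Test.Holds, h₁, h₂, hn,
          hlt, hle]
      obtain ⟨s', hs', e₁, e₂, e₃, e₄, e₅, e₆, e₇, e₈, e₉⟩ := key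
      rw [hs']
      have e25 := e₄ 25 (by simp)
      refine (ih s' ((e₃ 26 (by simp)).trans h0) e₅ (by rw [e₁, e₆]; exact h₃)).mono le_rfl ?_
      rintro s'' ⟨f₁, f₂, f₃, f₄, f₅, f₆, f₇⟩
      refine ⟨f₁.trans e₁, f₂.trans e₂, fun i hi => (f₃ i hi).trans (e₃ i hi),
        fun i hi => (f₄ i hi).trans (e₄ i hi), ?_, ?_, ?_⟩
      · rw [f₅, e₇, e25, massAbove, massAbove, List.map_cons, List.sum_cons, add_assoc]
      · rw [f₆, e₈, e25, momentAbove, momentAbove, List.map_cons, List.sum_cons, add_assoc]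
      · rw [f₇, e₉, e25, massFrom, massFrom, List.map_cons, List.sum_cons, add_assoc]
    · simp only [List.length_cons]
      have : scanBody.cost ≤ 19 := by decide
      omega

/-! ### Discarding part of a segment -/

/-- One step of `prune`. -/
def pruneBody : Cmd := block [
  ops [.realLoad 30 23, .natConst 28 1, .natAdd 23 23 28, .realLoad 31 23, .natAdd 23 23 28,
    .natSub 22 22 28, .realMul 34 29 30],
  .cond (.realLt 34 35)
    (ops [.realStore 24 30, .natAdd 24 24 28, .realStore 24 31, .natAdd 24 24 28, .natAdd 25 25 28])
    (ops [.realAdd 26 26 31, .realMul 32 31 30, .realAdd 27 27 32])]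

/-- Moves the pairs whose position, multiplied by the real register `29`, is less than the real
register `35`, to the address in the natural register `24`, adds their number to the natural register
`25`, and adds the mass and the moment of the others to the real registers `26` and `27`. The number
of pairs is in the natural register `22`, their address in `23`, and `26` is `0`. -/
def prune : Cmd := .loop (.natLt 26 22) pruneBody

/-- Compaction in place is safe: a round reads two cells before it writes at most two, so the write
address in `24` never overtakes the read address in `23`. The factor g lets one loop keep either
side: g = 1, θ = v keeps positions below v, and g = -1, θ = -v keeps those above. -/
theorem runs_prune (procs : List Cmd) (L : List (ℝ × ℝ)) (g θ : ℝ) (s : State)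
    (h0 : s.natReg 26 = 0) (hn : s.natReg 22 = L.length) (hg : s.realReg 29 = g)
    (hθ : s.realReg 35 = θ)
    (hw : s.natReg 24 ≤ s.natReg 23) (hL : Holds s.realMem (s.natReg 23) L) :
    Runs procs prune s (20 * L.length + 1) (fun s' =>
      (∀ k < s.natReg 24, s'.realMem k = s.realMem k) ∧ s'.natMem = s.natMem ∧
      (∀ i, i ∉ [22, 23, 24, 25, 28] → s'.natReg i = s.natReg i) ∧
      (∀ i, i ∉ [26, 27, 30, 31, 32, 34] → s'.realReg i = s.realReg i) ∧
      Holds s'.realMem (s.natReg 24) (L.filter fun q => g * q.1 < θ) ∧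
      s'.natReg 25 = s.natReg 25 + (L.filter fun q => g * q.1 < θ).length ∧
      s'.realReg 26 = s.realReg 26 + mass (L.filter fun q => ¬ g * q.1 < θ) ∧
      s'.realReg 27 = s.realReg 27 + moment (L.filter fun q => ¬ g * q.1 < θ)) := by
  induction L generalizing s with
  | nil =>
    refine Runs.loopDone (by simp [Test.Holds, h0, hn]) ?_
    simp [mass, moment, Holds]
  | cons q t ih =>
    obtain ⟨h₁, h₂, h₃⟩ := hL
    simp only [List.length_cons] at hn
    refine (Runs.loopStep (T₁ := pruneBody.cost) (T₂ := 20 * t.length + 1)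
      (by simp [Test.Holds, h0, hn]) (Runs.of_straight rfl ?_)).mono ?_ (fun _ => id)
    · by_cases hk : g * q.1 < θ
      · have key : ∃ s', pruneBody.run s = s' ∧
            s'.realMem = Function.update (Function.update s.realMem (s.natReg 24) q.1)
              (s.natReg 24 + 1) q.2 ∧
            s'.natMem = s.natMem ∧
            (∀ i, i ∉ [22, 23, 24, 25, 28] → s'.natReg i = s.natReg i) ∧
            (∀ i, i ∉ [26, 27, 30, 31, 32, 34] → s'.realReg i = s.realReg i) ∧
            s'.natReg 22 = t.length ∧ s'.natReg 23 = s.natReg 23 + 2 ∧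
            s'.natReg 24 = s.natReg 24 + 2 ∧ s'.natReg 25 = s.natReg 25 + 1 ∧
            s'.realReg 26 = s.realReg 26 ∧ s'.realReg 27 = s.realReg 27 := by
          refine ⟨_, rfl, ?_⟩
          simp +contextual [pruneBody, Cmd.run, Op.apply, Test.Holds, h₁, h₂, hn, hg, hθ, hk]
        obtain ⟨s', hs', e₁, e₂, e₃, e₄, e₅, e₆, e₇, e₈, e₉, e₁₀⟩ := key
        rw [hs']
        refine (ih s' ((e₃ 26 (by simp)).trans h0) e₅ ((e₄ 29 (by simp)).trans hg)
          ((e₄ 35 (by simp)).trans hθ) (by omega) ?_).mono le_rfl ?_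
        · rw [e₆]
          refine h₃.congr fun k hk _ => ?_
          rw [e₁, Function.update_of_ne (by omega), Function.update_of_ne (by omega)]
        rintro s'' ⟨f₁, f₂, f₃, f₄, f₅, f₆, f₇, f₈⟩
        have F : (q :: t).filter (fun q => g * q.1 < θ) = q :: t.filter (fun q => g * q.1 < θ) := by
          simp [hk]
        have F' : (q :: t).filter (fun q => ¬ g * q.1 < θ) = t.filter (fun q => ¬ g * q.1 < θ) := by
          simp [hk]
        rw [F, F']
        refine ⟨fun k hk => ?_, f₂.trans e₂, fun i hi => (f₃ i hi).trans (e₃ i hi),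
          fun i hi => (f₄ i hi).trans (e₄ i hi), ⟨?_, ?_, by rwa [e₇] at f₅⟩, ?_, ?_, ?_⟩
        · rw [f₁ k (by omega), e₁, Function.update_of_ne (by omega), Function.update_of_ne (by omega)]
        · rw [f₁ _ (by omega), e₁, Function.update_of_ne (by omega), Function.update_self]
        · rw [f₁ _ (by omega), e₁, Function.update_self]
        · rw [f₆, e₈, List.length_cons]; ring
        · rw [f₇, e₉]
        · rw [f₈, e₁₀]
      · have key : ∃ s', pruneBody.run s = s' ∧ s'.realMem = s.realMem ∧ s'.natMem = s.natMem ∧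
            (∀ i, i ∉ [22, 23, 28] → s'.natReg i = s.natReg i) ∧
            (∀ i, i ∉ [26, 27, 30, 31, 32, 34] → s'.realReg i = s.realReg i) ∧
            s'.natReg 22 = t.length ∧ s'.natReg 23 = s.natReg 23 + 2 ∧
            s'.realReg 26 = s.realReg 26 + q.2 ∧ s'.realReg 27 = s.realReg 27 + q.2 * q.1 := by
          refine ⟨_, rfl, ?_⟩
          simp +contextual [pruneBody, Cmd.run, Op.apply, Test.Holds, h₁, h₂, hn, hg, hθ, hk]
        obtain ⟨s', hs', e₁, e₂, e₃, e₄, e₅, e₆, e₇, e₈⟩ := key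
        rw [hs']
        have e24 := e₃ 24 (by simp)
        refine (ih s' ((e₃ 26 (by simp)).trans h0) e₅ ((e₄ 29 (by simp)).trans hg)
          ((e₄ 35 (by simp)).trans hθ) (by omega) (by rw [e₁, e₆]; exact h₃)).mono le_rfl ?_
        rintro s'' ⟨f₁, f₂, f₃, f₄, f₅, f₆, f₇, f₈⟩
        have F : (q :: t).filter (fun q => g * q.1 < θ) = t.filter (fun q => g * q.1 < θ) := by
          simp [hk]
        have F' : (q :: t).filter (fun q => ¬ g * q.1 < θ) =
            q :: t.filter (fun q => ¬ g * q.1 < θ) :=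
          List.filter_cons_of_pos (by simpa using hk)
        rw [F, F']
        refine ⟨fun k hk => ?_, f₂.trans e₂, fun i hi => (f₃ i hi).trans (e₃ i (by simp at hi ⊢; tauto)),
          fun i hi => (f₄ i hi).trans (e₄ i hi), by rwa [e24] at f₅, ?_, ?_, ?_⟩
        · rw [f₁ k (by omega), e₁]
        · rw [f₆, e₃ 25 (by simp)]
        · rw [f₇, e₇, mass, mass, List.map_cons, List.sum_cons, add_assoc]
        · rw [f₈, e₈, moment, moment, List.map_cons, List.sum_cons, add_assoc]
    · simp only [List.length_cons]
      have : pruneBody.cost ≤ 19 := by decide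
      omega

/-! ### Second smallest elements of groups of four -/

/-- The second smallest of four numbers. -/
noncomputable def secondSmallest (a b c d : ℝ) : ℝ :=
  min (min a b ⊔ min c d) (min (max a b) (max c d))

/-- The second smallest positions of consecutive groups of four pairs, with weight `5`. -/
noncomputable def groupPivots : List (ℝ × ℝ) → List (ℝ × ℝ)
  | a :: b :: c :: d :: t => (secondSmallest a.1 b.1 c.1 d.1, 5) :: groupPivots t
  | _ => []

/-- Sorts the real registers `i` and `j`. -/
def sortTwo (i j : ℕ) : Cmd := .cond (.realLe i j) .skip
  (ops [.realConst 38 0, .realAdd 37 i 38, .realAdd i j 38, .realAdd j 37 38])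

theorem run_sortTwo (i j : ℕ) (s : State) (hij : i ≠ j) (hi : i < 37) (hj : j < 37) :
    ((sortTwo i j).run s).realMem = s.realMem ∧ ((sortTwo i j).run s).natMem = s.natMem ∧
    ((sortTwo i j).run s).natReg = s.natReg ∧
    (∀ k, k ∉ [i, j, 37, 38] → ((sortTwo i j).run s).realReg k = s.realReg k) ∧
    ((sortTwo i j).run s).realReg i = min (s.realReg i) (s.realReg j) ∧
    ((sortTwo i j).run s).realReg j = max (s.realReg i) (s.realReg j) := by
  by_cases h : s.realReg i ≤ s.realReg j
  · rw [sortTwo, run_cond_of (b := .realLe i j) h]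
    simp [h]
  · rw [sortTwo, run_cond_of_not (b := .realLe i j) h]
    have h' := (not_le.1 h).le
    simp +contextual [Op.apply, hij, hi.ne', hj.ne, h',
      show 38 ≠ i by omega, show i ≠ 38 by omega, show j ≠ 38 by omega]

/-- One step of `collectPivots`. -/
def collectBody : Cmd := block [
  ops [.natConst 28 2, .realLoad 30 23, .natAdd 23 23 28, .realLoad 31 23, .natAdd 23 23 28,
    .realLoad 32 23, .natAdd 23 23 28, .realLoad 33 23, .natAdd 23 23 28, .natSub 22 22 27],
  sortTwo 30 31, sortTwo 32 33, sortTwo 30 32, sortTwo 31 33, sortTwo 31 32,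
  -- Natural numbers held in registers have no direct conversion to reals, so the count is also
  -- accumulated in the real register `36`; it becomes the parameter K of the recursive search.
  ops [.natConst 28 1, .realConst 38 5, .realStore 24 31, .natAdd 24 24 28, .realStore 24 38,
    .natAdd 24 24 28, .natAdd 25 25 28, .realConst 38 2, .realAdd 36 36 38]]

/-- Writes the pivots of the groups of four to the address in the natural register `24`, adds their
number to the natural register `25` and twice their number to the real register `36`. The number of
pairs is in the natural register `22`, their address in `23`, and `27` is `4`. -/
def collectPivots : Cmd := .loop (.natLe 27 22) collectBody

theorem groupPivots_of_length_lt {L : List (ℝ × ℝ)} (h : L.length < 4) : groupPivots L = [] := by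
  unfold groupPivots
  split
  · simp at h
    omega
  · rfl

/-- The five comparators form the usual sorting network for four numbers, which leaves the second
smallest in register `31`. Only positions are read, hence the steps of two in the address. -/
theorem run_collectBody (s : State) (a b c d : ℝ) (h4 : s.natReg 27 = 4)
    (ha : s.realMem (s.natReg 23) = a) (hb : s.realMem (s.natReg 23 + 2) = b)
    (hc : s.realMem (s.natReg 23 + 4) = c) (hd : s.realMem (s.natReg 23 + 6) = d) :
    ∃ s', collectBody.run s = s' ∧
      s'.realMem = Function.update (Function.update s.realMem (s.natReg 24)
        (secondSmallest a b c d)) (s.natReg 24 + 1) 5 ∧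
      s'.natMem = s.natMem ∧
      (∀ i, i ∉ [22, 23, 24, 25, 28] → s'.natReg i = s.natReg i) ∧
      (∀ i, i ∉ [30, 31, 32, 33, 36, 37, 38] → s'.realReg i = s.realReg i) ∧
      s'.natReg 22 = s.natReg 22 - 4 ∧ s'.natReg 23 = s.natReg 23 + 8 ∧
      s'.natReg 24 = s.natReg 24 + 2 ∧ s'.natReg 25 = s.natReg 25 + 1 ∧
      s'.realReg 36 = s.realReg 36 + 2 := by
  refine ⟨_, rfl, ?_⟩
  rw [collectBody]
  simp only [block_cons, block_singleton, run_seq]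
  generalize hs₀ : (ops [.natConst 28 2, .realLoad 30 23, .natAdd 23 23 28, .realLoad 31 23,
    .natAdd 23 23 28, .realLoad 32 23, .natAdd 23 23 28, .realLoad 33 23, .natAdd 23 23 28,
    .natSub 22 22 27]).run s = s₀
  have e : s₀.realMem = s.realMem ∧ s₀.natMem = s.natMem ∧
      (∀ i, i ∉ [22, 23, 28] → s₀.natReg i = s.natReg i) ∧
      (∀ i, i ∉ [30, 31, 32, 33] → s₀.realReg i = s.realReg i) ∧
      s₀.natReg 22 = s.natReg 22 - 4 ∧ s₀.natReg 23 = s.natReg 23 + 8 ∧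
      s₀.realReg 30 = a ∧ s₀.realReg 31 = b ∧ s₀.realReg 32 = c ∧ s₀.realReg 33 = d := by
    subst hs₀
    simp +contextual [Op.apply, h4, ha, hb, hc, hd, add_assoc]
  clear hs₀
  obtain ⟨e₁, e₂, e₃, e₄, e₅, e₆, e₇, e₈, e₉, e₁₀⟩ := e
  obtain ⟨a₁, a₂, a₃, a₄, a₅, a₆⟩ := run_sortTwo 30 31 s₀ (by simp) (by simp) (by simp)
  generalize (sortTwo 30 31).run s₀ = s₁ at *
  obtain ⟨b₁, b₂, b₃, b₄, b₅, b₆⟩ := run_sortTwo 32 33 s₁ (by simp) (by simp) (by simp)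
  generalize (sortTwo 32 33).run s₁ = s₂ at *
  obtain ⟨c₁, c₂, c₃, c₄, c₅, c₆⟩ := run_sortTwo 30 32 s₂ (by simp) (by simp) (by simp)
  generalize (sortTwo 30 32).run s₂ = s₃ at *
  obtain ⟨d₁, d₂, d₃, d₄, d₅, d₆⟩ := run_sortTwo 31 33 s₃ (by simp) (by simp) (by simp)
  generalize (sortTwo 31 33).run s₃ = s₄ at *
  obtain ⟨k₁, k₂, k₃, k₄, k₅, k₆⟩ := run_sortTwo 31 32 s₄ (by simp) (by simp) (by simp)
  generalize (sortTwo 31 32).run s₄ = s₅ at *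
  have hr : s₅.realReg 31 = secondSmallest a b c d := by
    rw [k₅, d₅, d₄ 32 (by simp), c₆, c₄ 31 (by simp), c₄ 33 (by simp), b₄ 31 (by simp), b₆, b₄ 30 (by simp), b₅,
      a₅, a₆, a₄ 32 (by simp), a₄ 33 (by simp), e₇, e₈, e₉, e₁₀, secondSmallest, min_comm]
  have hn : s₅.natReg = s₀.natReg := by rw [k₃, d₃, c₃, b₃, a₃]
  have hm : s₅.realMem = s.realMem := by rw [k₁, d₁, c₁, b₁, a₁, e₁]
  have hnm : s₅.natMem = s.natMem := by rw [k₂, d₂, c₂, b₂, a₂, e₂]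
  have hR : ∀ i, i ∉ [30, 31, 32, 33, 37, 38] → s₅.realReg i = s.realReg i := by
    intro i hi
    simp only [List.mem_cons, List.not_mem_nil, or_false, not_or] at *
    rw [k₄ i (by tauto), d₄ i (by tauto), c₄ i (by tauto), b₄ i (by tauto), a₄ i (by tauto),
      e₄ i (by tauto)]
  have h36 := hR 36 (by simp)
  have h24 := e₃ 24 (by simp)
  have h25 := e₃ 25 (by simp)
  clear k₁ k₂ k₃ k₄ k₅ k₆ d₁ d₂ d₃ d₄ d₅ d₆ c₁ c₂ c₃ c₄ c₅ c₆ b₁ b₂ b₃ b₄ b₅ b₆ a₁ a₂ a₃ a₄ a₅ a₆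
  simp +contextual [Op.apply, hn, hm, hnm, h36, h24, h25, e₃, e₅, e₆, hr, hR]

theorem runs_collectPivots (procs : List Cmd) (L : List (ℝ × ℝ)) (s : State)
    (h4 : s.natReg 27 = 4) (hn : s.natReg 22 = L.length)
    (hw : s.natReg 23 + 2 * L.length ≤ s.natReg 24) (hL : Holds s.realMem (s.natReg 23) L) :
    Runs procs collectPivots s (60 * (groupPivots L).length + 1) (fun s' =>
      (∀ k < s.natReg 24, s'.realMem k = s.realMem k) ∧ s'.natMem = s.natMem ∧
      (∀ i, i ∉ [22, 23, 24, 25, 28] → s'.natReg i = s.natReg i) ∧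
      (∀ i, i ∉ [30, 31, 32, 33, 36, 37, 38] → s'.realReg i = s.realReg i) ∧
      Holds s'.realMem (s.natReg 24) (groupPivots L) ∧
      s'.natReg 25 = s.natReg 25 + (groupPivots L).length ∧
      s'.realReg 36 = s.realReg 36 + 2 * (groupPivots L).length) := by
  induction L using groupPivots.induct generalizing s with
  | case2 L hL' =>
    have hlt : L.length < 4 := by
      match L, hL' with
      | [], _ => simp
      | [_], _ => simp
      | [_, _], _ => simp
      | [_, _, _], _ => simp
      | a :: b :: c :: d :: t, h => exact absurd rfl (h a b c d t)
    rw [groupPivots_of_length_lt hlt]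
    refine Runs.loopDone (by simp [Test.Holds, h4, hn, hlt]) ?_
    simp [Holds]
  | case1 a b c d t ih =>
    obtain ⟨ha, -, hb, -, hc, -, hd, -, h₃⟩ := hL
    simp only [List.length_cons] at hn hw
    obtain ⟨s', hs', e₁, e₂, e₃, e₄, e₅, e₆, e₇, e₈, e₉⟩ :=
      run_collectBody s a.1 b.1 c.1 d.1 h4 ha hb hc hd
    refine (Runs.loopStep (T₁ := collectBody.cost) (T₂ := 60 * (groupPivots t).length + 1)
      (by simp [Test.Holds, h4, hn]) (Runs.of_straight rfl ?_)).mono ?_ (fun _ => id)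
    · rw [hs']
      refine (ih s' ((e₃ 27 (by simp)).trans h4) (by omega) (by omega) ?_).mono le_rfl ?_
      · rw [e₆]
        refine h₃.congr fun k _ hk => ?_
        rw [e₁, Function.update_of_ne (by omega), Function.update_of_ne (by omega)]
      rintro s'' ⟨f₁, f₂, f₃, f₄, f₅, f₆, f₇⟩
      rw [groupPivots]
      refine ⟨fun k hk => ?_, f₂.trans e₂, fun i hi => (f₃ i hi).trans (e₃ i hi),
        fun i hi => (f₄ i hi).trans (e₄ i hi), ⟨?_, ?_, by rwa [e₇] at f₅⟩, ?_, ?_⟩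
      · rw [f₁ k (by omega), e₁, Function.update_of_ne (by omega), Function.update_of_ne (by omega)]
      · rw [f₁ _ (by omega), e₁, Function.update_of_ne (by omega), Function.update_self]
      · rw [f₁ _ (by omega), e₁, Function.update_self]
      · rw [f₆, e₈, List.length_cons]; ring
      · rw [f₇, e₉, List.length_cons]; push_cast; ring
    · rw [groupPivots, List.length_cons]
      have : collectBody.cost ≤ 58 := by decide
      omega

/-! ### Thresholds -/

/-- The search for a threshold may stop at `v`: the mass above `v` is at most `K`, or its excess
moment is at most `(1 - v) * c`. -/
def Stop (K c : ℝ) (L : List (ℝ × ℝ)) (v : ℝ) : Prop :=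
  massAbove L v ≤ K ∨ momentAbove L v - v * massAbove L v ≤ (1 - v) * c

/-- The position `r` is a point where the search stops, while it does not stop at the next lower
position of the list. -/
structure IsThreshold (K c : ℝ) (L : List (ℝ × ℝ)) (r : ℝ) : Prop where
  le_one : r ≤ 1
  eq_or_exists_le : r = 1 ∨ ∃ p ∈ L, p.1 ≤ r
  stops : Stop K c L r
  gap : (∀ p ∈ L, r ≤ p.1) ∨ ∃ u < r, ¬ Stop K c L u ∧ ∀ p ∈ L, p.1 ≤ u ∨ r ≤ p.1

/-- The state of a search in `L`: the best threshold so far is `r`, the pairs `M` are active, and the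
pairs that have been discarded above them have mass `S₁` and moment `S₂`. -/
structure Searching (K c : ℝ) (L : List (ℝ × ℝ)) (S₁ S₂ r : ℝ) (M : List (ℝ × ℝ)) : Prop where
  le_one : r ≤ 1
  eq_or_exists_le : r = 1 ∨ ∃ p ∈ L, p.1 ≤ r
  stops : Stop K c L r
  active_le : ∀ q ∈ M, q.1 ≤ r
  split : ∃ D R : List (ℝ × ℝ), L.Perm (D ++ (M ++ R)) ∧ S₁ = mass R ∧ S₂ = moment R ∧
    (∀ p ∈ R, r ≤ p.1) ∧ (∀ p ∈ R, ∀ q ∈ M, q.1 < p.1) ∧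
    (D = [] ∨ ∃ u < r, ¬ Stop K c L u ∧ (∀ p ∈ D, p.1 ≤ u) ∧ ∀ q ∈ M, u < q.1)

section Sums

variable {L L' : List (ℝ × ℝ)} {v : ℝ}

theorem massAbove_perm (h : L.Perm L') : massAbove L v = massAbove L' v :=
  (h.map _).sum_eq

theorem momentAbove_perm (h : L.Perm L') : momentAbove L v = momentAbove L' v :=
  (h.map _).sum_eq

theorem massAbove_append : massAbove (L ++ L') v = massAbove L v + massAbove L' v := by
  simp [massAbove]

theorem momentAbove_append : momentAbove (L ++ L') v = momentAbove L v + momentAbove L' v := by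
  simp [momentAbove]

theorem mass_append : mass (L ++ L') = mass L + mass L' := by simp [mass]

theorem moment_append : moment (L ++ L') = moment L + moment L' := by simp [moment]

theorem massAbove_of_le (h : ∀ p ∈ L, p.1 ≤ v) : massAbove L v = 0 :=
  List.sum_eq_zero fun x hx => by
    obtain ⟨p, hp, rfl⟩ := List.mem_map.1 hx
    exact if_neg (h p hp).not_gt

theorem momentAbove_of_le (h : ∀ p ∈ L, p.1 ≤ v) : momentAbove L v = 0 :=
  List.sum_eq_zero fun x hx => by
    obtain ⟨p, hp, rfl⟩ := List.mem_map.1 hx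
    exact if_neg (h p hp).not_gt

theorem massAbove_of_lt (h : ∀ p ∈ L, v < p.1) : massAbove L v = mass L := by
  rw [massAbove, mass]
  exact congrArg _ (List.map_congr_left fun p hp => if_pos (h p hp))

theorem momentAbove_of_lt (h : ∀ p ∈ L, v < p.1) : momentAbove L v = moment L := by
  rw [momentAbove, moment]
  exact congrArg _ (List.map_congr_left fun p hp => if_pos (h p hp))

end Sums

/-- No pair lies above 1, so both sides of the second clause vanish. This makes 1 a legitimate
initial threshold. -/
theorem stop_one {K c : ℝ} {L : List (ℝ × ℝ)} (h : ∀ p ∈ L, p.1 ≤ 1) : Stop K c L 1 := by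
  right
  simp [massAbove_of_le h, momentAbove_of_le h]

theorem Searching.start {K c : ℝ} {L : List (ℝ × ℝ)} (h : ∀ p ∈ L, p.1 ≤ 1) :
    Searching K c L 0 0 1 L where
  le_one := le_rfl
  eq_or_exists_le := .inl rfl
  stops := stop_one h
  active_le := h
  split := ⟨[], [], by simp, by simp [mass], by simp [moment], by simp, by simp, .inl rfl⟩

/-- Once no pair is active, every pair was discarded at or below some u where the rule fails, or at
or above r; nothing remains strictly between. -/
theorem Searching.isThreshold {K c : ℝ} {L : List (ℝ × ℝ)} {S₁ S₂ r : ℝ}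
    (h : Searching K c L S₁ S₂ r []) : IsThreshold K c L r where
  le_one := h.le_one
  eq_or_exists_le := h.eq_or_exists_le
  stops := h.stops
  gap := by
    obtain ⟨D, R, hp, -, -, hR, -, hD⟩ := h.split
    rcases hD with rfl | ⟨u, hu, hs, hD, -⟩
    · exact .inl fun p hpL => hR p (by simpa using hp.subset hpL)
    · refine .inr ⟨u, hu, hs, fun p hpL => ?_⟩
      have := hp.subset hpL
      simp only [List.nil_append, List.mem_append] at this
      exact this.imp (hD p) (hR p)

section Step

variable {K c : ℝ} {L M : List (ℝ × ℝ)} {S₁ S₂ r v : ℝ}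

/-- A value within the range of the active positions is strictly below everything in R and not below
anything in D. So R contributes its whole mass and moment and D nothing, and the rule for L can be
tested by a pass over M alone. -/
theorem Searching.sums_eq (h : Searching K c L S₁ S₂ r M) (hge : ∃ q ∈ M, v ≤ q.1)
    (hle : ∃ q ∈ M, q.1 ≤ v) :
    massAbove L v = S₁ + massAbove M v ∧ momentAbove L v = S₂ + momentAbove M v := by
  obtain ⟨D, R, hp, rfl, rfl, -, hRM, hD⟩ := h.split
  obtain ⟨q, hq, hvq⟩ := hge
  obtain ⟨q', hq', hvq'⟩ := hle
  have hR : ∀ p ∈ R, v < p.1 := fun p hp => hvq.trans_lt (hRM p hp q hq)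
  have hD' : ∀ p ∈ D, p.1 ≤ v := by
    rcases hD with rfl | ⟨u, -, -, hD, hM⟩
    · simp
    · exact fun p hp => (hD p hp).trans ((hM q' hq').le.trans hvq')
  rw [massAbove_perm hp, momentAbove_perm hp]
  simp only [massAbove_append, momentAbove_append, massAbove_of_le hD', momentAbove_of_le hD',
    massAbove_of_lt hR, momentAbove_of_lt hR]
  constructor <;> ring

/-- Here v becomes the best threshold and the pairs at v or above join R. The old witness u stays
below v, since u is below every active position and one of these is at most v. -/
theorem Searching.lower (h : Searching K c L S₁ S₂ r M) (hge : ∃ q ∈ M, v ≤ q.1)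
    (hle : ∃ q ∈ M, q.1 ≤ v) (hv : Stop K c L v) :
    Searching K c L (S₁ + mass (M.filter fun q => ¬ q.1 < v))
      (S₂ + moment (M.filter fun q => ¬ q.1 < v)) v (M.filter fun q => q.1 < v) := by
  obtain ⟨D, R, hp, rfl, rfl, hR, hRM, hD⟩ := h.split
  obtain ⟨q, hq, hvq⟩ := hge
  obtain ⟨q', hq', hvq'⟩ := hle
  have hvr : v ≤ r := hvq.trans (h.active_le q hq)
  refine ⟨hvr.trans h.le_one, .inr ⟨q', hp.symm.subset (by simp [hq']), hvq'⟩, hv, ?_, D,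
    M.filter (fun q => ¬ q.1 < v) ++ R, hp.trans ?_, ?_, ?_, ?_, ?_, ?_⟩
  · simp +contextual [le_of_lt]
  · rw [← List.append_assoc (M.filter _)]
    refine ((List.filter_append_perm (fun q : ℝ × ℝ => decide (q.1 < v)) M).symm.trans ?_
      |>.append_right R).append_left D
    exact List.Perm.of_eq (by simp only [decide_not])
  · rw [mass_append, add_comm]
  · rw [moment_append, add_comm]
  · simp only [List.mem_append, List.mem_filter, decide_eq_true_eq, not_lt]
    rintro p (⟨-, hp⟩ | hp)
    exacts [hp, hvr.trans (hR p hp)]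
  · simp only [List.mem_append, List.mem_filter, decide_eq_true_eq, not_lt]
    rintro p (⟨-, hp⟩ | hp) k ⟨hk, hkv⟩
    exacts [hkv.trans_le hp, hRM p hp k hk]
  · refine hD.imp id ?_
    rintro ⟨u, hu, hs, hD, hM⟩
    exact ⟨u, (hM q' hq').trans_le hvq', hs, hD, fun k hk => hM k (List.mem_filter.1 hk).1⟩

/-- The value v is itself the new witness u. It is at most some active position, hence at most r,
and it differs from r because the rule holds at r. Neither this step nor `Searching.lower` needs
`Stop` to be monotone. -/
theorem Searching.raise (h : Searching K c L S₁ S₂ r M) (hge : ∃ q ∈ M, v ≤ q.1)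
    (hle : ∃ q ∈ M, q.1 ≤ v) (hv : ¬ Stop K c L v) :
    Searching K c L S₁ S₂ r (M.filter fun q => v < q.1) := by
  obtain ⟨D, R, hp, hS₁, hS₂, hR, hRM, hD⟩ := h.split
  obtain ⟨q, hq, hvq⟩ := hge
  obtain ⟨q', hq', hvq'⟩ := hle
  have hvr : v < r := (hvq.trans (h.active_le q hq)).lt_of_ne (by rintro rfl; exact hv h.stops)
  refine ⟨h.le_one, h.eq_or_exists_le, h.stops,
    fun k hk => h.active_le k (List.mem_filter.1 hk).1,
    D ++ M.filter (fun q => ¬ v < q.1), R, hp.trans ?_, hS₁, hS₂, hR,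
    fun p hp k hk => hRM p hp k (List.mem_filter.1 hk).1, .inr ⟨v, hvr, hv, ?_, ?_⟩⟩
  · rw [List.append_assoc, ← List.append_assoc (M.filter _)]
    refine ((List.filter_append_perm (fun q : ℝ × ℝ => decide (v < q.1)) M).symm.trans
      (List.perm_append_comm.trans ?_) |>.append_right R).append_left D
    exact List.Perm.of_eq (by simp only [decide_not])
  · simp only [List.mem_append, List.mem_filter, decide_eq_true_eq, not_lt]
    rintro p (hp | ⟨-, hp⟩)
    · rcases hD with rfl | ⟨u, -, -, hD, hM⟩
      · simp at hp
      · exact (hD p hp).trans ((hM q' hq').le.trans hvq')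
    · exact hp
  · simp

end Step

/-! ### Quality of the pivots -/

/-- In the min-max formula, a second smallest number at least v means that one of the two pairs has
both members at least v and the other has its larger member at least v: three of the four. -/
theorem three_mul_countP_groupPivots_le (L : List (ℝ × ℝ)) (v : ℝ) :
    3 * (groupPivots L).countP (fun q => v ≤ q.1) ≤ L.countP fun q => v ≤ q.1 := by
  induction L using groupPivots.induct with
  | case2 L h =>
    unfold groupPivots
    split
    · exact absurd rfl (h _ _ _ _ _)
    · simp
  | case1 a b c d t ih =>
    simp only [groupPivots, List.countP_cons, secondSmallest, le_min_iff, le_max_iff,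
      decide_eq_true_eq]
    split_ifs <;> first | omega | (exfalso; tauto)

/-- A second smallest number at most v means that both pairs have their smaller member at most v, or
one pair has both: two of the four. -/
theorem two_mul_countP_groupPivots_le (L : List (ℝ × ℝ)) (v : ℝ) :
    2 * (groupPivots L).countP (fun q => q.1 ≤ v) ≤ L.countP fun q => q.1 ≤ v := by
  induction L using groupPivots.induct with
  | case2 L h =>
    unfold groupPivots
    split
    · exact absurd rfl (h _ _ _ _ _)
    · simp
  | case1 a b c d t ih =>
    simp only [groupPivots, List.countP_cons, secondSmallest, min_le_iff, max_le_iff,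
      decide_eq_true_eq]
    split_ifs <;> first | omega | (exfalso; tauto)

theorem length_groupPivots (L : List (ℝ × ℝ)) : (groupPivots L).length = L.length / 4 := by
  induction L using groupPivots.induct with
  | case2 L h =>
    have : L.length < 4 := by
      match L, h with
      | [], _ => simp
      | [_], _ => simp
      | [_, _], _ => simp
      | [_, _, _], _ => simp
      | a :: b :: c :: d :: t, h => exact absurd rfl (h a b c d t)
    rw [groupPivots_of_length_lt this, List.length_nil]
    omega
  | case1 a b c d t ih =>
    simp only [groupPivots, List.length_cons, ih]
    omega

theorem groupPivots_snd {L : List (ℝ × ℝ)} {p : ℝ × ℝ} (hp : p ∈ groupPivots L) : p.2 = 5 := by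
  induction L using groupPivots.induct with
  | case2 L h =>
    unfold groupPivots at hp
    split at hp
    · exact absurd rfl (h _ _ _ _ _)
    · simp at hp
  | case1 a b c d t ih =>
    simp only [groupPivots, List.mem_cons] at hp
    rcases hp with rfl | hp
    exacts [rfl, ih hp]

theorem groupPivots_le_one {L : List (ℝ × ℝ)} (hL : ∀ p ∈ L, p.1 ≤ 1) {p : ℝ × ℝ}
    (hp : p ∈ groupPivots L) : p.1 ≤ 1 := by
  induction L using groupPivots.induct with
  | case2 L h =>
    unfold groupPivots at hp
    split at hp
    · exact absurd rfl (h _ _ _ _ _)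
    · simp at hp
  | case1 a b c d t ih =>
    simp only [groupPivots, List.mem_cons] at hp
    rcases hp with rfl | hp
    · simp only [secondSmallest, min_le_iff, max_le_iff]
      have ha := hL a (by simp)
      have hb := hL b (by simp)
      have hc := hL c (by simp)
      have hd := hL d (by simp)
      tauto
    · exact ih (fun p hp => hL p (by simp [hp])) hp

theorem massAbove_eq_countP {L : List (ℝ × ℝ)} {w : ℝ} (hw : ∀ p ∈ L, p.2 = w) (v : ℝ) :
    massAbove L v = w * (L.countP fun q => v < q.1 : ℕ) := by
  induction L with
  | nil => simp [massAbove]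
  | cons a t ih =>
    rw [massAbove, List.map_cons, List.sum_cons, ← massAbove, ih fun p hp => hw p (by simp [hp]),
      List.countP_cons, hw a (by simp)]
    simp only [decide_eq_true_eq]
    split_ifs <;> push_cast <;> ring

theorem mul_massAbove_le_momentAbove {L : List (ℝ × ℝ)} (hw : ∀ p ∈ L, 0 ≤ p.2) (v : ℝ) :
    v * massAbove L v ≤ momentAbove L v := by
  rw [massAbove, momentAbove, ← List.sum_map_mul_left]
  refine List.sum_le_sum fun p hp => ?_
  split_ifs with h
  · rw [mul_comm]
    exact mul_le_mul_of_nonneg_left h.le (hw p hp)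
  · simp

/-- A threshold of the pivots of the groups, for `K` equal to twice their number, has many elements
of the list on either side. -/
theorem IsThreshold.balanced {L : List (ℝ × ℝ)} {v : ℝ} (hL : ∀ p ∈ L, p.1 ≤ 1)
    (h4 : 4 ≤ L.length)
    (h : IsThreshold (2 * ((L.length / 4 : ℕ) : ℝ)) (-1) (groupPivots L) v) :
    6 * (L.length / 4) ≤ 5 * (L.countP fun q => v ≤ q.1) ∧
      6 * (L.length / 4) ≤ 5 * L.countP fun q => q.1 ≤ v := by
  set N := groupPivots L with hN
  set k := L.length / 4 with hk
  have hNk : N.length = k := length_groupPivots L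
  have hw : ∀ p ∈ N, p.2 = 5 := fun p hp => groupPivots_snd hp
  have hw0 : ∀ p ∈ N, 0 ≤ p.2 := fun p hp => by rw [hw p hp]; norm_num
  have hN1 : ∀ p ∈ N, p.1 ≤ 1 := fun p hp => groupPivots_le_one hL hp
  have hk1 : 1 ≤ k := by omega
  have above : 5 * N.countP (fun q => v < q.1) ≤ 2 * k := by
    rcases h.stops with hs | hs
    · rw [massAbove_eq_countP hw] at hs
      exact_mod_cast hs
    -- The excess moment is nonnegative, so with c = -1 the second clause forces v = 1, where
    -- nothing lies above. The parameter c thus switches this clause off.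
    · have h1 := mul_massAbove_le_momentAbove hw0 v
      have hv : v = 1 := le_antisymm h.le_one (by linarith)
      have : massAbove N v = 0 := massAbove_of_le (by rwa [hv])
      rw [massAbove_eq_countP hw] at this
      have : N.countP (fun q => v < q.1) = 0 := by
        have h5 : (5 : ℝ) ≠ 0 := by norm_num
        exact_mod_cast (mul_eq_zero.1 this).resolve_left h5
      omega
  have upper : 2 * k < 5 * N.countP (fun q => v ≤ q.1) := by
    -- Failure of the rule at u includes failure of its mass clause, and the pivots above u are
    -- exactly of the kind counted at v or above.
    rcases h.gap with hg | ⟨u, -, hs, hg⟩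
    · have : N.countP (fun q => v ≤ q.1) = N.length :=
        List.countP_eq_length.2 fun p hp => by simpa using hg p hp
      omega
    · have h1 : 2 * (k : ℝ) < massAbove N u := by
        by_contra hc
        exact hs (.inl (not_lt.1 hc))
      rw [massAbove_eq_countP hw] at h1
      have h2 : N.countP (fun q => u < q.1) ≤ N.countP (fun q => v ≤ q.1) := by
        refine List.countP_mono_left fun p hp hu => ?_
        simp only [decide_eq_true_eq] at hu ⊢
        exact (hg p hp).resolve_left hu.not_ge
      have h3 : 2 * k < 5 * N.countP (fun q => u < q.1) := by exact_mod_cast h1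
      omega
  have hsum : N.length = N.countP (fun q => v < q.1) + N.countP (fun q => q.1 ≤ v) := by
    rw [List.length_eq_countP_add_countP (fun q : ℝ × ℝ => decide (v < q.1))]
    simp
  -- More than 2k/5 pivots are at least v, each with three members of its group; at least 3k/5 are
  -- at most v, each with two. The share 2/5 is chosen so that both products are 6k/5.
  have h3 := three_mul_countP_groupPivots_le L v
  have h2 := two_mul_countP_groupPivots_le L v
  rw [← hN] at h3 h2
  omega

/-! ### The search procedure

Natural registers: `20` address and `21` number of the active pairs, `26` the constant `0`, `27` the
constant `4`. Real registers: `20` and `21` the parameters of the stopping rule, `22` and `23` mass and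
moment of the pairs discarded above, `24` the best threshold so far, `25` the pivot. -/

/-- Saves the registers behind the active pairs. -/
def saveSearch : Cmd := ops [.natAdd 23 20 26, .natAdd 22 21 26, .natAdd 24 20 21, .natAdd 24 24 21,
  .natConst 28 1, .realStore 24 20, .natAdd 24 24 28, .realStore 24 21, .natAdd 24 24 28,
  .realStore 24 22, .natAdd 24 24 28, .realStore 24 23, .natStore 24 20, .natAdd 24 24 28,
  .realStore 24 24, .natStore 24 21, .natAdd 24 24 28, .natAdd 29 24 26, .natConst 25 0,
  .realConst 36 0]

/-- Starts a search among the pivots of the groups. -/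
def enterSearch : Cmd := ops [.natAdd 20 29 26, .natAdd 21 25 26, .realConst 38 0, .realAdd 20 36 38,
  .realConst 39 1, .realSub 21 38 39, .realConst 22 0, .realConst 23 0, .realConst 24 1]

/-- Takes the result of the search as pivot and restores the registers. -/
def leaveSearch : Cmd := ops [.realConst 38 0, .realAdd 25 24 38, .natConst 28 1, .natSub 24 20 28,
  .natLoad 21 24, .realLoad 24 24, .natSub 24 24 28, .natLoad 20 24, .realLoad 23 24,
  .natSub 24 24 28, .realLoad 22 24, .natSub 24 24 28, .realLoad 21 24, .natSub 24 24 28,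
  .realLoad 20 24]

/-- Chooses a pivot among the active pairs. -/
def choosePivot : Cmd := .cond (.natLt 21 27) (ops [.realLoad 25 20])
  (block [saveSearch, collectPivots, enterSearch, .call 0, leaveSearch])

/-- Prepares a scan of the active pairs. -/
def prepareScan : Cmd := ops [.natAdd 23 20 26, .natAdd 22 21 26, .realConst 26 0, .realConst 27 0,
  .realConst 28 0]

/-- The search may stop at the pivot: lower positions are to be kept. -/
def keepLower : Cmd := ops [.natConst 29 1, .realConst 29 1, .realConst 32 0, .realAdd 35 25 32]

/-- The search may not stop at the pivot: higher positions are to be kept. -/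
def keepHigher : Cmd := ops [.natConst 29 0, .realConst 29 1, .realConst 32 0, .realSub 29 32 29,
  .realSub 35 32 25]

/-- Evaluates the stopping rule at the pivot and prepares to prune the active pairs. -/
def decideStop : Cmd := block [
  ops [.realAdd 26 22 26, .realAdd 27 23 27, .realMul 32 25 26, .realSub 32 27 32, .realConst 33 1,
    .realSub 33 33 25, .realMul 33 33 21],
  .cond (.realLe 26 20) keepLower (.cond (.realLe 32 33) keepLower keepHigher),
  ops [.natAdd 23 20 26, .natAdd 22 21 26, .natAdd 24 20 26, .natConst 25 0, .realConst 26 0,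
    .realConst 27 0]]

/-- Updates the search after the active pairs have been pruned. -/
def finishStep : Cmd := block [ops [.natAdd 21 25 26],
  .cond (.natLt 26 29) (ops [.realAdd 22 22 26, .realAdd 23 23 27, .realConst 32 0,
    .realAdd 24 25 32]) .skip]

/-- Discards the active pairs on one side of the pivot. -/
def narrow : Cmd := block [prepareScan, scan, decideStop, prune, finishStep]

/-- Searches for a threshold. -/
def search : Cmd := .loop (.natLt 26 21) (.seq choosePivot narrow)

/-- What a search preserves. -/
structure Preserved (B : ℕ) (s s' : State) : Prop where
  realMem : ∀ k < B, s'.realMem k = s.realMem k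
  natMem : ∀ k < B, s'.natMem k = s.natMem k
  realReg : ∀ i < 20, s'.realReg i = s.realReg i
  natReg : ∀ i < 20, s'.natReg i = s.natReg i
  natReg20 : s'.natReg 20 = s.natReg 20
  natReg26 : s'.natReg 26 = s.natReg 26
  natReg27 : s'.natReg 27 = s.natReg 27

theorem Preserved.trans {B : ℕ} {s s' s'' : State} (h : Preserved B s s')
    (h' : Preserved B s' s'') : Preserved B s s'' where
  realMem k hk := (h'.realMem k hk).trans (h.realMem k hk)
  natMem k hk := (h'.natMem k hk).trans (h.natMem k hk)
  realReg k hk := (h'.realReg k hk).trans (h.realReg k hk)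
  natReg k hk := (h'.natReg k hk).trans (h.natReg k hk)
  natReg20 := h'.natReg20.trans h.natReg20
  natReg26 := h'.natReg26.trans h.natReg26
  natReg27 := h'.natReg27.trans h.natReg27

theorem Preserved.refl (B : ℕ) (s : State) : Preserved B s s where
  realMem _ _ := rfl
  natMem _ _ := rfl
  realReg _ _ := rfl
  natReg _ _ := rfl
  natReg20 := rfl
  natReg26 := rfl
  natReg27 := rfl

/-- The state of the machine during a search in `L`, with active pairs `M` at address `B`. -/
structure InSearch (K c : ℝ) (L : List (ℝ × ℝ)) (B : ℕ) (M : List (ℝ × ℝ)) (s : State) : Prop where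
  address : s.natReg 20 = B
  length : s.natReg 21 = M.length
  zero : s.natReg 26 = 0
  four : s.natReg 27 = 4
  par₁ : s.realReg 20 = K
  par₂ : s.realReg 21 = c
  active : Holds s.realMem B M
  searching : Searching K c L (s.realReg 22) (s.realReg 23) (s.realReg 24) M

/-- Two passes over M suffice: one for the sums in the rule, to which the stored sums of the
discarded pairs are added, and one for compaction. All writing happens in the segment of M, so
nothing below B changes. The two outcomes are `Searching.lower` and `Searching.raise`. -/
theorem runs_narrow (procs : List Cmd) {K c : ℝ} {L : List (ℝ × ℝ)} {B : ℕ} {M : List (ℝ × ℝ)}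
    {s : State} (h : InSearch K c L B M s) (hge : ∃ q ∈ M, s.realReg 25 ≤ q.1)
    (hle : ∃ q ∈ M, q.1 ≤ s.realReg 25) :
    Runs procs narrow s (40 * M.length + 60) (fun s' => Preserved B s s' ∧
      (InSearch K c L B (M.filter fun q => q.1 < s.realReg 25) s' ∨
        InSearch K c L B (M.filter fun q => s.realReg 25 < q.1) s')) := by
  obtain ⟨hB, hlen, h0, h4, hK, hc, hM, hS⟩ := h
  rw [narrow]
  simp only [block_cons, block_singleton]
  suffices H : Runs procs (.seq prepareScan (.seq scan (.seq decideStop (.seq prune finishStep)))) s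
      (prepareScan.cost + ((20 * M.length + 1) + (decideStop.cost + ((20 * M.length + 1) +
        finishStep.cost)))) (fun s' => Preserved B s s' ∧
      (InSearch K c L B (M.filter fun q => q.1 < s.realReg 25) s' ∨
        InSearch K c L B (M.filter fun q => s.realReg 25 < q.1) s')) by
    refine H.mono ?_ (fun _ => id)
    have h₁ : prepareScan.cost = 6 := by decide
    have h₂ : decideStop.cost ≤ 25 := by decide
    have h₃ : finishStep.cost ≤ 10 := by decide
    omega
  refine Runs.seq (Runs.of_straight rfl ?_)
  have e : ∃ s₁, prepareScan.run s = s₁ ∧ s₁.realMem = s.realMem ∧ s₁.natMem = s.natMem ∧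
      (∀ i, i ∉ [22, 23] → s₁.natReg i = s.natReg i) ∧
      (∀ i, i ∉ [26, 27, 28] → s₁.realReg i = s.realReg i) ∧ s₁.natReg 22 = M.length ∧
      s₁.natReg 23 = B ∧ s₁.realReg 26 = 0 ∧ s₁.realReg 27 = 0 := by
    refine ⟨_, rfl, ?_⟩
    simp +contextual [prepareScan, Op.apply, hB, hlen, h0]
  obtain ⟨s₁, hs₁, a₁, a₂, a₃, a₄, a₅, a₆, a₇, a₈⟩ := e
  rw [hs₁]
  clear hs₁
  refine Runs.seq ((runs_scan procs M s₁ ((a₃ 26 (by simp)).trans h0) a₅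
    (by rw [a₁, a₆]; exact hM)).mono le_rfl ?_)
  rintro s₂ ⟨b₁, b₂, b₃, b₄, b₅, b₆, -⟩
  rw [a₄ 25 (by simp), a₇, zero_add] at b₅
  rw [a₄ 25 (by simp), a₈, zero_add] at b₆
  replace b₁ := b₁.trans a₁
  replace b₂ := b₂.trans a₂
  replace b₃ : ∀ i, i ∉ [22, 23, 28] → s₂.natReg i = s.natReg i := fun i hi =>
    (b₃ i hi).trans (a₃ i (by simp at hi ⊢; tauto))
  replace b₄ : ∀ i, i ∉ [26, 27, 28, 30, 31, 32] → s₂.realReg i = s.realReg i := fun i hi =>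
    (b₄ i hi).trans (a₄ i (by simp at hi ⊢; tauto))
  clear a₁ a₂ a₃ a₄ a₅ a₆ a₇ a₈ s₁
  obtain ⟨hm₁, hm₂⟩ := hS.sums_eq hge hle
  set v := s.realReg 25 with hv
  refine Runs.seq (Runs.of_straight rfl ?_)
  have e : ∃ s₃, decideStop.run s₂ = s₃ ∧ s₃.realMem = s.realMem ∧ s₃.natMem = s.natMem ∧
      (∀ i, i ∉ [22, 23, 24, 25, 28, 29] → s₃.natReg i = s.natReg i) ∧
      (∀ i, i ∉ [26, 27, 28, 29, 30, 31, 32, 33, 35] → s₃.realReg i = s.realReg i) ∧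
      s₃.natReg 22 = M.length ∧ s₃.natReg 23 = B ∧ s₃.natReg 24 = B ∧ s₃.natReg 25 = 0 ∧
      s₃.realReg 26 = 0 ∧ s₃.realReg 27 = 0 ∧
      (Stop K c L v ∧ s₃.natReg 29 = 1 ∧ s₃.realReg 29 = 1 ∧ s₃.realReg 35 = v ∨
        ¬ Stop K c L v ∧ s₃.natReg 29 = 0 ∧ s₃.realReg 29 = -1 ∧ s₃.realReg 35 = -v) := by
    refine ⟨_, rfl, ?_⟩
    have c22 := b₄ 22 (by simp)
    have c23 := b₄ 23 (by simp)
    have c25 := b₄ 25 (by simp)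
    have c20 := (b₄ 20 (by simp)).trans hK
    have c21 := (b₄ 21 (by simp)).trans hc
    have d20 := (b₃ 20 (by simp)).trans hB
    have d21 := (b₃ 21 (by simp)).trans hlen
    have d26 := (b₃ 26 (by simp)).trans h0
    rw [← hv] at c25
    by_cases t₁ : massAbove L v ≤ K
    · have t : Stop K c L v := .inl t₁
      rw [hm₁] at t₁
      simp +contextual [decideStop, keepLower, Cmd.run, Op.apply, Test.Holds, c22, c23, c25, c20,
        c21, d20, d21, d26, b₁, b₂, b₃, b₄, b₅, b₆, t₁, t]
    · by_cases t₂ : momentAbove L v - v * massAbove L v ≤ (1 - v) * c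
      · have t : Stop K c L v := .inr t₂
        rw [hm₁] at t₁
        rw [hm₁, hm₂] at t₂
        simp +contextual [decideStop, keepLower, Cmd.run, Op.apply, Test.Holds, c22, c23, c25, c20,
          c21, d20, d21, d26, b₁, b₂, b₃, b₄, b₅, b₆, t₁, t₂, t]
      · have t : ¬ Stop K c L v := by rintro (h | h) <;> contradiction
        rw [hm₁] at t₁
        rw [hm₁, hm₂] at t₂
        simp +contextual [decideStop, keepHigher, Cmd.run, Op.apply, Test.Holds, c22, c23, c25, c20,
          c21, d20, d21, d26, b₁, b₂, b₃, b₄, b₅, b₆, t₁, t₂, t]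
  obtain ⟨s₃, hs₃, a₁, a₂, a₃, a₄, a₅, a₆, a₇, a₈, a₉, a₁₀, hd⟩ := e
  rw [hs₃]
  clear hs₃ b₁ b₂ b₃ b₄ b₅ b₆ s₂
  refine Runs.seq ((runs_prune procs M _ _ s₃ ((a₃ 26 (by simp)).trans h0) a₅ rfl rfl
    (by omega) (by rw [a₁, a₆]; exact hM)).mono le_rfl ?_)
  rintro s₄ ⟨b₁, b₂, b₃, b₄, b₅, b₆, b₇, b₈⟩
  rw [a₇] at b₁ b₅
  rw [a₈, zero_add] at b₆
  rw [a₉, zero_add] at b₇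
  rw [a₁₀, zero_add] at b₈
  replace b₁ : ∀ k < B, s₄.realMem k = s.realMem k := fun k hk => by rw [b₁ k hk, a₁]
  replace b₂ := b₂.trans a₂
  replace a₃ : ∀ i, i ∉ [22, 23, 24, 25, 28, 29] → s₄.natReg i = s.natReg i := fun i hi =>
    (b₃ i (by simp at hi ⊢; tauto)).trans (a₃ i hi)
  replace a₄ : ∀ i, i ∉ [26, 27, 28, 29, 30, 31, 32, 33, 34, 35] → s₄.realReg i = s.realReg i :=
    fun i hi => (b₄ i (by simp at hi ⊢; tauto)).trans (a₄ i (by simp at hi ⊢; tauto))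
  refine Runs.of_straight rfl ?_
  have d29 := b₃ 29 (by simp)
  have c22 := a₄ 22 (by simp)
  have c23 := a₄ 23 (by simp)
  have c24 := a₄ 24 (by simp)
  have c25 := a₄ 25 (by simp)
  have d26 := (a₃ 26 (by simp)).trans h0
  rw [← hv] at c25
  rcases hd with ⟨t, d, g, θ⟩ | ⟨t, d, g, θ⟩
  · rw [d] at d29
    have e : ∃ s₅, finishStep.run s₄ = s₅ ∧ s₅.realMem = s₄.realMem ∧ s₅.natMem = s₄.natMem ∧
        (∀ i, i ∉ [21] → s₅.natReg i = s₄.natReg i) ∧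
        (∀ i, i ∉ [22, 23, 24, 32] → s₅.realReg i = s₄.realReg i) ∧
        s₅.natReg 21 = s₄.natReg 25 ∧ s₅.realReg 22 = s.realReg 22 + s₄.realReg 26 ∧
        s₅.realReg 23 = s.realReg 23 + s₄.realReg 27 ∧ s₅.realReg 24 = v := by
      refine ⟨_, rfl, ?_⟩
      simp +contextual [finishStep, Cmd.run, Op.apply, Test.Holds, d26, d29, c22, c23, c25]
    obtain ⟨s₅, hs₅, e₁, e₂, e₃, e₄, e₅, e₆, e₇, e₈⟩ := e
    rw [hs₅]
    simp only [g, θ, one_mul] at b₅ b₆ b₇ b₈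
    refine ⟨⟨fun k hk => by rw [e₁, b₁ k hk], fun k _ => by rw [e₂, b₂],
      fun i hi => (e₄ i (by simp; omega)).trans (a₄ i (by simp; omega)),
      fun i hi => (e₃ i (by simp; omega)).trans (a₃ i (by simp; omega)),
      (e₃ 20 (by simp)).trans (a₃ 20 (by simp)), (e₃ 26 (by simp)).trans (a₃ 26 (by simp)),
      (e₃ 27 (by simp)).trans (a₃ 27 (by simp))⟩, .inl ⟨?_, ?_, ?_, ?_, ?_, ?_, ?_, ?_⟩⟩
    · rw [e₃ 20 (by simp), a₃ 20 (by simp), hB]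
    · rw [e₅, b₆]
    · rw [e₃ 26 (by simp), d26]
    · rw [e₃ 27 (by simp), a₃ 27 (by simp), h4]
    · rw [e₄ 20 (by simp), a₄ 20 (by simp), hK]
    · rw [e₄ 21 (by simp), a₄ 21 (by simp), hc]
    · rw [e₁]; exact b₅
    · rw [e₆, e₇, e₈, b₇, b₈]
      exact hS.lower hge hle t
  · rw [d] at d29
    have e : ∃ s₅, finishStep.run s₄ = s₅ ∧ s₅.realMem = s₄.realMem ∧ s₅.natMem = s₄.natMem ∧
        (∀ i, i ∉ [21] → s₅.natReg i = s₄.natReg i) ∧ s₅.realReg = s₄.realReg ∧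
        s₅.natReg 21 = s₄.natReg 25 := by
      refine ⟨_, rfl, ?_⟩
      simp +contextual [finishStep, Cmd.run, Op.apply, Test.Holds, d26, d29]
    obtain ⟨s₅, hs₅, e₁, e₂, e₃, e₄, e₅⟩ := e
    rw [hs₅]
    simp only [g, θ, neg_mul, one_mul, neg_lt_neg_iff] at b₅ b₆
    refine ⟨⟨fun k hk => by rw [e₁, b₁ k hk], fun k _ => by rw [e₂, b₂],
      fun i hi => by rw [e₄, a₄ i (by simp; omega)],
      fun i hi => (e₃ i (by simp; omega)).trans (a₃ i (by simp; omega)),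
      (e₃ 20 (by simp)).trans (a₃ 20 (by simp)), (e₃ 26 (by simp)).trans (a₃ 26 (by simp)),
      (e₃ 27 (by simp)).trans (a₃ 27 (by simp))⟩, .inr ⟨?_, ?_, ?_, ?_, ?_, ?_, ?_, ?_⟩⟩
    · rw [e₃ 20 (by simp), a₃ 20 (by simp), hB]
    · rw [e₅, b₆]
    · rw [e₃ 26 (by simp), d26]
    · rw [e₃ 27 (by simp), a₃ 27 (by simp), h4]
    · rw [e₄, a₄ 20 (by simp), hK]
    · rw [e₄, a₄ 21 (by simp), hc]
    · rw [e₁]; exact b₅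
    · rw [e₄, c22, c23, c24]
      exact hS.raise hge hle t

/-- What a search achieves. -/
def SearchPost (K c : ℝ) (L : List (ℝ × ℝ)) (B : ℕ) (s s' : State) : Prop :=
  Preserved B s s' ∧ IsThreshold K c L (s'.realReg 24)

/-- The hypothesis `hcall` stands for the recursive call and is supplied by the induction in
`runs_search`. With fewer than four active pairs any of them may be the pivot, since the claims of
balance are then void. -/
theorem runs_choosePivot (procs : List Cmd) {K c : ℝ} {L : List (ℝ × ℝ)} {B : ℕ}
    {M : List (ℝ × ℝ)} {s : State} {T : ℕ} (h : InSearch K c L B M s) (hM0 : M ≠ [])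
    (hcall : ∀ (K' c' : ℝ) (L' : List (ℝ × ℝ)) (B' : ℕ) (s' : State),
      L'.length = M.length / 4 → InSearch K' c' L' B' L' s' →
      Runs procs (.call 0) s' T (SearchPost K' c' L' B' s')) :
    Runs procs choosePivot s (if M.length / 4 = 0 then 60 else 60 * (M.length / 4) + T + 60)
      (fun s' => Preserved B s s' ∧ InSearch K c L B M s' ∧
        (∃ q ∈ M, s'.realReg 25 ≤ q.1) ∧ (∃ q ∈ M, q.1 ≤ s'.realReg 25) ∧
        6 * (M.length / 4) ≤ 5 * (M.countP fun q => s'.realReg 25 ≤ q.1) ∧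
        6 * (M.length / 4) ≤ 5 * M.countP fun q => q.1 ≤ s'.realReg 25) := by
  obtain ⟨hB, hlen, h0, h4, hK, hc, hM, hS⟩ := h
  by_cases hsmall : M.length < 4
  · rw [if_pos (by omega), Nat.div_eq_of_lt hsmall, choosePivot]
    refine (Runs.ite (T := (ops [.realLoad 25 20]).cost) (fun _ => Runs.of_straight rfl ?_)
      (fun hb => absurd (show Test.Holds (.natLt 21 27) s by simp [Test.Holds]; omega) hb)).mono ?_ (fun _ => id)
    · obtain ⟨q, t, rfl⟩ := List.exists_cons_of_ne_nil hM0
      have e : ∃ s₁, (ops [.realLoad 25 20]).run s = s₁ ∧ s₁.realMem = s.realMem ∧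
          s₁.natMem = s.natMem ∧ s₁.natReg = s.natReg ∧
          (∀ i, i ∉ [25] → s₁.realReg i = s.realReg i) ∧ s₁.realReg 25 = q.1 := by
        refine ⟨_, rfl, ?_⟩
        simp +contextual [Op.apply, hB, hM.1]
      obtain ⟨s₁, hs₁, a₁, a₂, a₃, a₄, a₅⟩ := e
      rw [hs₁]
      refine ⟨⟨fun k _ => by rw [a₁], fun k _ => by rw [a₂], fun i hi => a₄ i (by simp; omega),
        fun i _ => by rw [a₃], by rw [a₃], by rw [a₃], by rw [a₃]⟩, ⟨?_, ?_, ?_, ?_, ?_, ?_, ?_, ?_⟩,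
        ⟨q, by simp, a₅.le⟩, ⟨q, by simp, a₅.ge⟩, by simp, by simp⟩
      · rwa [a₃]
      · rwa [a₃]
      · rwa [a₃]
      · rwa [a₃]
      · rwa [a₄ 20 (by simp)]
      · rwa [a₄ 21 (by simp)]
      · rwa [a₁]
      · rwa [a₄ 22 (by simp), a₄ 23 (by simp), a₄ 24 (by simp)]
    · decide
  · have hlarge : 4 ≤ M.length := not_lt.1 hsmall
    rw [if_neg (by omega), choosePivot]
    set k := M.length / 4 with hk
    suffices H : Runs procs (block [saveSearch, collectPivots, enterSearch, .call 0, leaveSearch]) s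
        (saveSearch.cost + ((60 * k + 1) + (enterSearch.cost + (T + leaveSearch.cost))))
        (fun s' => Preserved B s s' ∧ InSearch K c L B M s' ∧
        (∃ q ∈ M, s'.realReg 25 ≤ q.1) ∧ (∃ q ∈ M, q.1 ≤ s'.realReg 25) ∧
        6 * k ≤ 5 * (M.countP fun q => s'.realReg 25 ≤ q.1) ∧
        6 * k ≤ 5 * M.countP fun q => q.1 ≤ s'.realReg 25) by
      refine (Runs.ite (fun hb => absurd hb ?_) (fun _ => H)).mono ?_ (fun _ => id)
      · simp [Test.Holds, hlen, h4, hlarge]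
      · have h₁ : saveSearch.cost = 21 := by decide
        have h₂ : enterSearch.cost = 10 := by decide
        have h₃ : leaveSearch.cost = 16 := by decide
        omega
    simp only [block_cons, block_singleton]
    refine Runs.seq (Runs.of_straight rfl ?_)
    -- The active pairs fill the addresses from B up to E. The registers are saved in the five cells
    -- from E on, and the pivots start at E + 5. The recursive call works at E + 5 and preserves
    -- everything below, so this area acts as a stack frame.
    set E := B + M.length + M.length with hE
    have e : ∃ s₁, saveSearch.run s = s₁ ∧ (∀ j < E, s₁.realMem j = s.realMem j) ∧
        (∀ j < E, s₁.natMem j = s.natMem j) ∧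
        (∀ i, i ∉ [22, 23, 24, 25, 28, 29] → s₁.natReg i = s.natReg i) ∧
        (∀ i, i ∉ [36] → s₁.realReg i = s.realReg i) ∧
        s₁.natReg 22 = M.length ∧ s₁.natReg 23 = B ∧ s₁.natReg 24 = E + 5 ∧ s₁.natReg 25 = 0 ∧
        s₁.natReg 29 = E + 5 ∧ s₁.realReg 36 = 0 ∧
        s₁.realMem E = K ∧ s₁.realMem (E + 1) = c ∧ s₁.realMem (E + 2) = s.realReg 22 ∧
        s₁.realMem (E + 3) = s.realReg 23 ∧ s₁.realMem (E + 4) = s.realReg 24 ∧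
        s₁.natMem (E + 3) = B ∧ s₁.natMem (E + 4) = M.length := by
      refine ⟨_, rfl, ?_⟩
      have hu : ∀ j < E, j ≠ E ∧ j ≠ E + 1 ∧ j ≠ E + 2 ∧ j ≠ E + 3 ∧ j ≠ E + 4 := by
        intro j hj; omega
      simp +contextual [saveSearch, Op.apply, hB, hlen, h0, hK, hc, ← hE, add_assoc, hu]
    obtain ⟨s₁, hs₁, a₁, a₂, a₃, a₄, a₅, a₆, a₇, a₈, a₉, a₁₀, m₀, m₁, m₂, m₃, m₄, m₅, m₆⟩ := e
    rw [hs₁]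
    clear hs₁
    have hM₁ : Holds s₁.realMem (s₁.natReg 23) M := by
      rw [a₆]; exact hM.congr fun j _ hj => a₁ j (by omega)
    have hkl := length_groupPivots M
    refine Runs.seq ((runs_collectPivots procs M s₁ ((a₃ 27 (by simp)).trans h4) a₅ (by omega)
      hM₁).mono (by rw [hkl]) ?_)
    rintro s₂ ⟨b₁, b₂, b₃, b₄, b₅, b₆, b₇⟩
    rw [hkl, ← hk] at b₆ b₇
    rw [a₈, zero_add] at b₆
    rw [a₁₀, zero_add] at b₇
    rw [a₇] at b₁ b₅
    refine Runs.seq (Runs.of_straight rfl ?_)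
    have e : ∃ s₃, enterSearch.run s₂ = s₃ ∧ s₃.realMem = s₂.realMem ∧ s₃.natMem = s₂.natMem ∧
        (∀ i, i ∉ [20, 21] → s₃.natReg i = s₂.natReg i) ∧
        (∀ i, i ∉ [20, 21, 22, 23, 24, 38, 39] → s₃.realReg i = s₂.realReg i) ∧
        s₃.natReg 20 = E + 5 ∧ s₃.natReg 21 = k ∧ s₃.realReg 20 = 2 * k ∧ s₃.realReg 21 = -1 ∧
        s₃.realReg 22 = 0 ∧ s₃.realReg 23 = 0 ∧ s₃.realReg 24 = 1 := by
      refine ⟨_, rfl, ?_⟩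
      have d26 : s₂.natReg 26 = 0 := by rw [b₃ 26 (by simp), a₃ 26 (by simp), h0]
      have d29 : s₂.natReg 29 = E + 5 := by rw [b₃ 29 (by simp), a₉]
      simp +contextual [enterSearch, Op.apply, d26, d29, b₆, b₇]
    obtain ⟨s₃, hs₃, c₁, c₂, c₃, c₄, c₅, c₆, c₇, c₈, c₉, c₁₀, c₁₁⟩ := e
    rw [hs₃]
    clear hs₃
    -- The pivots inherit the bound 1, which lets the inner search start from the threshold 1.
    have hM1 : ∀ q ∈ M, q.1 ≤ 1 := fun q hq => (hS.active_le q hq).trans hS.le_one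
    refine Runs.seq ((hcall (2 * k) (-1) (groupPivots M) (E + 5) s₃ hkl
      ⟨c₅, by rw [c₆, hkl], ?_, ?_, c₇, c₈, by rwa [c₁], ?_⟩).mono le_rfl ?_)
    · rw [c₃ 26 (by simp), b₃ 26 (by simp), a₃ 26 (by simp), h0]
    · rw [c₃ 27 (by simp), b₃ 27 (by simp), a₃ 27 (by simp), h4]
    · rw [c₉, c₁₀, c₁₁]
      exact .start fun q hq => groupPivots_le_one hM1 hq
    rintro s₄ ⟨hp, hr⟩
    obtain ⟨hbal₁, hbal₂⟩ := hr.balanced hM1 hlarge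
    have mem : ∀ j < E + 5, s₄.realMem j = s₁.realMem j := fun j hj => by
      rw [hp.realMem j hj, c₁, b₁ j hj]
    have nmem : ∀ j < E + 5, s₄.natMem j = s₁.natMem j := fun j hj => by
      rw [hp.natMem j hj, c₂, b₂]
    have e : ∃ s₅, leaveSearch.run s₄ = s₅ ∧ s₅.realMem = s₄.realMem ∧ s₅.natMem = s₄.natMem ∧
        (∀ i, i ∉ [20, 21, 24, 28] → s₅.natReg i = s₄.natReg i) ∧
        (∀ i, i ∉ [20, 21, 22, 23, 24, 25, 38] → s₅.realReg i = s₄.realReg i) ∧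
        s₅.natReg 20 = B ∧ s₅.natReg 21 = M.length ∧ s₅.realReg 20 = K ∧ s₅.realReg 21 = c ∧
        s₅.realReg 22 = s.realReg 22 ∧ s₅.realReg 23 = s.realReg 23 ∧
        s₅.realReg 24 = s.realReg 24 ∧ s₅.realReg 25 = s₄.realReg 24 := by
      refine ⟨_, rfl, ?_⟩
      have d20 : s₄.natReg 20 = E + 5 := hp.natReg20.trans c₅
      rw [← mem _ (by omega)] at m₀ m₁ m₂ m₃ m₄
      rw [← nmem _ (by omega)] at m₅ m₆
      simp +contextual [leaveSearch, Op.apply, d20, m₀, m₁, m₂, m₃, m₄, m₅, m₆]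
    obtain ⟨s₅, hs₅, f₁, f₂, f₃, f₄, f₅, f₆, f₇, f₈, f₉, f₁₀, f₁₁, f₁₂⟩ := e
    refine Runs.of_straight rfl ?_
    rw [hs₅]
    have g26 : s₅.natReg 26 = s.natReg 26 := by
      rw [f₃ 26 (by simp), hp.natReg26, c₃ 26 (by simp), b₃ 26 (by simp), a₃ 26 (by simp)]
    have g27 : s₅.natReg 27 = s.natReg 27 := by
      rw [f₃ 27 (by simp), hp.natReg27, c₃ 27 (by simp), b₃ 27 (by simp), a₃ 27 (by simp)]
    rw [f₁₂]
    refine ⟨⟨fun j hj => ?_, fun j hj => ?_, fun i hi => ?_, fun i hi => ?_, f₅.trans hB.symm, g26,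
      g27⟩, ⟨f₅, f₆, g26.trans h0, g27.trans h4, f₇, f₈, ?_, ?_⟩, ?_, ?_, hbal₁, hbal₂⟩
    · rw [f₁, mem j (by omega), a₁ j (by omega)]
    · rw [f₂, nmem j (by omega), a₂ j (by omega)]
    · rw [f₄ i (by simp; omega), hp.realReg i hi, c₄ i (by simp; omega), b₄ i (by simp; omega),
        a₄ i (by simp; omega)]
    · rw [f₃ i (by simp; omega), hp.natReg i hi, c₃ i (by simp; omega), b₃ i (by simp; omega),
        a₃ i (by simp; omega)]
    · exact hM.congr fun j _ hj => by rw [f₁, mem j (by omega), a₁ j (by omega)]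
    · rwa [f₉, f₁₀, f₁₁]
    · have : 0 < M.countP fun q => s₄.realReg 24 ≤ q.1 := by omega
      simpa [List.countP_pos_iff] using this
    · have : 0 < M.countP fun q => q.1 ≤ s₄.realReg 24 := by omega
      simpa [List.countP_pos_iff] using this

theorem length_filter_lt_add_countP (M : List (ℝ × ℝ)) (v : ℝ) :
    (M.filter fun q => q.1 < v).length + (M.countP fun q => v ≤ q.1) = M.length := by
  rw [← List.countP_eq_length_filter,
    List.length_eq_countP_add_countP (fun q : ℝ × ℝ => decide (q.1 < v)) (l := M)]
  simp

theorem length_filter_gt_add_countP (M : List (ℝ × ℝ)) (v : ℝ) :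
    (M.filter fun q => v < q.1).length + (M.countP fun q => q.1 ≤ v) = M.length := by
  rw [← List.countP_eq_length_filter,
    List.length_eq_countP_add_countP (fun q : ℝ × ℝ => decide (v < q.1)) (l := M)]
  simp

/-- Strong induction on the number of active pairs covers both the recursive call on the pivots and
the remaining rounds of the loop. The parameters K, c and L must be general, because the inner
search uses others. -/
theorem runs_search {procs : List Cmd} (hprocs : procs[0]? = some search) {K c : ℝ}
    {L : List (ℝ × ℝ)} {B : ℕ} {M : List (ℝ × ℝ)} {s : State} (h : InSearch K c L B M s) :
    Runs procs search s (5000 * M.length + 1) (SearchPost K c L B s) := by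
  induction hm : M.length using Nat.strong_induction_on generalizing K c L B M s with
  | _ m ih =>
  subst hm
  rcases M.eq_nil_or_concat' with rfl | hne
  · refine Runs.loopDone (by simp [Test.Holds, h.zero, h.length]) ⟨.refl B s, ?_⟩
    exact h.searching.isThreshold
  · have hM0 : M ≠ [] := by
      obtain ⟨_, _, rfl⟩ := hne
      simp
    have hpos : 0 < M.length := List.length_pos_iff.2 hM0
    set k := M.length / 4 with hk
    have hcall : ∀ (K' c' : ℝ) (L' : List (ℝ × ℝ)) (B' : ℕ) (s' : State),
        L'.length = M.length / 4 → InSearch K' c' L' B' L' s' →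
        Runs procs (.call 0) s' (5000 * k + 2) (SearchPost K' c' L' B' s') := by
      intro K' c' L' B' s' hL' hs'
      refine (Runs.call hprocs (ih L'.length (by omega) hs' rfl)).mono ?_ (fun _ => id)
      omega
    have hpiv := runs_choosePivot procs h hM0 hcall
    rw [← hk] at hpiv
    have hT : (if k = 0 then 60 else 60 * k + (5000 * k + 2) + 60) ≤ 5060 * k + 62 := by
      split_ifs <;> omega
    -- R is the time left after one round. For k ≥ 1 the next list M' is shorter by at least 6k/5,
    -- which frees 6000k steps; these pay for 5060k + 40m + 123, because m ≤ 4k + 3. For k = 0 the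
    -- loss of a single pair frees enough.
    set R := 5000 * M.length - (5060 * k + 40 * M.length + 122) with hR
    refine (Runs.loopStep (T₁ := (5060 * k + 62) + (40 * M.length + 60)) (T₂ := R)
      (by simpa [Test.Holds, h.zero, h.length] using hpos) (Runs.seq (hpiv.mono hT ?_))).mono ?_
      (fun _ => id)
    · rintro s₁ ⟨hp₁, hs₁, hge, hle, hb₁, hb₂⟩
      refine (runs_narrow procs hs₁ hge hle).mono le_rfl ?_
      have step : ∀ (M' : List (ℝ × ℝ)) (s₂ : State), M'.length < M.length →
          5 * M'.length + 6 * k ≤ 5 * M.length → Preserved B s₁ s₂ → InSearch K c L B M' s₂ →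
          Runs procs search s₂ R (SearchPost K c L B s) := by
        intro M' s₂ hlt hlen hp₂ hs₂
        refine (ih M'.length hlt hs₂ rfl).mono (by omega) ?_
        rintro s₃ ⟨hp₃, hr⟩
        exact ⟨(hp₁.trans hp₂).trans hp₃, hr⟩
      rintro s₂ ⟨hp₂, hs₂ | hs₂⟩
      · have h₁ := length_filter_lt_add_countP M (s₁.realReg 25)
        have h₂ : 0 < M.countP fun q => s₁.realReg 25 ≤ q.1 := by
          simpa [List.countP_pos_iff] using hge
        exact step _ s₂ (by omega) (by omega) hp₂ hs₂
      · have h₁ := length_filter_gt_add_countP M (s₁.realReg 25)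
        have h₂ : 0 < M.countP fun q => q.1 ≤ s₁.realReg 25 := by
          simpa [List.countP_pos_iff] using hle
        exact step _ s₂ (by omega) (by omega) hp₂ hs₂
    · omega

end RealRAM

/-! ### Soft-thresholding over a box -/

section Coordinates

/-- The bound at which `a * y` is least. -/
noncomputable def nearEnd (a lo hi : ℝ) : ℝ := if 0 ≤ a then lo else hi

/-- The bound at which `a * y` is greatest. -/
noncomputable def farEnd (a lo hi : ℝ) : ℝ := if 0 ≤ a then hi else lo

/-- The relative position of `y` between the bounds. -/
noncomputable def relPos (a lo hi y : ℝ) : ℝ :=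
  (y - nearEnd a lo hi) / (farEnd a lo hi - nearEnd a lo hi)

/-- The range of `a * y`. -/
noncomputable def spread (a lo hi : ℝ) : ℝ := a * (farEnd a lo hi - nearEnd a lo hi)

variable {a lo hi y : ℝ}

theorem mul_sub_nearEnd_nonneg (h₁ : lo ≤ y) (h₂ : y ≤ hi) : 0 ≤ a * (y - nearEnd a lo hi) := by
  rw [nearEnd]
  split_ifs with ha
  · exact mul_nonneg ha (sub_nonneg.2 h₁)
  · exact mul_nonneg_of_nonpos_of_nonpos (not_le.1 ha).le (sub_nonpos.2 h₂)

theorem mul_sub_nearEnd_le_spread (h₁ : lo ≤ y) (h₂ : y ≤ hi) :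
    a * (y - nearEnd a lo hi) ≤ spread a lo hi := by
  rw [spread, nearEnd, farEnd]
  split_ifs with ha
  · exact mul_le_mul_of_nonneg_left (by linarith) ha
  · exact mul_le_mul_of_nonpos_left (by linarith) (not_le.1 ha).le

theorem relPos_nonneg (h₁ : lo ≤ y) (h₂ : y ≤ hi) : 0 ≤ relPos a lo hi y := by
  rw [relPos, nearEnd, farEnd]
  split_ifs with ha
  · exact div_nonneg (by linarith) (by linarith)
  · exact div_nonneg_of_nonpos (by linarith) (by linarith)

theorem relPos_le_one (h₁ : lo ≤ y) (h₂ : y ≤ hi) : relPos a lo hi y ≤ 1 := by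
  rw [relPos, nearEnd, farEnd]
  split_ifs with ha
  · exact div_le_one_of_le₀ (by linarith) (by linarith)
  · exact div_le_one_of_ge (by linarith) (by linarith)

/-- If the two ends coincide, so do y and the near end, and the default value 0 of the quotient is
correct. -/
theorem relPos_mul (h₁ : lo ≤ y) (h₂ : y ≤ hi) :
    relPos a lo hi y * (farEnd a lo hi - nearEnd a lo hi) = y - nearEnd a lo hi := by
  rw [relPos]
  refine div_mul_cancel_of_imp fun h => ?_
  rw [nearEnd, farEnd] at *
  split_ifs at * <;> linarith

theorem spread_mul_relPos (h₁ : lo ≤ y) (h₂ : y ≤ hi) :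
    spread a lo hi * relPos a lo hi y = a * (y - nearEnd a lo hi) := by
  rw [spread, mul_assoc, mul_comm (_ - _), relPos_mul h₁ h₂]

theorem nearEnd_add_mem (h : lo ≤ hi) {τ : ℝ} (h₀ : 0 ≤ τ) (h₁ : τ ≤ 1) :
    lo ≤ nearEnd a lo hi + τ * (farEnd a lo hi - nearEnd a lo hi) ∧
      nearEnd a lo hi + τ * (farEnd a lo hi - nearEnd a lo hi) ≤ hi := by
  rw [nearEnd, farEnd]
  split_ifs <;> constructor <;> nlinarith

end Coordinates

/-! ### Scalar bounds for soft-thresholding -/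

section Threshold

variable {lam t : ℝ}

theorem softThreshold_neg (hlam : 0 < lam) : softThreshold lam (-t) = -softThreshold lam t := by
  rw [softThreshold, softThreshold]
  split_ifs <;> linarith

theorem sub_le_softThreshold (hlam : 0 < lam) : t - lam ≤ softThreshold lam t := by
  rw [softThreshold]
  split_ifs <;> linarith

theorem softThreshold_nonneg_or (lam t : ℝ) :
    0 ≤ softThreshold lam t ∨ t + lam ≤ softThreshold lam t := by
  rw [softThreshold]
  split_ifs
  · left; linarith
  · right; linarith
  · left; exact le_rfl

/-- Above lam the first bound is what is needed. In the middle θ(t + lam) is nonnegative. Below -lam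
the number t + lam is negative, so multiplying it by θ ≤ 1 only increases it. -/
theorem softThreshold_le_of {z θ : ℝ} (hθ₀ : 0 ≤ θ) (hθ₁ : θ ≤ 1)
    (h₁ : t - lam ≤ z) (h₂ : θ * (t + lam) ≤ z) : softThreshold lam t ≤ z := by
  rw [softThreshold]
  split_ifs with h h'
  · exact h₁
  · nlinarith
  · exact (mul_nonneg hθ₀ (by linarith)).trans h₂

end Threshold

/-! ### Affine majorants and points of the convex hull -/

section Envelope

variable {n : ℕ} {lam : ℝ} {a lo hi y : Fin n → ℝ}

/-- The least value of `aᵀ y` over the box. -/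
noncomputable def leastValue (a lo hi : Fin n → ℝ) : ℝ := ∑ i, a i * nearEnd (a i) (lo i) (hi i)

theorem dotProduct_eq_leastValue_add (a lo hi y : Fin n → ℝ) :
    a ⬝ᵥ y = leastValue a lo hi + ∑ i, a i * (y i - nearEnd (a i) (lo i) (hi i)) := by
  rw [leastValue, dotProduct, ← Finset.sum_add_distrib]
  exact Finset.sum_congr rfl fun i _ => by ring

/-- Affine upper bounds for soft-thresholding over the box. -/
theorem softThreshold_dotProduct_le {θ : ℝ} {κ : Fin n → ℝ} (hθ₀ : 0 ≤ θ) (hθ₁ : θ ≤ 1)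
    (hκ₀ : ∀ i, θ ≤ κ i) (hκ₁ : ∀ i, κ i ≤ 1)
    (h : (1 - θ) * leastValue a lo hi + ∑ i, (1 - κ i) * spread (a i) (lo i) (hi i) ≤
      (1 + θ) * lam) (hy : y ∈ Set.Icc lo hi) :
    softThreshold lam (a ⬝ᵥ y) ≤ θ * (leastValue a lo hi + lam) +
      ∑ i, κ i * (a i * (y i - nearEnd (a i) (lo i) (hi i))) := by
  rw [dotProduct_eq_leastValue_add a lo hi y]
  set b := leastValue a lo hi
  set z : Fin n → ℝ := fun i => a i * (y i - nearEnd (a i) (lo i) (hi i)) with hz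
  have hz₀ : ∀ i, 0 ≤ z i := fun i => mul_sub_nearEnd_nonneg (hy.1 i) (hy.2 i)
  have hz₁ : ∀ i, z i ≤ spread (a i) (lo i) (hi i) := fun i =>
    mul_sub_nearEnd_le_spread (hy.1 i) (hy.2 i)
  have e₁ : ∑ i, (1 - κ i) * z i ≤ ∑ i, (1 - κ i) * spread (a i) (lo i) (hi i) :=
    Finset.sum_le_sum fun i _ => mul_le_mul_of_nonneg_left (hz₁ i) (by linarith [hκ₁ i])
  have e₂ : ∑ i, (1 - κ i) * z i = ∑ i, z i - ∑ i, κ i * z i := by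
    rw [← Finset.sum_sub_distrib]
    exact Finset.sum_congr rfl fun i _ => by ring
  have e₃ : θ * ∑ i, z i ≤ ∑ i, κ i * z i := by
    rw [Finset.mul_sum]
    exact Finset.sum_le_sum fun i _ => mul_le_mul_of_nonneg_right (hκ₀ i) (hz₀ i)
  -- The majorant exceeds aᵀy - lam by an amount that is least when every zᵢ equals its spread, and
  -- there it is `h`. That it dominates θ(aᵀy + lam) is `e₃`.
  exact softThreshold_le_of hθ₀ hθ₁ (by linarith) (by linarith)

/-- Points of the convex hull above a given point of the box. -/
theorem exists_mem_convexHull_softGraph (hlam : 0 < lam) (hy : y ∈ Set.Icc lo hi) {μ l : ℝ}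
    (hμ₀ : 0 ≤ μ) (hμ₁ : μ ≤ 1) (h₁ : l ≤ a ⬝ᵥ y + (1 - 2 * μ) * lam)
    (h₂ : l ≤ μ * (leastValue a lo hi - lam) +
      ∑ i, spread (a i) (lo i) (hi i) * min μ (relPos (a i) (lo i) (hi i) (y i))) :
    ∃ w, l ≤ w ∧ (y, w) ∈ convexHull ℝ (softGraph lam a lo hi) := by
  set b := leastValue a lo hi
  set e : Fin n → ℝ := fun i => nearEnd (a i) (lo i) (hi i) with he
  set f : Fin n → ℝ := fun i => farEnd (a i) (lo i) (hi i) with hf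
  set x : Fin n → ℝ := fun i => relPos (a i) (lo i) (hi i) (y i) with hx
  have hx₀ : ∀ i, 0 ≤ x i := fun i => relPos_nonneg (hy.1 i) (hy.2 i)
  have hx₁ : ∀ i, x i ≤ 1 := fun i => relPos_le_one (hy.1 i) (hy.2 i)
  have hyx : ∀ i, x i * (f i - e i) = y i - e i := fun i => relPos_mul (hy.1 i) (hy.2 i)
  have hbox : ∀ i, lo i ≤ hi i := fun i => (hy.1 i).trans (hy.2 i)
  -- For μ = 0 the numerator vanishes together with the denominator; in `hv'` the same happens for μ
  -- = 1.
  have hv : ∀ i, μ * (min μ (x i) / μ) = min μ (x i) := fun i => by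
    refine mul_div_cancel_of_imp' fun h => ?_
    rw [h, min_eq_left (hx₀ i)]
  have hv' : ∀ i, (1 - μ) * ((x i - min μ (x i)) / (1 - μ)) = x i - min μ (x i) := fun i => by
    refine mul_div_cancel_of_imp' fun h => ?_
    rw [show μ = 1 by linarith, min_eq_right (hx₁ i), sub_self]
  -- The part of xᵢ that goes to z is as large as possible: more than μ would push z out of the box,
  -- and more than xᵢ would push y₀ out.
  set z : Fin n → ℝ := fun i => e i + min μ (x i) / μ * (f i - e i) with hz
  set y₀ : Fin n → ℝ := fun i => e i + (x i - min μ (x i)) / (1 - μ) * (f i - e i) with hy₀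
  have hzbox : z ∈ Set.Icc lo hi := by
    have H := fun i => nearEnd_add_mem (a := a i) (hbox i) (τ := min μ (x i) / μ)
      (div_nonneg (le_min hμ₀ (hx₀ i)) hμ₀) (div_le_one_of_le₀ (min_le_left _ _) hμ₀)
    exact ⟨fun i => (H i).1, fun i => (H i).2⟩
  have hy₀box : y₀ ∈ Set.Icc lo hi := by
    have H := fun i => nearEnd_add_mem (a := a i) (hbox i) (τ := (x i - min μ (x i)) / (1 - μ))
      (div_nonneg (sub_nonneg.2 (min_le_right _ _)) (sub_nonneg.2 hμ₁))
      (div_le_one_of_le₀ (by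
        rcases min_choice μ (x i) with h | h <;> rw [h] <;> linarith [hx₁ i])
        (sub_nonneg.2 hμ₁))
    exact ⟨fun i => (H i).1, fun i => (H i).2⟩
  have hcomb : (1 - μ) • y₀ + μ • z = y := by
    funext i
    simp only [Pi.add_apply, Pi.smul_apply, smul_eq_mul, hz, hy₀]
    linear_combination (f i - e i) * hv i + (f i - e i) * hv' i + hyx i
  refine ⟨(1 - μ) * softThreshold lam (a ⬝ᵥ y₀) + μ * softThreshold lam (a ⬝ᵥ z), ?_, ?_⟩
  · have hz' : μ * (a ⬝ᵥ z) = μ * b + ∑ i, spread (a i) (lo i) (hi i) * min μ (x i) := by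
      rw [dotProduct_eq_leastValue_add a lo hi z, mul_add, Finset.mul_sum]
      congr 1
      refine Finset.sum_congr rfl fun i _ => ?_
      simp only [hz, spread]
      linear_combination a i * (f i - e i) * hv i
    have hy' : a ⬝ᵥ y = (1 - μ) * (a ⬝ᵥ y₀) + μ * (a ⬝ᵥ z) := by
      rw [← hcomb]
      simp [dotProduct_add, dotProduct_smul]
    have e₁ : μ * (a ⬝ᵥ z - lam) ≤ μ * softThreshold lam (a ⬝ᵥ z) :=
      mul_le_mul_of_nonneg_left (sub_le_softThreshold hlam) hμ₀
    -- At z the height is at least aᵀz - lam. Height at least 0 at y₀ then gives `h₂`, and height at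
    -- least aᵀy₀ + lam gives `h₁`.
    rcases softThreshold_nonneg_or lam (a ⬝ᵥ y₀) with h | h
    · have := mul_nonneg (sub_nonneg.2 hμ₁) h
      linarith
    · have := mul_le_mul_of_nonneg_left h (sub_nonneg.2 hμ₁)
      linarith
  · have h₀ : (y₀, softThreshold lam (a ⬝ᵥ y₀)) ∈ convexHull ℝ (softGraph lam a lo hi) :=
      subset_convexHull _ _ ⟨hy₀box, rfl⟩
    have h₁ : (z, softThreshold lam (a ⬝ᵥ z)) ∈ convexHull ℝ (softGraph lam a lo hi) :=
      subset_convexHull _ _ ⟨hzbox, rfl⟩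
    have := (convex_convexHull ℝ (softGraph lam a lo hi)) h₀ h₁ (sub_nonneg.2 hμ₁) hμ₀ (by ring)
    simpa only [Prod.smul_mk, Prod.mk_add_mk, hcomb, smul_eq_mul] using this

/-- The affine function `αᵀ y + β` is an upper bound for soft-thresholding on the box, and its value
at `y` is attained in the convex hull. -/
structure Supports (lam : ℝ) (a lo hi y : Fin n → ℝ) (α : Fin n → ℝ) (β : ℝ) : Prop where
  bound : ∀ y' ∈ Set.Icc lo hi, softThreshold lam (a ⬝ᵥ y') ≤ α ⬝ᵥ y' + β
  tight : (y, α ⬝ᵥ y + β) ∈ convexHull ℝ (softGraph lam a lo hi)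

/-- An inequality `w ≤ αᵀ y + β` that holds on a graph holds on its convex hull. -/
theorem le_of_mem_convexHull {α : Fin n → ℝ} {β : ℝ}
    (h : ∀ y ∈ Set.Icc lo hi, softThreshold lam (a ⬝ᵥ y) ≤ α ⬝ᵥ y + β)
    {q : (Fin n → ℝ) × ℝ} (hq : q ∈ convexHull ℝ (softGraph lam a lo hi)) :
    q.2 ≤ α ⬝ᵥ q.1 + β := by
  have hconv : Convex ℝ {q : (Fin n → ℝ) × ℝ | q.2 ≤ α ⬝ᵥ q.1 + β} := by
    intro p hp q hq s t hs ht hst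
    simp only [Set.mem_ofPred_eq, Prod.snd_add, Prod.smul_snd, Prod.fst_add, Prod.smul_fst,
      dotProduct_add, dotProduct_smul, smul_eq_mul] at *
    have h₁ := mul_le_mul_of_nonneg_left hp hs
    have h₂ := mul_le_mul_of_nonneg_left hq ht
    have : β = s * β + t * β := by rw [← add_mul, hst, one_mul]
    linarith
  refine convexHull_min ?_ hconv hq
  rintro ⟨y, w⟩ ⟨hy, hw⟩
  exact hw.trans_le (h y hy)

/-- Weak duality: `h₁` and `h₂` put the value of the majorant at y below a height that the hull
reaches with weight μ, while no height in the hull exceeds a majorant. Hence they are equal. -/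
theorem supports_of_certificate (hlam : 0 < lam) (hy : y ∈ Set.Icc lo hi) {θ μ : ℝ}
    {κ : Fin n → ℝ} (hθ₀ : 0 ≤ θ) (hθ₁ : θ ≤ 1) (hκ₀ : ∀ i, θ ≤ κ i) (hκ₁ : ∀ i, κ i ≤ 1)
    (h : (1 - θ) * leastValue a lo hi + ∑ i, (1 - κ i) * spread (a i) (lo i) (hi i) ≤
      (1 + θ) * lam) (hμ₀ : 0 ≤ μ) (hμ₁ : μ ≤ 1)
    (h₁ : θ * (leastValue a lo hi + lam) +
      ∑ i, κ i * (spread (a i) (lo i) (hi i) * relPos (a i) (lo i) (hi i) (y i)) ≤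
      leastValue a lo hi + ∑ i, spread (a i) (lo i) (hi i) * relPos (a i) (lo i) (hi i) (y i) +
        (1 - 2 * μ) * lam)
    (h₂ : θ * (leastValue a lo hi + lam) +
      ∑ i, κ i * (spread (a i) (lo i) (hi i) * relPos (a i) (lo i) (hi i) (y i)) ≤
      μ * (leastValue a lo hi - lam) +
      ∑ i, spread (a i) (lo i) (hi i) * min μ (relPos (a i) (lo i) (hi i) (y i))) :
    Supports lam a lo hi y (fun i => κ i * a i)
      (θ * (leastValue a lo hi + lam) - ∑ i, κ i * a i * nearEnd (a i) (lo i) (hi i)) := by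
  have key : ∀ y' : Fin n → ℝ, (fun i => κ i * a i) ⬝ᵥ y' +
      (θ * (leastValue a lo hi + lam) - ∑ i, κ i * a i * nearEnd (a i) (lo i) (hi i)) =
      θ * (leastValue a lo hi + lam) +
        ∑ i, κ i * (a i * (y' i - nearEnd (a i) (lo i) (hi i))) := by
    intro y'
    have : ∑ i, κ i * (a i * (y' i - nearEnd (a i) (lo i) (hi i))) =
        (fun i => κ i * a i) ⬝ᵥ y' - ∑ i, κ i * a i * nearEnd (a i) (lo i) (hi i) := by
      rw [dotProduct, ← Finset.sum_sub_distrib]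
      exact Finset.sum_congr rfl fun i _ => by ring
    rw [this]
    ring
  have hb : ∀ y' ∈ Set.Icc lo hi, softThreshold lam (a ⬝ᵥ y') ≤ (fun i => κ i * a i) ⬝ᵥ y' +
      (θ * (leastValue a lo hi + lam) - ∑ i, κ i * a i * nearEnd (a i) (lo i) (hi i)) := by
    intro y' hy'
    rw [key]
    exact softThreshold_dotProduct_le hθ₀ hθ₁ hκ₀ hκ₁ h hy'
  refine ⟨hb, ?_⟩
  have hz : ∀ i, spread (a i) (lo i) (hi i) * relPos (a i) (lo i) (hi i) (y i) =
      a i * (y i - nearEnd (a i) (lo i) (hi i)) := fun i => spread_mul_relPos (hy.1 i) (hy.2 i)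
  simp only [hz] at h₁ h₂
  rw [← dotProduct_eq_leastValue_add a lo hi y] at h₁
  obtain ⟨w, hw, hmem⟩ := exists_mem_convexHull_softGraph hlam hy hμ₀ hμ₁ h₁ h₂
  have := le_of_mem_convexHull hb hmem
  rw [key] at this ⊢
  rwa [le_antisymm hw this]

/-- The multiplier of a coordinate at position `x`, for the threshold `r`. -/
noncomputable def multiplier (r κ₂ κ₃ x : ℝ) : ℝ := if x < r then 1 else if r < x then κ₃ else κ₂

/-- The upper bound `t + lam`. -/
theorem supports_of_le_neg (hlam : 0 < lam) (hy : y ∈ Set.Icc lo hi) (ht : a ⬝ᵥ y ≤ -lam) (r : ℝ) :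
    Supports lam a lo hi y
      (fun i => multiplier r 1 1 (relPos (a i) (lo i) (hi i) (y i)) * a i)
      (1 * (leastValue a lo hi + lam) -
        ∑ i, multiplier r 1 1 (relPos (a i) (lo i) (hi i) (y i)) * a i *
          nearEnd (a i) (lo i) (hi i)) := by
  have hm : ∀ x, multiplier r 1 1 x = 1 := fun x => by simp [multiplier]
  have e : a ⬝ᵥ y = leastValue a lo hi +
      ∑ i, spread (a i) (lo i) (hi i) * relPos (a i) (lo i) (hi i) (y i) := by
    rw [dotProduct_eq_leastValue_add a lo hi]
    simp only [fun i => spread_mul_relPos (a := a i) (hy.1 i) (hy.2 i)]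
  -- Here θ = κᵢ = 1 and μ = 0, where φ(0) = aᵀy + lam ≤ 0 = ψ(0).
  refine supports_of_certificate hlam hy zero_le_one le_rfl (fun i => (hm _).ge)
    (fun i => (hm _).le) ?_ le_rfl zero_le_one ?_ ?_
  · simp only [hm, sub_self, zero_mul, Finset.sum_const_zero]; linarith
  · simp only [hm, one_mul]; linarith
  · have hmin : ∀ i, min 0 (relPos (a i) (lo i) (hi i) (y i)) = 0 := fun i =>
      min_eq_left (relPos_nonneg (hy.1 i) (hy.2 i))
    simp only [hm, hmin, one_mul, mul_zero, zero_mul, Finset.sum_const_zero]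
    linarith

/-- The upper bound `0`. -/
theorem supports_of_greatest_le (hlam : 0 < lam) (hy : y ∈ Set.Icc lo hi) (ht : -lam ≤ a ⬝ᵥ y)
    (hU : leastValue a lo hi + ∑ i, spread (a i) (lo i) (hi i) ≤ lam) {r : ℝ} (hr : r < 0) :
    Supports lam a lo hi y
      (fun i => multiplier r 0 0 (relPos (a i) (lo i) (hi i) (y i)) * a i)
      (0 * (leastValue a lo hi + lam) -
        ∑ i, multiplier r 0 0 (relPos (a i) (lo i) (hi i) (y i)) * a i *
          nearEnd (a i) (lo i) (hi i)) := by
  have hx : ∀ i, 0 ≤ relPos (a i) (lo i) (hi i) (y i) := fun i =>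
    relPos_nonneg (hy.1 i) (hy.2 i)
  have hm : ∀ i, multiplier r 0 0 (relPos (a i) (lo i) (hi i) (y i)) = 0 := fun i => by
    rw [multiplier, if_neg (hr.trans_le (hx i)).not_gt, ite_self]
  have e : a ⬝ᵥ y = leastValue a lo hi +
      ∑ i, spread (a i) (lo i) (hi i) * relPos (a i) (lo i) (hi i) (y i) := by
    rw [dotProduct_eq_leastValue_add a lo hi]
    simp only [fun i => spread_mul_relPos (a := a i) (hy.1 i) (hy.2 i)]
  -- Here θ = κᵢ = 0 and μ = 0, where ψ(0) = 0 ≤ φ(0). A negative r was required because positions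
  -- below r would get the multiplier 1.
  refine supports_of_certificate hlam hy le_rfl zero_le_one (fun i => (hm i).ge)
    (fun i => (hm i).trans_le zero_le_one) ?_ le_rfl zero_le_one ?_ ?_
  · simp only [hm, sub_zero, one_mul, add_zero]; linarith
  · simp only [hm, zero_mul, Finset.sum_const_zero]; linarith
  · have hmin : ∀ i, min 0 (relPos (a i) (lo i) (hi i) (y i)) = 0 := fun i => min_eq_left (hx i)
    simp only [hm, hmin, mul_zero, zero_mul, Finset.sum_const_zero]
    linarith

end Envelope

namespace RealRAM

/-! ### Sums over lists as sums over coordinates -/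

theorem sum_map_range (n : ℕ) (f : ℕ → ℝ) : ((List.range n).map f).sum = ∑ i : Fin n, f i := by
  rw [← Finset.sum_range]
  rfl

section Lists

variable {n : ℕ} {F : ℕ → ℝ × ℝ} {x A : Fin n → ℝ}

theorem massAbove_map_range (hF : ∀ i : Fin n, F i = (x i, A i)) (v : ℝ) :
    massAbove ((List.range n).map F) v = ∑ i, if v < x i then A i else 0 := by
  rw [massAbove, List.map_map, sum_map_range]
  simp [hF]

theorem massFrom_map_range (hF : ∀ i : Fin n, F i = (x i, A i)) (v : ℝ) :
    massFrom ((List.range n).map F) v = ∑ i, if v ≤ x i then A i else 0 := by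
  rw [massFrom, List.map_map, sum_map_range]
  simp [hF]

theorem momentAbove_map_range (hF : ∀ i : Fin n, F i = (x i, A i)) (v : ℝ) :
    momentAbove ((List.range n).map F) v = ∑ i, if v < x i then A i * x i else 0 := by
  rw [momentAbove, List.map_map, sum_map_range]
  simp [hF]

theorem mem_map_range (hF : ∀ i : Fin n, F i = (x i, A i)) {p : ℝ × ℝ} :
    p ∈ (List.range n).map F ↔ ∃ i, p = (x i, A i) := by
  simp only [List.mem_map, List.mem_range]
  constructor
  · rintro ⟨j, hj, rfl⟩
    exact ⟨⟨j, hj⟩, hF ⟨j, hj⟩⟩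
  · rintro ⟨i, rfl⟩
    exact ⟨i, i.2, hF i⟩

end Lists

/-! ### Slopes and sums split at a threshold -/

section Cases

variable {n : ℕ} {lam b r : ℝ} {F : ℕ → ℝ × ℝ} {x A : Fin n → ℝ}

/-- The slope of the relaxation to the left of a threshold is positive. -/
theorem IsThreshold.slope_pos (hF : ∀ i : Fin n, F i = (x i, A i))
    (h : IsThreshold (lam - b) (-(b + lam)) ((List.range n).map F) r)
    (hU : lam < b + ∑ i, A i) : 0 < b - lam + ∑ i, if r ≤ x i then A i else 0 := by
  rcases h.gap with hg | ⟨u, hu, hs, hg⟩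
  · have : ∀ i, r ≤ x i := fun i => hg (x i, A i) ((mem_map_range hF).2 ⟨i, rfl⟩)
    simp only [this, if_true]
    linarith
  · have h₁ : lam - b < massAbove ((List.range n).map F) u := by
      by_contra hc
      exact hs (.inl (not_lt.1 hc))
    rw [massAbove_map_range hF] at h₁
    -- No position lies strictly between u and r, so the slope just to the left of r is the right
    -- slope at u, where the rule fails.
    have h₂ : ∑ i, (if u < x i then A i else 0) = ∑ i, if r ≤ x i then A i else 0 := by
      refine Finset.sum_congr rfl fun i _ => ?_
      rcases hg (x i, A i) ((mem_map_range hF).2 ⟨i, rfl⟩) with hi | hi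
      · rw [if_neg (not_lt.2 hi), if_neg (not_le.2 (lt_of_le_of_lt hi hu))]
      · rw [if_pos (lt_of_lt_of_le hu hi), if_pos hi]
    linarith

/-- This is what the field `eq_or_exists_le` is for; together with `le_one` it makes r an admissible
weight μ. -/
theorem IsThreshold.nonneg (hF : ∀ i : Fin n, F i = (x i, A i)) (hx₀ : ∀ i, 0 ≤ x i) {K c : ℝ}
    (h : IsThreshold K c ((List.range n).map F) r) : 0 ≤ r := by
  rcases h.eq_or_exists_le with rfl | ⟨p, hp, hpr⟩
  · exact zero_le_one
  · obtain ⟨i, rfl⟩ := (mem_map_range hF).1 hp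
    exact (hx₀ i).trans hpr

theorem sum_mul_eq_split (r : ℝ) : ∑ i, A i * x i = (∑ i, if x i < r then A i * x i else 0) +
    r * ((∑ i, if r ≤ x i then A i else 0) - ∑ i, if r < x i then A i else 0) +
    ∑ i, if r < x i then A i * x i else 0 := by
  rw [← Finset.sum_sub_distrib, Finset.mul_sum, ← Finset.sum_add_distrib,
    ← Finset.sum_add_distrib]
  refine Finset.sum_congr rfl fun i _ => ?_
  rcases lt_trichotomy (x i) r with h | h | h
  · simp [h, h.not_ge, h.not_gt]
  · simp [h, mul_comm]
  · simp [h, h.le, h.not_gt]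

theorem sum_mul_min_eq (r : ℝ) : ∑ i, A i * min r (x i) =
    (∑ i, if x i < r then A i * x i else 0) + r * ∑ i, if r ≤ x i then A i else 0 := by
  rw [Finset.mul_sum, ← Finset.sum_add_distrib]
  refine Finset.sum_congr rfl fun i _ => ?_
  rcases lt_or_ge (x i) r with h | h
  · simp [h, h.le, h.not_ge]
  · simp [h, h.not_gt, mul_comm]

theorem sum_multiplier_mul (r κ₂ κ₃ : ℝ) : ∑ i, multiplier r κ₂ κ₃ (x i) * (A i * x i) =
    (∑ i, if x i < r then A i * x i else 0) +
    κ₂ * (r * ((∑ i, if r ≤ x i then A i else 0) - ∑ i, if r < x i then A i else 0)) +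
    κ₃ * ∑ i, if r < x i then A i * x i else 0 := by
  rw [← Finset.sum_sub_distrib, Finset.mul_sum, Finset.mul_sum, Finset.mul_sum,
    ← Finset.sum_add_distrib, ← Finset.sum_add_distrib]
  refine Finset.sum_congr rfl fun i _ => ?_
  rcases lt_trichotomy (x i) r with h | h | h
  · simp [multiplier, h, h.not_ge, h.not_gt]
  · simp [multiplier, h, mul_comm]
  · simp [multiplier, h, h.le, h.not_gt]

theorem sum_one_sub_multiplier_mul (r κ₂ κ₃ : ℝ) :
    ∑ i, (1 - multiplier r κ₂ κ₃ (x i)) * A i =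
    (1 - κ₂) * ((∑ i, if r ≤ x i then A i else 0) - ∑ i, if r < x i then A i else 0) +
    (1 - κ₃) * ∑ i, if r < x i then A i else 0 := by
  rw [← Finset.sum_sub_distrib, Finset.mul_sum, Finset.mul_sum, ← Finset.sum_add_distrib]
  refine Finset.sum_congr rfl fun i _ => ?_
  rcases lt_trichotomy (x i) r with h | h | h
  · simp [multiplier, h, h.not_ge, h.not_gt]
  · simp [multiplier, h]
  · simp [multiplier, h, h.le, h.not_gt]

theorem multiplier_mem {θ r κ₂ κ₃ x : ℝ} (hθ : θ ≤ 1) (h₂ : θ ≤ κ₂) (h₂' : κ₂ ≤ 1) (h₃ : θ ≤ κ₃)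
    (h₃' : κ₃ ≤ 1) : θ ≤ multiplier r κ₂ κ₃ x ∧ multiplier r κ₂ κ₃ x ≤ 1 := by
  rw [multiplier]
  split_ifs <;> constructor <;> first | assumption | exact le_rfl

end Cases

/-! ### Multipliers read off at the threshold -/

section Support

variable {n : ℕ} {lam r : ℝ} {a lo hi y : Fin n → ℝ} {F : ℕ → ℝ × ℝ}

/-- The supporting inequality when the two relaxed functions cross at the threshold or before. -/
theorem supports_of_crossing (hlam : 0 < lam) (hy : y ∈ Set.Icc lo hi) {L : List (ℝ × ℝ)}
    (hL : L = (List.range n).map F)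
    (hF : ∀ i : Fin n, F i = (relPos (a i) (lo i) (hi i) (y i), spread (a i) (lo i) (hi i)))
    (h : IsThreshold (lam - leastValue a lo hi) (-(leastValue a lo hi + lam)) L r)
    (ht : -lam < a ⬝ᵥ y) (hU : lam < leastValue a lo hi + ∑ i, spread (a i) (lo i) (hi i))
    (hc : momentAbove L r - r * massAbove L r ≤ (1 - r) * -(leastValue a lo hi + lam)) {θ : ℝ}
    (hθ : θ = (leastValue a lo hi - lam + massFrom L r) /
      (leastValue a lo hi - lam + massFrom L r + (lam + lam))) :
    Supports lam a lo hi y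
      (fun i => multiplier r θ θ (relPos (a i) (lo i) (hi i) (y i)) * a i)
      (θ * (leastValue a lo hi + lam) -
        ∑ i, multiplier r θ θ (relPos (a i) (lo i) (hi i) (y i)) * a i *
          nearEnd (a i) (lo i) (hi i)) := by
  subst hL
  set b := leastValue a lo hi with hb
  set x : Fin n → ℝ := fun i => relPos (a i) (lo i) (hi i) (y i) with hx
  set A : Fin n → ℝ := fun i => spread (a i) (lo i) (hi i) with hA
  have hx₀ : ∀ i, 0 ≤ x i := fun i => relPos_nonneg (hy.1 i) (hy.2 i)
  have et : a ⬝ᵥ y = b + ∑ i, A i * x i := by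
    rw [dotProduct_eq_leastValue_add a lo hi]
    simp only [hA, hx, fun i => spread_mul_relPos (a := a i) (hy.1 i) (hy.2 i), hb]
  have hr₀ := h.nonneg hF hx₀
  have hg := h.slope_pos hF hU
  rw [massFrom_map_range hF] at hθ
  rw [momentAbove_map_range hF, massAbove_map_range hF] at hc
  have split := sum_mul_eq_split (A := A) (x := x) r
  have hN := sum_multiplier_mul (A := A) (x := x) r θ θ
  have hO := sum_one_sub_multiplier_mul (A := A) (x := x) r θ θ
  set N := ∑ i, if x i < r then A i * x i else 0 with hNdef
  set G := ∑ i, if r ≤ x i then A i else 0 with hG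
  set g := b - lam + G with hgdef
  set t := a ⬝ᵥ y
  have hd : 0 < g + (lam + lam) := by linarith
  have hθg : θ * (g + (lam + lam)) = g := by rw [hθ]; exact div_mul_cancel₀ _ hd.ne'
  have hθ₀ : 0 ≤ θ := by rw [hθ]; positivity
  have hθ₁ : θ ≤ 1 := by rw [hθ]; exact div_le_one_of_le₀ (by linarith) hd.le
  -- On the linear piece of ψ that ends at r one has ψ(μ) = N + gμ, while φ(μ) = t + lam - 2 lam μ;
  -- this is where the two lines meet. The weight θ = g/(g + 2 lam) makes θφ + (1-θ)ψ constant on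
  -- the piece.
  set μ := (t + lam - N) / (g + (lam + lam)) with hμ
  have hμg : μ * (g + (lam + lam)) = t + lam - N := div_mul_cancel₀ _ hd.ne'
  -- By `hc`, φ(r) ≤ ψ(r), so the meeting point is not to the right of r.
  have hμr : μ ≤ r := by
    rw [hμ, div_le_iff₀ hd]
    linarith
  -- If some position lies below r, the rule fails at u, so ψ(u) < φ(u) and the meeting point is not
  -- to the left of u. Otherwise N = 0, and `ht` gives the sign of μ.
  have hlow : 0 ≤ μ ∧ ∀ i, x i < r → x i ≤ μ := by
    by_cases hex : ∃ i, x i < r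
    · obtain ⟨i₀, hi₀⟩ := hex
      rcases h.gap with hgap | ⟨u, hu, hs, hgap⟩
      · exact absurd hi₀ (not_lt.2 (hgap (x i₀, A i₀) ((mem_map_range hF).2 ⟨i₀, rfl⟩)))
      · have hgap' : ∀ i, x i ≤ u ∨ r ≤ x i := fun i =>
          hgap (x i, A i) ((mem_map_range hF).2 ⟨i, rfl⟩)
        have hmu : ∀ i, (if u < x i then A i else 0) = if r ≤ x i then A i else 0 := fun i => by
          rcases hgap' i with hi | hi
          · rw [if_neg (not_lt.2 hi), if_neg (not_le.2 (lt_of_le_of_lt hi hu))]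
          · rw [if_pos (lt_of_lt_of_le hu hi), if_pos hi]
        have hmo : ∑ i, (if u < x i then A i * x i else 0) = ∑ i, A i * x i - N := by
          rw [hNdef, ← Finset.sum_sub_distrib]
          refine Finset.sum_congr rfl fun i _ => ?_
          rcases hgap' i with hi | hi
          · rw [if_neg (not_lt.2 hi), if_pos (lt_of_le_of_lt hi hu), sub_self]
          · rw [if_pos (lt_of_lt_of_le hu hi), if_neg (not_lt.2 hi), sub_zero]
        have h₁ : (1 - u) * -(b + lam) < ∑ i, A i * x i - N - u * G := by
          by_contra hcon
          refine hs (.inr ?_)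
          rw [momentAbove_map_range hF, massAbove_map_range hF, hmo,
            Finset.sum_congr rfl fun i _ => hmu i]
          exact not_lt.1 hcon
        have hμu : u ≤ μ := by
          rw [hμ, le_div_iff₀ hd]
          linarith
        have hu₀ : 0 ≤ u := (hx₀ i₀).trans ((hgap' i₀).resolve_right (not_le.2 hi₀))
        exact ⟨hu₀.trans hμu, fun i hi => ((hgap' i).resolve_right (not_le.2 hi)).trans hμu⟩
    · push Not at hex
      have hN0 : N = 0 := Finset.sum_eq_zero fun i _ => if_neg (not_lt.2 (hex i))
      exact ⟨div_nonneg (by linarith) hd.le, fun i hi => absurd hi (not_lt.2 (hex i))⟩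
  obtain ⟨hμ₀, hμx⟩ := hlow
  have hmin : ∑ i, A i * min μ (x i) = N + μ * G := by
    rw [hNdef, hG, Finset.mul_sum, ← Finset.sum_add_distrib]
    refine Finset.sum_congr rfl fun i _ => ?_
    rcases lt_or_ge (x i) r with hi | hi
    · rw [if_pos hi, if_neg (not_le.2 hi), min_eq_right (hμx i hi)]; ring
    · rw [if_neg (not_lt.2 hi), if_pos hi, min_eq_left (hμr.trans hi)]; ring
  refine supports_of_certificate hlam hy (μ := μ) hθ₀ hθ₁
    (fun i => (multiplier_mem hθ₁ le_rfl hθ₁ le_rfl hθ₁).1)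
    (fun i => (multiplier_mem hθ₁ le_rfl hθ₁ le_rfl hθ₁).2) ?_ hμ₀ (hμr.trans h.le_one) ?_ ?_
  · rw [hO]
    have : (1 - θ) * (b + G) = (1 + θ) * lam := by linear_combination -hθg
    linarith
  -- At y the majorant has the value θ(t + lam) + (1-θ)N, and this is both φ(μ) and ψ(μ).
  · rw [hN, ← et]
    have e₂ : (μ * (lam + lam)) = (1 - θ) * (t + lam - N) := by
      have : (g + (lam + lam)) * (μ * (lam + lam)) =
          (g + (lam + lam)) * ((1 - θ) * (t + lam - N)) := by
        linear_combination (lam + lam) * hμg + (t + lam - N) * hθg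
      exact mul_left_cancel₀ hd.ne' this
    nlinarith
  · rw [hN, hmin]
    have e₂ : μ * g = θ * (t + lam - N) := by
      have : (g + (lam + lam)) * (μ * g) = (g + (lam + lam)) * (θ * (t + lam - N)) := by
        linear_combination g * hμg - (t + lam - N) * hθg
      exact mul_left_cancel₀ hd.ne' this
    nlinarith

/-- The supporting inequality when the two relaxed functions do not cross up to the threshold. -/
theorem supports_of_not_crossing (hlam : 0 < lam) (hy : y ∈ Set.Icc lo hi) {L : List (ℝ × ℝ)}
    (hL : L = (List.range n).map F)
    (hF : ∀ i : Fin n, F i = (relPos (a i) (lo i) (hi i) (y i), spread (a i) (lo i) (hi i)))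
    (h : IsThreshold (lam - leastValue a lo hi) (-(leastValue a lo hi + lam)) L r)
    (hU : lam < leastValue a lo hi + ∑ i, spread (a i) (lo i) (hi i))
    (hc : ¬ momentAbove L r - r * massAbove L r ≤ (1 - r) * -(leastValue a lo hi + lam)) {κ : ℝ}
    (hκ : κ = (leastValue a lo hi - lam + massFrom L r) / (massFrom L r - massAbove L r)) :
    Supports lam a lo hi y
      (fun i => multiplier r κ 0 (relPos (a i) (lo i) (hi i) (y i)) * a i)
      (0 * (leastValue a lo hi + lam) -
        ∑ i, multiplier r κ 0 (relPos (a i) (lo i) (hi i) (y i)) * a i *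
          nearEnd (a i) (lo i) (hi i)) := by
  subst hL
  set b := leastValue a lo hi with hb
  set x : Fin n → ℝ := fun i => relPos (a i) (lo i) (hi i) (y i) with hx
  set A : Fin n → ℝ := fun i => spread (a i) (lo i) (hi i) with hA
  have hx₀ : ∀ i, 0 ≤ x i := fun i => relPos_nonneg (hy.1 i) (hy.2 i)
  have hr₀ := h.nonneg hF hx₀
  have hg := h.slope_pos hF hU
  have hs : massAbove ((List.range n).map F) r ≤ lam - b := h.stops.resolve_right hc
  rw [massFrom_map_range hF, massAbove_map_range hF] at hκ
  rw [momentAbove_map_range hF, massAbove_map_range hF] at hc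
  rw [massAbove_map_range hF] at hs
  have split := sum_mul_eq_split (A := A) (x := x) r
  have hN := sum_multiplier_mul (A := A) (x := x) r κ 0
  have hO := sum_one_sub_multiplier_mul (A := A) (x := x) r κ 0
  have hM := sum_mul_min_eq (A := A) (x := x) r
  set N := ∑ i, if x i < r then A i * x i else 0
  set G := ∑ i, if r ≤ x i then A i else 0 with hG
  set H := ∑ i, if r < x i then A i else 0
  -- The slope of ψ is positive to the left of r and, as only the mass clause of the rule can hold,
  -- at most 0 to the right. So there is mass at r, and κ makes the intermediate slope b - lam + H +
  -- (1-κ)(G - H) vanish: r maximises ψ, and φ(r) > ψ(r) by `hc`.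
  have hd : 0 < G - H := by linarith
  have hκd : κ * (G - H) = b - lam + G := by rw [hκ]; exact div_mul_cancel₀ _ hd.ne'
  have hκ₀ : 0 ≤ κ := by rw [hκ]; positivity
  have hκ₁ : κ ≤ 1 := by rw [hκ]; exact div_le_one_of_le₀ (by linarith) hd.le
  refine supports_of_certificate hlam hy (μ := r) le_rfl zero_le_one
    (fun i => (multiplier_mem zero_le_one hκ₀ hκ₁ le_rfl zero_le_one).1)
    (fun i => (multiplier_mem zero_le_one hκ₀ hκ₁ le_rfl zero_le_one).2) ?_ hr₀ h.le_one ?_ ?_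
  · rw [hO]
    linarith
  · rw [hN, split]
    have : κ * (r * (G - H)) = r * (b - lam + G) := by rw [← hκd]; ring
    rw [this]
    linarith [not_le.1 hc]
  · rw [hN, hM]
    have : κ * (r * (G - H)) = r * (b - lam + G) := by rw [← hκd]; ring
    rw [this]
    linarith

end Support

/-! ### The separation program

Natural registers: `2` the dimension `n`, `3` a running index, `10` and `11` the constants `0` and `1`,
`12` to `15` the addresses `2 n`, `3 n`, `4 n` and `6 n`. Real registers: `0` the constant of the
soft-thresholding operator, `1` the last coordinate of the point, `15` the constant `0`. -/

/-- The data of the separation problem are available. -/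
structure Ready (n : ℕ) (lam w : ℝ) (a lo hi y : ℕ → ℝ) (s : State) : Prop where
  dim : s.natReg 2 = n
  zero : s.natReg 10 = 0
  one : s.natReg 11 = 1
  addrHi : s.natReg 12 = 2 * n
  addrY : s.natReg 13 = 3 * n
  addrPairs : s.natReg 14 = 4 * n
  addrWork : s.natReg 15 = 6 * n
  searchZero : s.natReg 26 = 0
  searchFour : s.natReg 27 = 4
  lam_eq : s.realReg 0 = lam
  w_eq : s.realReg 1 = w
  realZero : s.realReg 15 = 0
  a_eq : ∀ j < n, s.realMem j = a j
  lo_eq : ∀ j < n, s.realMem (n + j) = lo j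
  hi_eq : ∀ j < n, s.realMem (2 * n + j) = hi j
  y_eq : ∀ j < n, s.realMem (3 * n + j) = y j

theorem Ready.congr {n : ℕ} {lam w : ℝ} {a lo hi y : ℕ → ℝ} {s s' : State}
    (h : Ready n lam w a lo hi y s)
    (hn : ∀ i ∈ [2, 10, 11, 12, 13, 14, 15, 26, 27], s'.natReg i = s.natReg i)
    (hr : ∀ i ∈ [0, 1, 15], s'.realReg i = s.realReg i)
    (hm : ∀ k < 4 * n, s'.realMem k = s.realMem k) : Ready n lam w a lo hi y s' where
  dim := (hn 2 (by simp)).trans h.dim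
  zero := (hn 10 (by simp)).trans h.zero
  one := (hn 11 (by simp)).trans h.one
  addrHi := (hn 12 (by simp)).trans h.addrHi
  addrY := (hn 13 (by simp)).trans h.addrY
  addrPairs := (hn 14 (by simp)).trans h.addrPairs
  addrWork := (hn 15 (by simp)).trans h.addrWork
  searchZero := (hn 26 (by simp)).trans h.searchZero
  searchFour := (hn 27 (by simp)).trans h.searchFour
  lam_eq := (hr 0 (by simp)).trans h.lam_eq
  w_eq := (hr 1 (by simp)).trans h.w_eq
  realZero := (hr 15 (by simp)).trans h.realZero
  a_eq j hj := (hm j (by omega)).trans (h.a_eq j hj)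
  lo_eq j hj := (hm _ (by omega)).trans (h.lo_eq j hj)
  hi_eq j hj := (hm _ (by omega)).trans (h.hi_eq j hj)
  y_eq j hj := (hm _ (by omega)).trans (h.y_eq j hj)

/-- Computes the constants of the program. -/
def setup : Cmd := ops [.natAdd 2 0 1, .natAdd 12 2 2, .natAdd 13 12 2, .natAdd 14 12 12,
  .natAdd 15 14 12, .natConst 10 0, .natConst 11 1, .natConst 26 0, .natConst 27 4, .realConst 15 0]

theorem run_setup (d p : ℕ) (lam w : ℝ) (a lo hi y : Fin (d + p) → ℝ) :
    Ready (d + p) lam w (readVec a) (readVec lo) (readVec hi) (readVec y)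
      (setup.run (separationInput d p lam a lo hi y w)) := by
  have hm : (setup.run (separationInput d p lam a lo hi y w)).realMem =
      (separationInput d p lam a lo hi y w).realMem := by simp [setup, Op.apply]
  refine ⟨?_, ?_, ?_, ?_, ?_, ?_, ?_, ?_, ?_, ?_, ?_, ?_, ?_, ?_, ?_, ?_⟩
  all_goals try rw [hm]
  · simp [setup, Op.apply, separationInput]
  · simp [setup, Op.apply]
  · simp [setup, Op.apply]
  · simp [setup, Op.apply, separationInput]; ring
  · simp [setup, Op.apply, separationInput]; ring
  · simp [setup, Op.apply, separationInput]; ring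
  · simp [setup, Op.apply, separationInput]; ring
  · simp [setup, Op.apply]
  · simp [setup, Op.apply]
  · simp [setup, Op.apply, separationInput]
  · simp [setup, Op.apply, separationInput]
  · simp [setup, Op.apply]
  · intro j hj
    simp only [separationInput]
    rw [if_pos hj]
  · intro j hj
    simp only [separationInput]
    rw [if_neg (by omega), if_pos (by omega), Nat.add_sub_cancel_left]
  · intro j hj
    simp only [separationInput]
    rw [if_neg (by omega), if_neg (by omega), if_pos (by omega), Nat.add_sub_cancel_left]
  · intro j hj
    simp only [separationInput]
    rw [if_neg (by omega), if_neg (by omega), if_neg (by omega), Nat.add_sub_cancel_left]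

/-! ### Writing a vector with the opposite sign -/

/-- Starts a loop over the coordinates. -/
def initIndex : Cmd := .op (.natConst 3 0)

/-- One step of `negCopy`. -/
def negCopyBody (k : ℕ) : Cmd :=
  ops [.natAdd 4 k 3, .realLoad 2 4, .realSub 2 15 2, .realStore 3 2, .natAdd 3 3 11]

/-- Writes the vector at the address in the natural register `k`, with the opposite sign, to the
address `0`. -/
def negCopy (k : ℕ) : Cmd := .seq initIndex (.loop (.natLt 3 2) (negCopyBody k))

theorem runs_negCopy (procs : List Cmd) (k n : ℕ) (v : ℕ → ℝ) (s : State)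
    (hk : k ∈ [10, 15]) (hv : ∀ j < n, s.realMem (s.natReg k + j) = v j)
    (h1 : s.natReg 11 = 1) (hn : s.natReg 2 = n) (h0 : s.realReg 15 = 0) :
    Runs procs (negCopy k) s (20 * n + 10) (fun s' =>
      (∀ j < n, s'.realMem j = -v j) ∧ (∀ j, n ≤ j → s'.realMem j = s.realMem j) ∧
      (∀ i, i ∉ [3, 4] → s'.natReg i = s.natReg i) ∧
      (∀ i, i ∉ [2] → s'.realReg i = s.realReg i)) := by
  have hk' : k ≠ 3 ∧ k ≠ 4 := by
    simp only [List.mem_cons, List.not_mem_nil, or_false] at hk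
    omega
  let Inv : ℕ → State → Prop := fun i s' => s'.natReg 3 = i ∧
    (∀ j < i, s'.realMem j = -v j) ∧ (∀ j, i ≤ j → s'.realMem j = s.realMem j) ∧
    (∀ i, i ∉ [3, 4] → s'.natReg i = s.natReg i) ∧
    (∀ i, i ∉ [2] → s'.realReg i = s.realReg i)
  refine (Runs.seq (T₁ := initIndex.cost) (Runs.of_straight rfl ((Runs.forLoop Inv n 7 ?_ ?_ ?_).mono
    le_rfl ?_))).mono ?_ (fun _ => id)
  · rintro i hi s₁ ⟨e₁, e₂, e₃, e₄, e₅⟩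
    have d2 := (e₄ 2 (by simp)).trans hn
    have d11 := (e₄ 11 (by simp)).trans h1
    have dk := e₄ k (by simp; omega)
    have c15 := (e₅ 15 (by simp)).trans h0
    -- The source address is at least i, so the cell has not been overwritten yet, even when source
    -- and target coincide.
    have hval : s₁.realMem (s.natReg k + i) = v i := by rw [e₃ _ (by omega), hv i hi]
    refine ⟨by simp [Test.Holds, e₁, d2, hi], (Runs.of_straight (c := negCopyBody k) rfl ?_).mono
      (by simp [negCopyBody, ops, Cmd.cost]) (fun _ => id)⟩
    have key : ∃ s', (negCopyBody k).run s₁ = s' ∧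
        s'.realMem = Function.update s₁.realMem i (-v i) ∧ s'.natReg 3 = i + 1 ∧
        (∀ i, i ∉ [3, 4] → s'.natReg i = s₁.natReg i) ∧
        (∀ i, i ∉ [2] → s'.realReg i = s₁.realReg i) := by
      refine ⟨_, rfl, ?_⟩
      simp +contextual [negCopyBody, Op.apply, e₁, d11, dk, c15, hval]
    obtain ⟨s₂, hs₂, f₁, f₂, f₃, f₄⟩ := key
    rw [hs₂]
    refine ⟨f₂, fun j hj => ?_, fun j hj => ?_, fun j hj => (f₃ j hj).trans (e₄ j hj),
      fun j hj => (f₄ j hj).trans (e₅ j hj)⟩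
    · rcases Nat.lt_succ_iff_lt_or_eq.1 hj with hj | rfl
      · rw [f₁, Function.update_of_ne (by omega), e₂ j hj]
      · rw [f₁, Function.update_self]
    · rw [f₁, Function.update_of_ne (by omega), e₃ j (by omega)]
  · rintro s₁ ⟨e₁, -, -, e₄, -⟩
    simp [Test.Holds, e₁, e₄ 2 (by simp), hn]
  · refine ⟨?_, ?_, ?_, ?_, ?_⟩ <;> simp +contextual [initIndex, Cmd.run, Op.apply]
  · rintro s₁ ⟨-, e₂, e₃, e₄, e₅⟩
    exact ⟨e₂, e₃, e₄, e₅⟩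
  · have : initIndex.cost = 1 := rfl
    omega

/-! ### The bounds -/

section Body

variable {n : ℕ} {lam w : ℝ} {a lo hi y : ℕ → ℝ}

/-- Loads the `i`-th coordinates of all vectors. -/
def loadCoords : Cmd := ops [.realLoad 2 3, .natAdd 4 2 3, .realLoad 3 4, .natAdd 4 12 3,
  .realLoad 4 4, .natAdd 4 13 3, .realLoad 5 4]

theorem run_loadCoords {s : State} {i : ℕ} (h : Ready n lam w a lo hi y s) (hi' : s.natReg 3 = i)
    (hin : i < n) : ∃ s', loadCoords.run s = s' ∧ s'.realMem = s.realMem ∧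
      (∀ i, i ∉ [4] → s'.natReg i = s.natReg i) ∧
      (∀ i, i ∉ [2, 3, 4, 5] → s'.realReg i = s.realReg i) ∧
      s'.realReg 2 = a i ∧ s'.realReg 3 = lo i ∧ s'.realReg 4 = hi i ∧ s'.realReg 5 = y i := by
  refine ⟨_, rfl, ?_⟩
  simp +contextual [loadCoords, Op.apply, h.dim, h.addrHi, h.addrY, hi', h.a_eq i hin,
    h.lo_eq i hin, h.hi_eq i hin, h.y_eq i hin]

/-- The coefficient of the bound that is violated, with the opposite sign. -/
noncomputable def boundCoef (lo hi y : ℝ) : ℝ := if y < lo then 1 else if hi < y then -1 else 0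

/-- The right-hand side of the bound that is violated. -/
noncomputable def boundRhs (lo hi y : ℝ) : ℝ := if y < lo then -lo else if hi < y then hi else 0

/-- The amount by which the bounds are violated. -/
noncomputable def boundGap (lo hi y : ℝ) : ℝ :=
  if y < lo then lo - y else if hi < y then y - hi else 0

/-- One step of `checkBounds`. -/
def checkBoundsBody : Cmd := block [loadCoords, ops [.natAdd 4 15 3],
  .cond (.realLt 5 3)
    (ops [.realConst 8 1, .realStore 4 8, .realSub 13 13 3, .realSub 8 3 5, .realAdd 14 14 8])
    (.cond (.realLt 4 5)
      (ops [.realConst 8 1, .realSub 8 15 8, .realStore 4 8, .realAdd 13 13 4, .realSub 8 5 4,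
        .realAdd 14 14 8])
      (ops [.realStore 4 15])),
  ops [.natAdd 3 3 11]]

/-- Computes the sum of the violated bounds. -/
def checkBounds : Cmd := .seq (ops [.natConst 3 0, .realConst 13 0, .realConst 14 0])
  (.loop (.natLt 3 2) checkBoundsBody)

theorem runs_checkBounds (procs : List Cmd) {s : State} (h : Ready n lam w a lo hi y s) :
    Runs procs checkBounds s (40 * n + 10) (fun s' => Ready n lam w a lo hi y s' ∧
      (∀ j < n, s'.realMem (6 * n + j) = boundCoef (lo j) (hi j) (y j)) ∧
      s'.realReg 13 = ∑ j ∈ Finset.range n, boundRhs (lo j) (hi j) (y j) ∧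
      s'.realReg 14 = ∑ j ∈ Finset.range n, boundGap (lo j) (hi j) (y j)) := by
  let Inv : ℕ → State → Prop := fun i s' => s'.natReg 3 = i ∧ Ready n lam w a lo hi y s' ∧
      (∀ j < i, s'.realMem (6 * n + j) = boundCoef (lo j) (hi j) (y j)) ∧
      s'.realReg 13 = ∑ j ∈ Finset.range i, boundRhs (lo j) (hi j) (y j) ∧
      s'.realReg 14 = ∑ j ∈ Finset.range i, boundGap (lo j) (hi j) (y j)
  refine (Runs.seq (T₁ := (ops [.natConst 3 0, .realConst 13 0, .realConst 14 0]).cost)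
    (Runs.of_straight rfl ((Runs.forLoop Inv n 25 ?_ ?_ ?_).mono
    le_rfl ?_))).mono ?_ (fun _ => id)
  · rintro i hi' s₁ ⟨e₁, e₂, e₃, e₄, e₅⟩
    refine ⟨by simp [Test.Holds, e₁, e₂.dim, hi'], (Runs.of_straight rfl ?_).mono
      (by decide) (fun _ => id)⟩
    have key : ∃ s', checkBoundsBody.run s₁ = s' ∧
        s'.realMem = Function.update s₁.realMem (6 * n + i) (boundCoef (lo i) (hi i) (y i)) ∧
        s'.natReg 3 = i + 1 ∧
        (∀ i, i ∉ [3, 4] → s'.natReg i = s₁.natReg i) ∧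
        (∀ i, i ∉ [2, 3, 4, 5, 8, 13, 14] → s'.realReg i = s₁.realReg i) ∧
        s'.realReg 13 = s₁.realReg 13 + boundRhs (lo i) (hi i) (y i) ∧
        s'.realReg 14 = s₁.realReg 14 + boundGap (lo i) (hi i) (y i) := by
      refine ⟨_, rfl, ?_⟩
      obtain ⟨s₂, hs₂, f₁, f₂, f₃, -, f₅, f₆, f₇⟩ := run_loadCoords e₂ e₁ hi'
      rw [checkBoundsBody]
      simp only [block_cons, block_singleton, run_seq, hs₂]
      by_cases h₁ : y i < lo i
      · simp +contextual [Cmd.run, Op.apply, Test.Holds, f₁, f₂, f₃, f₅, f₇, e₂.addrWork, e₂.one, e₁, h₁,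
          boundCoef, boundRhs, boundGap, sub_eq_add_neg]
      · by_cases h₂ : hi i < y i <;>
        simp +contextual [Cmd.run, Op.apply, Test.Holds, f₁, f₂, f₃, f₅, f₆, f₇, e₂.addrWork, e₂.one, e₁,
          e₂.realZero, h₁, h₂, boundCoef, boundRhs, boundGap]
    obtain ⟨s₂, hs₂, f₁, f₂, f₃, f₄, f₅, f₆⟩ := key
    rw [hs₂]
    refine ⟨f₂, e₂.congr (fun j hj => f₃ j ?_) (fun j hj => f₄ j ?_) (fun j hj => ?_), fun j hj => ?_,
      ?_, ?_⟩
    · simp at hj ⊢; omega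
    · simp at hj ⊢; omega
    · rw [f₁, Function.update_of_ne (by omega)]
    · rcases Nat.lt_succ_iff_lt_or_eq.1 hj with hj | rfl
      · rw [f₁, Function.update_of_ne (by omega), e₃ j hj]
      · rw [f₁, Function.update_self]
    · rw [f₅, e₄, Finset.sum_range_succ]
    · rw [f₆, e₅, Finset.sum_range_succ]
  · rintro s₁ ⟨e₁, e₂, -⟩
    simp [Test.Holds, e₁, e₂.dim]
  · refine ⟨by simp [Op.apply], h.congr (fun j hj => ?_) (fun j hj => ?_) (fun j hj => ?_), by simp,
      ?_, ?_⟩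
    · simp at hj
      rcases hj with rfl | rfl | rfl | rfl | rfl | rfl | rfl | rfl | rfl <;> simp [Op.apply]
    · simp at hj
      rcases hj with rfl | rfl | rfl <;> simp [Op.apply]
    · simp [Op.apply]
    · simp [Op.apply]
    · simp [Op.apply]
  · rintro s₁ ⟨-, e₂, e₃, e₄, e₅⟩
    exact ⟨e₂, e₃, e₄, e₅⟩
  · have : (ops [.natConst 3 0, .realConst 13 0, .realConst 14 0]).cost = 4 := rfl
    omega

/-! ### Relative coordinates -/

/-- Finds the bound at which the term of a coordinate is least, and the other one. -/
def loadEnds : Cmd := .cond (.realLe 15 2) (ops [.realAdd 6 3 15, .realAdd 7 4 15])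
  (ops [.realAdd 6 4 15, .realAdd 7 3 15])

/-- Loads the `i`-th coordinates of all vectors, and the ends. -/
def loadAll : Cmd := .seq loadCoords loadEnds

theorem run_loadAll {s : State} {i : ℕ} (h : Ready n lam w a lo hi y s) (hi' : s.natReg 3 = i)
    (hin : i < n) : ∃ s', loadAll.run s = s' ∧ s'.realMem = s.realMem ∧
      (∀ i, i ∉ [4] → s'.natReg i = s.natReg i) ∧
      (∀ i, i ∉ [2, 3, 4, 5, 6, 7] → s'.realReg i = s.realReg i) ∧
      s'.realReg 2 = a i ∧ s'.realReg 5 = y i ∧ s'.realReg 6 = nearEnd (a i) (lo i) (hi i) ∧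
      s'.realReg 7 = farEnd (a i) (lo i) (hi i) := by
  refine ⟨_, rfl, ?_⟩
  obtain ⟨s₂, hs₂, f₁, f₂, f₃, f₄, f₅, f₆, f₇⟩ := run_loadCoords h hi' hin
  rw [loadAll, run_seq, hs₂]
  by_cases h₀ : 0 ≤ a i <;>
  simp +contextual [loadEnds, Cmd.run, Op.apply, Test.Holds, f₁, f₂, f₃, f₄, f₅, f₆, f₇, h.realZero, h₀,
    nearEnd, farEnd]

/-- One step of `relativeCoords`. -/
def relativeBody : Cmd := .seq loadAll
  (ops [.realSub 8 7 6, .realMul 9 2 8, .realSub 19 5 6, .realDiv 19 19 8, .realMul 8 2 6,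
    .realAdd 10 10 8, .realAdd 11 11 9, .realMul 8 2 5, .realAdd 12 12 8,
    .natAdd 4 14 3, .natAdd 4 4 3, .natAdd 5 15 3, .natAdd 5 5 3, .realStore 4 19, .realStore 5 19,
    .natAdd 4 4 11, .natAdd 5 5 11, .realStore 4 9, .realStore 5 9, .natAdd 3 3 11])

/-- Writes relative positions and spreads of the coordinates to two places in the memory. -/
def relativeCoords : Cmd :=
  .seq (ops [.natConst 3 0, .realConst 10 0, .realConst 11 0, .realConst 12 0])
    (.loop (.natLt 3 2) relativeBody)

/-- Two copies are needed because the search compacts the one at 6n, while the one at 4n serves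
later for the sums at the threshold and for the multipliers. -/
theorem runs_relativeCoords (procs : List Cmd) {s : State} (h : Ready n lam w a lo hi y s) :
    Runs procs relativeCoords s (50 * n + 10) (fun s' => Ready n lam w a lo hi y s' ∧
      (∀ j < n, s'.realMem (4 * n + 2 * j) = relPos (a j) (lo j) (hi j) (y j) ∧
        s'.realMem (4 * n + 2 * j + 1) = spread (a j) (lo j) (hi j) ∧
        s'.realMem (6 * n + 2 * j) = relPos (a j) (lo j) (hi j) (y j) ∧
        s'.realMem (6 * n + 2 * j + 1) = spread (a j) (lo j) (hi j)) ∧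
      s'.realReg 10 = ∑ j ∈ Finset.range n, a j * nearEnd (a j) (lo j) (hi j) ∧
      s'.realReg 11 = ∑ j ∈ Finset.range n, spread (a j) (lo j) (hi j) ∧
      s'.realReg 12 = ∑ j ∈ Finset.range n, a j * y j) := by
  let Inv : ℕ → State → Prop := fun i s' => s'.natReg 3 = i ∧ Ready n lam w a lo hi y s' ∧
      (∀ j < i, s'.realMem (4 * n + 2 * j) = relPos (a j) (lo j) (hi j) (y j) ∧
        s'.realMem (4 * n + 2 * j + 1) = spread (a j) (lo j) (hi j) ∧
        s'.realMem (6 * n + 2 * j) = relPos (a j) (lo j) (hi j) (y j) ∧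
        s'.realMem (6 * n + 2 * j + 1) = spread (a j) (lo j) (hi j)) ∧
      s'.realReg 10 = ∑ j ∈ Finset.range i, a j * nearEnd (a j) (lo j) (hi j) ∧
      s'.realReg 11 = ∑ j ∈ Finset.range i, spread (a j) (lo j) (hi j) ∧
      s'.realReg 12 = ∑ j ∈ Finset.range i, a j * y j
  refine (Runs.seq (T₁ := (ops [.natConst 3 0, .realConst 10 0, .realConst 11 0,
    .realConst 12 0]).cost) (Runs.of_straight rfl ((Runs.forLoop Inv n 40 ?_ ?_ ?_).mono
    le_rfl ?_))).mono ?_ (fun _ => id)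
  · rintro i hi' s₁ ⟨e₁, e₂, e₃, e₄, e₅, e₆⟩
    refine ⟨by simp [Test.Holds, e₁, e₂.dim, hi'], (Runs.of_straight rfl ?_).mono
      (by decide) (fun _ => id)⟩
    have key : ∃ s', relativeBody.run s₁ = s' ∧
        s'.realMem = Function.update (Function.update (Function.update (Function.update s₁.realMem
          (4 * n + 2 * i) (relPos (a i) (lo i) (hi i) (y i)))
          (6 * n + 2 * i) (relPos (a i) (lo i) (hi i) (y i)))
          (4 * n + 2 * i + 1) (spread (a i) (lo i) (hi i)))
          (6 * n + 2 * i + 1) (spread (a i) (lo i) (hi i)) ∧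
        s'.natReg 3 = i + 1 ∧
        (∀ i, i ∉ [3, 4, 5] → s'.natReg i = s₁.natReg i) ∧
        (∀ i, i ∉ [2, 3, 4, 5, 6, 7, 8, 9, 10, 11, 12, 19] → s'.realReg i = s₁.realReg i) ∧
        s'.realReg 10 = s₁.realReg 10 + a i * nearEnd (a i) (lo i) (hi i) ∧
        s'.realReg 11 = s₁.realReg 11 + spread (a i) (lo i) (hi i) ∧
        s'.realReg 12 = s₁.realReg 12 + a i * y i := by
      refine ⟨_, rfl, ?_⟩
      obtain ⟨s₂, hs₂, f₁, f₂, f₃, f₄, f₅, f₆, f₇⟩ := run_loadAll e₂ e₁ hi'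
      rw [relativeBody, run_seq, hs₂]
      simp +contextual [Op.apply, f₁, f₂, f₃, f₄, f₅, f₆, f₇, e₂.addrPairs, e₂.addrWork, e₂.one, e₁,
        relPos, spread,
        add_assoc, two_mul]
    obtain ⟨s₂, hs₂, f₁, f₂, f₃, f₄, f₅, f₆, f₇⟩ := key
    rw [hs₂]
    refine ⟨f₂, e₂.congr (fun j hj => f₃ j ?_) (fun j hj => f₄ j ?_) (fun j hj => ?_), fun j hj => ?_,
      ?_, ?_, ?_⟩
    · simp at hj ⊢; omega
    · simp at hj ⊢; omega
    · rw [f₁, Function.update_of_ne (by omega), Function.update_of_ne (by omega),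
        Function.update_of_ne (by omega), Function.update_of_ne (by omega)]
    · rw [f₁]
      rcases Nat.lt_succ_iff_lt_or_eq.1 hj with hj | rfl
      · obtain ⟨g₁, g₂, g₃, g₄⟩ := e₃ j hj
        refine ⟨?_, ?_, ?_, ?_⟩ <;>
        rwa [Function.update_of_ne (by omega), Function.update_of_ne (by omega),
          Function.update_of_ne (by omega), Function.update_of_ne (by omega)]
      · refine ⟨?_, ?_, ?_, ?_⟩
        · rw [Function.update_of_ne (by omega), Function.update_of_ne (by omega),
            Function.update_of_ne (by omega), Function.update_self]
        · rw [Function.update_of_ne (by omega), Function.update_self]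
        · rw [Function.update_of_ne (by omega), Function.update_of_ne (by omega),
            Function.update_self]
        · rw [Function.update_self]
    · rw [f₅, e₄, Finset.sum_range_succ]
    · rw [f₆, e₅, Finset.sum_range_succ]
    · rw [f₇, e₆, Finset.sum_range_succ]
  · rintro s₁ ⟨e₁, e₂, -⟩
    simp [Test.Holds, e₁, e₂.dim]
  · refine ⟨by simp [Op.apply], h.congr (fun j hj => ?_) (fun j hj => ?_) (fun j hj => ?_), by simp,
      ?_, ?_, ?_⟩
    · simp at hj
      rcases hj with rfl | rfl | rfl | rfl | rfl | rfl | rfl | rfl | rfl <;> simp [Op.apply]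
    · simp at hj
      rcases hj with rfl | rfl | rfl <;> simp [Op.apply]
    all_goals simp [Op.apply]
  · rintro s₁ ⟨-, e₂⟩
    exact e₂
  · have : (ops [.natConst 3 0, .realConst 10 0, .realConst 11 0, .realConst 12 0]).cost = 5 := rfl
    omega

end Body

/-! ### The multipliers of a supporting inequality -/

/-- Starts the search for the threshold. -/
def enterThreshold : Cmd := ops [.natAdd 20 15 10, .natAdd 21 2 10, .realSub 20 0 10,
  .realAdd 21 10 0, .realSub 21 15 21, .realConst 22 0, .realConst 23 0, .realConst 24 1]

/-- Prepares the computation of masses and moment for the threshold. -/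
def prepareSums : Cmd := ops [.natAdd 23 14 10, .natAdd 22 2 10, .realAdd 25 24 15,
  .realConst 26 0, .realConst 27 0, .realConst 28 0]

/-- Computes the multipliers from the threshold. -/
def solveMultipliers : Cmd := block [
  ops [.realSub 8 10 0, .realAdd 8 8 28, .realMul 9 24 26, .realSub 9 27 9, .realConst 19 1,
    .realSub 19 19 24, .realAdd 18 10 0, .realSub 18 15 18, .realMul 19 19 18],
  .cond (.realLe 9 19)
    (ops [.realAdd 9 0 0, .realAdd 9 8 9, .realDiv 18 8 9, .realAdd 16 18 15, .realAdd 17 18 15])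
    (ops [.realSub 9 28 26, .realDiv 16 8 9, .realConst 17 0, .realConst 18 0])]

/-- The multipliers when a threshold has to be found. -/
def thresholdMultipliers : Cmd :=
  block [enterThreshold, .call 0, prepareSums, scan, solveMultipliers]

/-- Computes the multipliers of a supporting inequality. -/
def chooseMultipliers : Cmd := .seq (ops [.realSub 8 15 0, .realAdd 9 10 11])
  (.cond (.realLe 12 8)
    (ops [.realConst 24 0, .realConst 16 1, .realConst 17 1, .realConst 18 1])
    (.cond (.realLe 9 0)
      (ops [.realConst 24 1, .realSub 24 15 24, .realConst 16 0, .realConst 17 0, .realConst 18 0])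
      thresholdMultipliers))

section Upper

variable {n : ℕ} {lam w : ℝ} {a lo hi y : ℕ → ℝ}

/-- The registers `24`, `16`, `17` and `18` hold a threshold and multipliers that define a supporting
inequality. -/
def HasMultipliers (n : ℕ) (lam : ℝ) (a lo hi y : ℕ → ℝ) (s : State) : Prop :=
  Supports lam (fun i : Fin n => a i) (fun i => lo i) (fun i => hi i) (fun i => y i)
    (fun i => multiplier (s.realReg 24) (s.realReg 16) (s.realReg 17)
      (relPos (a i) (lo i) (hi i) (y i)) * a i)
    (s.realReg 18 * (leastValue (fun i : Fin n => a i) (fun i => lo i) (fun i => hi i) + lam) -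
      ∑ i : Fin n, multiplier (s.realReg 24) (s.realReg 16) (s.realReg 17)
        (relPos (a i) (lo i) (hi i) (y i)) * a i * nearEnd (a i) (lo i) (hi i))

/-- Relative positions and spreads are available, and the real registers `10`, `11` and `12` hold the
least value, the total spread and the value at the given point. -/
structure HasCoords (n : ℕ) (a lo hi y : ℕ → ℝ) (s : State) : Prop where
  pairs : Holds s.realMem (4 * n)
    ((List.range n).map fun j => (relPos (a j) (lo j) (hi j) (y j), spread (a j) (lo j) (hi j)))
  least : s.realReg 10 = leastValue (fun i : Fin n => a i) (fun i => lo i) (fun i => hi i)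

/-- The search runs with K = lam - b and c = -(b + lam), for which `Stop` compares φ with ψ and
tests the slope of ψ. It returns only r, so one more scan of the untouched copy provides the sums
from which θ or κ is computed. -/
theorem runs_thresholdMultipliers {procs : List Cmd} (hprocs : procs[0]? = some search) {s : State}
    (h : Ready n lam w a lo hi y s) (hlam : 0 < lam)
    (hbox : (fun i : Fin n => y i) ∈ Set.Icc (fun i : Fin n => lo i) (fun i => hi i))
    (hc : HasCoords n a lo hi y s)
    (hcopy : Holds s.realMem (6 * n)
      ((List.range n).map fun j => (relPos (a j) (lo j) (hi j) (y j), spread (a j) (lo j) (hi j))))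
    (ht : -lam < (fun i : Fin n => a i) ⬝ᵥ (fun i => y i))
    (hU : lam < leastValue (fun i : Fin n => a i) (fun i => lo i) (fun i => hi i) +
      ∑ i : Fin n, spread (a i) (lo i) (hi i)) :
    Runs procs thresholdMultipliers s (5020 * n + 50) (fun s' => Ready n lam w a lo hi y s' ∧
      HasCoords n a lo hi y s' ∧ HasMultipliers n lam a lo hi y s') := by
  set F : ℕ → ℝ × ℝ := fun j => (relPos (a j) (lo j) (hi j) (y j), spread (a j) (lo j) (hi j))
    with hFdef
  set L := (List.range n).map F with hLdef
  set b := leastValue (fun i : Fin n => a i) (fun i => lo i) (fun i => hi i) with hb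
  have hF : ∀ i : Fin n, F i = (relPos (a i) (lo i) (hi i) (y i), spread (a i) (lo i) (hi i)) :=
    fun _ => rfl
  have hlen : L.length = n := by simp [L]
  have hL1 : ∀ p ∈ L, p.1 ≤ 1 := by
    intro p hp
    obtain ⟨i, rfl⟩ := (mem_map_range hF).1 hp
    exact relPos_le_one (hbox.1 i) (hbox.2 i)
  rw [thresholdMultipliers]
  simp only [block_cons, block_singleton]
  suffices H : Runs procs
      (.seq enterThreshold (.seq (.call 0) (.seq prepareSums (.seq scan solveMultipliers)))) s
      (enterThreshold.cost + ((5000 * n + 2) + (prepareSums.cost + ((20 * n + 1) +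
        solveMultipliers.cost)))) (fun s' => Ready n lam w a lo hi y s' ∧
      HasCoords n a lo hi y s' ∧ HasMultipliers n lam a lo hi y s') by
    refine H.mono ?_ (fun _ => id)
    have h₁ : enterThreshold.cost = 9 := rfl
    have h₂ : prepareSums.cost = 7 := rfl
    have h₃ : solveMultipliers.cost ≤ 17 := by decide
    omega
  refine Runs.seq (Runs.of_straight rfl ?_)
  have e : ∃ s₁, enterThreshold.run s = s₁ ∧ s₁.realMem = s.realMem ∧
      (∀ i, i ∉ [20, 21] → s₁.natReg i = s.natReg i) ∧
      (∀ i, i ∉ [20, 21, 22, 23, 24] → s₁.realReg i = s.realReg i) ∧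
      s₁.natReg 20 = 6 * n ∧ s₁.natReg 21 = n ∧ s₁.realReg 20 = lam - b ∧
      s₁.realReg 21 = -(b + lam) ∧ s₁.realReg 22 = 0 ∧ s₁.realReg 23 = 0 ∧ s₁.realReg 24 = 1 := by
    refine ⟨_, rfl, ?_⟩
    simp +contextual [enterThreshold, Op.apply, h.dim, h.zero, h.addrWork, h.lam_eq, h.realZero,
      hc.least, ← hb]
  obtain ⟨s₁, hs₁, a₁, a₂, a₃, a₄, a₅, a₆, a₇, a₈, a₉, a₁₀⟩ := e
  rw [hs₁]
  have hin : InSearch (lam - b) (-(b + lam)) L (6 * n) L s₁ :=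
    ⟨a₄, by rw [a₅, hlen], (a₂ 26 (by simp)).trans h.searchZero,
      (a₂ 27 (by simp)).trans h.searchFour, a₆, a₇, by rwa [a₁],
      by rw [a₈, a₉, a₁₀]; exact .start hL1⟩
  refine Runs.seq ((Runs.call hprocs (runs_search hprocs hin)).mono (by rw [hlen]) ?_)
  rintro s₂ ⟨hp, hr⟩
  have c₁ : ∀ k < 6 * n, s₂.realMem k = s.realMem k := fun k hk => by rw [hp.realMem k hk, a₁]
  have c₂ : ∀ i, i < 20 ∨ i = 26 ∨ i = 27 → s₂.natReg i = s.natReg i := by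
    rintro i (hi | rfl | rfl)
    · rw [hp.natReg i hi, a₂ i (by simp; omega)]
    · rw [hp.natReg26, a₂ 26 (by simp)]
    · rw [hp.natReg27, a₂ 27 (by simp)]
  have c₃ : ∀ i < 20, s₂.realReg i = s.realReg i := fun i hi => by
    rw [hp.realReg i hi, a₃ i (by simp; omega)]
  refine Runs.seq (Runs.of_straight rfl ?_)
  have e : ∃ s₃, prepareSums.run s₂ = s₃ ∧ s₃.realMem = s₂.realMem ∧
      (∀ i, i ∉ [22, 23] → s₃.natReg i = s₂.natReg i) ∧
      (∀ i, i ∉ [25, 26, 27, 28] → s₃.realReg i = s₂.realReg i) ∧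
      s₃.natReg 22 = n ∧ s₃.natReg 23 = 4 * n ∧ s₃.realReg 25 = s₂.realReg 24 ∧
      s₃.realReg 26 = 0 ∧ s₃.realReg 27 = 0 ∧ s₃.realReg 28 = 0 := by
    refine ⟨_, rfl, ?_⟩
    simp +contextual [prepareSums, Op.apply, c₂, c₃, h.dim, h.zero, h.addrPairs, h.realZero]
  obtain ⟨s₃, hs₃, d₁, d₂, d₃, d₄, d₅, d₆, d₇, d₈, d₉⟩ := e
  rw [hs₃]
  have hpairs : Holds s₃.realMem (4 * n) L := hc.pairs.congr fun k _ hk => by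
    simp only [List.length_map, List.length_range] at hk
    rw [d₁, c₁ k (by omega)]
  refine Runs.seq ((runs_scan procs L s₃
    (by rw [d₂ 26 (by simp), c₂ 26 (by simp), h.searchZero]) (by rw [d₄, hlen])
    (by rwa [d₅])).mono (by rw [hlen]) ?_)
  rintro s₄ ⟨e₁, -, e₂, e₃, e₄, e₅, e₆⟩
  rw [d₆, d₇, zero_add] at e₄
  rw [d₆, d₈, zero_add] at e₅
  rw [d₆, d₉, zero_add] at e₆
  set r := s₂.realReg 24 with hrdef
  have g24 : s₄.realReg 24 = r := by rw [e₃ 24 (by simp), d₃ 24 (by simp)]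
  have g0 : s₄.realReg 0 = lam := by rw [e₃ 0 (by simp), d₃ 0 (by simp), c₃ 0 (by simp), h.lam_eq]
  have g10 : s₄.realReg 10 = b := by
    rw [e₃ 10 (by simp), d₃ 10 (by simp), c₃ 10 (by simp), hc.least]
  have g15 : s₄.realReg 15 = 0 := by
    rw [e₃ 15 (by simp), d₃ 15 (by simp), c₃ 15 (by simp), h.realZero]
  have ready₄ : Ready n lam w a lo hi y s₄ := h.congr
    (fun i hi => by
      rw [e₂ i (by simp at hi ⊢; omega), d₂ i (by simp at hi ⊢; omega),
        c₂ i (by simp at hi; omega)])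
    (fun i hi => by
      rw [e₃ i (by simp at hi ⊢; omega), d₃ i (by simp at hi ⊢; omega),
        c₃ i (by simp at hi; omega)])
    (fun k hk => by rw [e₁, d₁, c₁ k (by omega)])
  have hpairs₄ : Holds s₄.realMem (4 * n) L := by rwa [e₁]
  refine Runs.of_straight rfl ?_
  have key : ∃ s₅, solveMultipliers.run s₄ = s₅ ∧ s₅.realMem = s₄.realMem ∧
      s₅.natReg = s₄.natReg ∧ (∀ i, i ∉ [8, 9, 16, 17, 18, 19] → s₅.realReg i = s₄.realReg i) ∧
      (momentAbove L r - r * massAbove L r ≤ (1 - r) * -(b + lam) ∧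
        s₅.realReg 16 = s₅.realReg 18 ∧ s₅.realReg 17 = s₅.realReg 18 ∧
        s₅.realReg 18 = (b - lam + massFrom L r) / (b - lam + massFrom L r + (lam + lam)) ∨
      ¬ momentAbove L r - r * massAbove L r ≤ (1 - r) * -(b + lam) ∧ s₅.realReg 17 = 0 ∧
        s₅.realReg 18 = 0 ∧
        s₅.realReg 16 = (b - lam + massFrom L r) / (massFrom L r - massAbove L r)) := by
    refine ⟨_, rfl, ?_⟩
    by_cases hcr : momentAbove L r - r * massAbove L r ≤ (1 - r) * -(b + lam)
    · have hcr' := hcr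
      rw [neg_add_rev] at hcr'
      simp +contextual [solveMultipliers, Cmd.run, Op.apply, Test.Holds, e₄, e₅, e₆, g24, g0, g10,
        g15, hcr']
    · have hcr' := hcr
      rw [neg_add_rev] at hcr'
      simp +contextual [solveMultipliers, Cmd.run, Op.apply, Test.Holds, e₄, e₅, e₆, g24, g0, g10,
        g15, hcr']
  obtain ⟨s₅, hs₅, f₁, f₂, f₃, hcase⟩ := key
  rw [hs₅]
  refine ⟨ready₄.congr (fun i _ => by rw [f₂]) (fun i hi => f₃ i (by simp at hi ⊢; omega))
    (fun k _ => by rw [f₁]), ⟨by rwa [f₁], by rw [f₃ 10 (by simp), g10]⟩, ?_⟩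
  have hr24 : s₅.realReg 24 = r := by rw [f₃ 24 (by simp), g24]
  rw [HasMultipliers, hr24]
  rcases hcase with ⟨hcr, k₁, k₂, k₃⟩ | ⟨hcr, k₁, k₂, k₃⟩
  · rw [k₁, k₂]
    exact supports_of_crossing hlam hbox hLdef hF hr ht hU hcr k₃
  · rw [k₁, k₂]
    exact supports_of_not_crossing hlam hbox hLdef hF hr hU hcr k₃

/-- The two bounds with μ = 0 are tried before the search; their failure yields `ht` and `hU`, which
the threshold case needs for μ ≥ 0 and for a positive left slope at r. -/
theorem runs_chooseMultipliers {procs : List Cmd} (hprocs : procs[0]? = some search) {s : State}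
    (h : Ready n lam w a lo hi y s) (hlam : 0 < lam)
    (hbox : (fun i : Fin n => y i) ∈ Set.Icc (fun i : Fin n => lo i) (fun i => hi i))
    (hc : HasCoords n a lo hi y s)
    (hcopy : Holds s.realMem (6 * n)
      ((List.range n).map fun j => (relPos (a j) (lo j) (hi j) (y j), spread (a j) (lo j) (hi j))))
    (hsum : s.realReg 11 = ∑ i : Fin n, spread (a i) (lo i) (hi i))
    (hval : s.realReg 12 = (fun i : Fin n => a i) ⬝ᵥ (fun i => y i)) :
    Runs procs chooseMultipliers s (5020 * n + 60) (fun s' => Ready n lam w a lo hi y s' ∧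
      HasCoords n a lo hi y s' ∧ HasMultipliers n lam a lo hi y s') := by
  set b := leastValue (fun i : Fin n => a i) (fun i => lo i) (fun i => hi i) with hb
  set W := ∑ i : Fin n, spread (a i) (lo i) (hi i) with hW
  set t := (fun i : Fin n => a i) ⬝ᵥ (fun i => y i) with ht
  refine (Runs.seq (T₂ := 5020 * n + 52) (Runs.of_straight rfl ?_)).mono ?_ (fun _ => id)
  · have key : ∃ s₁, (ops [.realSub 8 15 0, .realAdd 9 10 11]).run s = s₁ ∧
        s₁.realMem = s.realMem ∧ s₁.natReg = s.natReg ∧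
        (∀ i, i ∉ [8, 9] → s₁.realReg i = s.realReg i) ∧ s₁.realReg 8 = -lam ∧
        s₁.realReg 9 = b + W := by
      refine ⟨_, rfl, ?_⟩
      simp +contextual [Op.apply, h.realZero, h.lam_eq, hc.least, hsum, ← hb]
    obtain ⟨s₁, hs₁, a₁, a₂, a₃, a₄, a₅⟩ := key
    rw [hs₁]
    have ready : Ready n lam w a lo hi y s₁ := h.congr (fun i _ => by rw [a₂])
      (fun i hi => a₃ i (by simp at hi ⊢; omega)) (fun k _ => by rw [a₁])
    have coords : HasCoords n a lo hi y s₁ :=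
      ⟨by rw [a₁]; exact hc.pairs, by rw [a₃ 10 (by simp), hc.least]⟩
    have hval₁ : s₁.realReg 12 = t := by rw [a₃ 12 (by simp), hval]
    refine Runs.ite (fun hb₁ => ?_) (fun hb₁ => Runs.ite (fun hb₂ => ?_) (fun hb₂ => ?_))
    · have ht' : t ≤ -lam := by simpa [Test.Holds, hval₁, a₄] using hb₁
      refine (Runs.of_straight rfl ?_).mono (T₁ := 5) (by omega) (fun _ => id)
      have key : ∃ s₂, (ops [.realConst 24 0, .realConst 16 1, .realConst 17 1,
          .realConst 18 1]).run s₁ = s₂ ∧ s₂.realMem = s₁.realMem ∧ s₂.natReg = s₁.natReg ∧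
          (∀ i, i ∉ [16, 17, 18, 24] → s₂.realReg i = s₁.realReg i) ∧
          s₂.realReg 16 = 1 ∧ s₂.realReg 17 = 1 ∧ s₂.realReg 18 = 1 := by
        refine ⟨_, rfl, ?_⟩
        simp +contextual [Op.apply]
      obtain ⟨s₂, hs₂, e₁, e₂, e₃, e₄, e₅, e₆⟩ := key
      rw [hs₂]
      refine ⟨ready.congr (fun i _ => by rw [e₂]) (fun i hi => e₃ i (by simp at hi ⊢; omega))
        (fun k _ => by rw [e₁]), ⟨by rw [e₁]; exact coords.pairs,
          by rw [e₃ 10 (by simp), coords.least]⟩, ?_⟩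
      rw [HasMultipliers, e₄, e₅, e₆]
      exact supports_of_le_neg hlam hbox ht' _
    · have ht' : -lam < t := by simpa [Test.Holds, hval₁, a₄] using hb₁
      have hU : b + W ≤ lam := by simpa [Test.Holds, a₅, ready.lam_eq] using hb₂
      refine (Runs.of_straight rfl ?_).mono (T₁ := 6) (by omega) (fun _ => id)
      have key : ∃ s₂, (ops [.realConst 24 1, .realSub 24 15 24, .realConst 16 0, .realConst 17 0,
          .realConst 18 0]).run s₁ = s₂ ∧ s₂.realMem = s₁.realMem ∧ s₂.natReg = s₁.natReg ∧
          (∀ i, i ∉ [16, 17, 18, 24] → s₂.realReg i = s₁.realReg i) ∧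
          s₂.realReg 16 = 0 ∧ s₂.realReg 17 = 0 ∧ s₂.realReg 18 = 0 ∧ s₂.realReg 24 = -1 := by
        refine ⟨_, rfl, ?_⟩
        simp +contextual [Op.apply, ready.realZero]
      obtain ⟨s₂, hs₂, e₁, e₂, e₃, e₄, e₅, e₆, e₇⟩ := key
      rw [hs₂]
      refine ⟨ready.congr (fun i _ => by rw [e₂]) (fun i hi => e₃ i (by simp at hi ⊢; omega))
        (fun k _ => by rw [e₁]), ⟨by rw [e₁]; exact coords.pairs,
          by rw [e₃ 10 (by simp), coords.least]⟩, ?_⟩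
      rw [HasMultipliers, e₄, e₅, e₆, e₇]
      exact supports_of_greatest_le hlam hbox ht'.le hU (by norm_num)
    · have ht' : -lam < t := by simpa [Test.Holds, hval₁, a₄] using hb₁
      have hU : lam < b + W := by simpa [Test.Holds, a₅, ready.lam_eq] using hb₂
      exact runs_thresholdMultipliers hprocs ready hlam hbox coords (by rwa [a₁]) ht' hU
  · have : (ops [.realSub 8 15 0, .realAdd 9 10 11]).cost = 3 := rfl
    omega

/-! ### The supporting inequality -/

/-- One step of `writeBound`. -/
def writeBoundBody : Cmd := block [loadAll,
  ops [.natAdd 4 14 3, .natAdd 4 4 3, .realLoad 19 4, .natAdd 4 15 3],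
  .cond (.realLt 19 24) (ops [.realConst 8 1])
    (.cond (.realLt 24 19) (ops [.realAdd 8 17 15]) (ops [.realAdd 8 16 15])),
  ops [.realMul 9 8 2, .realStore 4 9, .realMul 8 9 6, .realSub 13 13 8, .realMul 8 9 5,
    .realAdd 14 14 8, .natAdd 3 3 11]]

/-- Writes the coefficients of the supporting inequality, its constant and its value. -/
def writeBound : Cmd := block [
  ops [.natConst 3 0, .realAdd 8 10 0, .realMul 13 18 8, .realConst 14 0],
  .loop (.natLt 3 2) writeBoundBody,
  ops [.realAdd 14 14 13]]

/-- The memory holds an upper bound that supports the convex hull at the given point: its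
coefficients, in the real register `13` its constant, and in `14` its value. -/
def HasBound (n : ℕ) (lam : ℝ) (a lo hi y : ℕ → ℝ) (s : State) : Prop :=
  ∃ α : ℕ → ℝ, (∀ j < n, s.realMem (6 * n + j) = α j) ∧
    Supports lam (fun i : Fin n => a i) (fun i => lo i) (fun i => hi i) (fun i => y i)
      (fun i => α i) (s.realReg 13) ∧
    s.realReg 14 = (fun i : Fin n => α i) ⬝ᵥ (fun i => y i) + s.realReg 13

theorem Holds.apply_map_range {mem : ℕ → ℝ} {p n : ℕ} {f : ℕ → ℝ × ℝ}
    (h : Holds mem p ((List.range n).map f)) {j : ℕ} (hj : j < n) : mem (p + 2 * j) = (f j).1 := by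
  induction n generalizing p f j with
  | zero => omega
  | succ n ih =>
    rw [List.range_succ_eq_map, List.map_cons, List.map_map] at h
    obtain ⟨h₁, -, h₃⟩ := h
    cases j with
    | zero => exact h₁
    | succ j =>
      have := ih h₃ (j := j) (by omega)
      rw [show p + 2 * (j + 1) = p + 2 + 2 * j by ring]
      exact this

/-- Positions are read from the copy at 4n, so the work area at 6n is free for the coefficients. The
vector a at address 0 must survive for the second pass. -/
theorem runs_writeBound (procs : List Cmd) {s : State} (h : Ready n lam w a lo hi y s)
    (hc : HasCoords n a lo hi y s) (hm : HasMultipliers n lam a lo hi y s) :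
    Runs procs writeBound s (40 * n + 10) (fun s' => Ready n lam w a lo hi y s' ∧
      HasBound n lam a lo hi y s') := by
  set r := s.realReg 24 with hr
  set κ₂ := s.realReg 16 with hκ₂
  set κ₃ := s.realReg 17 with hκ₃
  set θ := s.realReg 18 with hθ
  set b := leastValue (fun i : Fin n => a i) (fun i => lo i) (fun i => hi i) with hb
  set α : ℕ → ℝ := fun j => multiplier r κ₂ κ₃ (relPos (a j) (lo j) (hi j) (y j)) * a j with hα
  let Inv : ℕ → State → Prop := fun i s' => s'.natReg 3 = i ∧ Ready n lam w a lo hi y s' ∧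
    (∀ k < 6 * n, s'.realMem k = s.realMem k) ∧ (∀ j < i, s'.realMem (6 * n + j) = α j) ∧
    s'.realReg 24 = r ∧ s'.realReg 16 = κ₂ ∧ s'.realReg 17 = κ₃ ∧
    s'.realReg 13 = θ * (b + lam) - ∑ j ∈ Finset.range i, α j * nearEnd (a j) (lo j) (hi j) ∧
    s'.realReg 14 = ∑ j ∈ Finset.range i, α j * y j
  rw [writeBound]
  simp only [block_cons, block_singleton]
  refine (Runs.seq (T₂ := ((29 + 1) * n + 1) + 2) (Runs.of_straight rfl (Runs.seq
    ((Runs.forLoop Inv n 29 ?_ ?_ ?_).mono le_rfl ?_)))).mono ?_ (fun _ => id)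
  · rintro i hi' s₁ ⟨e₁, e₂, e₃, e₄, e₅, e₆, e₇, e₈, e₉⟩
    refine ⟨by simp [Test.Holds, e₁, e₂.dim, hi'], (Runs.of_straight rfl ?_).mono
      (by decide) (fun _ => id)⟩
    have hx : s₁.realMem (4 * n + i + i) = relPos (a i) (lo i) (hi i) (y i) := by
      rw [e₃ _ (by omega), add_assoc, ← two_mul]
      exact hc.pairs.apply_map_range hi'
    have key : ∃ s', writeBoundBody.run s₁ = s' ∧
        s'.realMem = Function.update s₁.realMem (6 * n + i) (α i) ∧
        s'.natReg 3 = i + 1 ∧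
        (∀ i, i ∉ [3, 4] → s'.natReg i = s₁.natReg i) ∧
        (∀ i, i ∉ [2, 3, 4, 5, 6, 7, 8, 9, 13, 14, 19] → s'.realReg i = s₁.realReg i) ∧
        s'.realReg 13 = s₁.realReg 13 - α i * nearEnd (a i) (lo i) (hi i) ∧
        s'.realReg 14 = s₁.realReg 14 + α i * y i := by
      refine ⟨_, rfl, ?_⟩
      obtain ⟨s₂, hs₂, f₁, f₂, f₃, f₄, f₅, f₆, f₇⟩ := run_loadAll e₂ e₁ hi'
      rw [writeBoundBody]
      simp only [block_cons, block_singleton, run_seq, hs₂]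
      by_cases h₁ : relPos (a i) (lo i) (hi i) (y i) < r
      · simp +contextual [Cmd.run, Op.apply, Test.Holds, f₁, f₂, f₃, f₄, f₅, f₆, e₂.addrWork,
          e₂.addrPairs, e₂.one, e₁, e₅, hx, h₁, hα, multiplier]
      · by_cases h₂ : r < relPos (a i) (lo i) (hi i) (y i)
        · simp +contextual [Cmd.run, Op.apply, Test.Holds, f₁, f₂, f₃, f₄, f₅, f₆, e₂.addrWork,
            e₂.addrPairs, e₂.one, e₂.realZero, e₁, e₅, e₇, hx, h₁, h₂, hα, multiplier]
        · simp +contextual [Cmd.run, Op.apply, Test.Holds, f₁, f₂, f₃, f₄, f₅, f₆, e₂.addrWork,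
            e₂.addrPairs, e₂.one, e₂.realZero, e₁, e₅, e₆, hx, h₁, h₂, hα, multiplier]
    obtain ⟨s₂, hs₂, f₁, f₂, f₃, f₄, f₅, f₆⟩ := key
    rw [hs₂]
    refine ⟨f₂, e₂.congr (fun j hj => f₃ j ?_) (fun j hj => f₄ j ?_) (fun j hj => ?_),
      fun k hk => ?_, fun j hj => ?_, ?_, ?_, ?_, ?_, ?_⟩
    · simp at hj ⊢; omega
    · simp at hj ⊢; omega
    · rw [f₁, Function.update_of_ne (by omega)]
    · rw [f₁, Function.update_of_ne (by omega), e₃ k hk]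
    · rcases Nat.lt_succ_iff_lt_or_eq.1 hj with hj | rfl
      · rw [f₁, Function.update_of_ne (by omega), e₄ j hj]
      · rw [f₁, Function.update_self]
    · rw [f₄ 24 (by simp), e₅]
    · rw [f₄ 16 (by simp), e₆]
    · rw [f₄ 17 (by simp), e₇]
    · rw [f₅, e₈, Finset.sum_range_succ]; ring
    · rw [f₆, e₉, Finset.sum_range_succ]
  · rintro s₁ ⟨e₁, e₂, -⟩
    simp [Test.Holds, e₁, e₂.dim]
  · have key : ∃ s', (ops [.natConst 3 0, .realAdd 8 10 0, .realMul 13 18 8, .realConst 14 0]).run s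
        = s' ∧ s'.realMem = s.realMem ∧ s'.natReg 3 = 0 ∧
        (∀ i, i ∉ [3] → s'.natReg i = s.natReg i) ∧
        (∀ i, i ∉ [8, 13, 14] → s'.realReg i = s.realReg i) ∧
        s'.realReg 13 = θ * (b + lam) ∧ s'.realReg 14 = 0 := by
      refine ⟨_, rfl, ?_⟩
      simp +contextual [Op.apply, hc.least, h.lam_eq, hθ, ← hb]
    obtain ⟨s₁, hs₁, e₁, e₂, e₃, e₄, e₅, e₆⟩ := key
    rw [hs₁]
    refine ⟨e₂, h.congr (fun i hi => e₃ i (by simp at hi ⊢; omega))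
      (fun i hi => e₄ i (by simp at hi ⊢; omega)) (fun k _ => by rw [e₁]), fun k _ => by rw [e₁],
      by simp, e₄ 24 (by simp), e₄ 16 (by simp), e₄ 17 (by simp), ?_, ?_⟩
    · simp [e₅]
    · simp [e₆]
  · rintro s₁ ⟨-, e₂, -, e₄, -, -, -, e₈, e₉⟩
    refine (Runs.of_straight rfl ?_).mono (T₁ := 2) le_rfl (fun _ => id)
    have key : ∃ s', (ops [.realAdd 14 14 13]).run s₁ = s' ∧ s'.realMem = s₁.realMem ∧
        s'.natReg = s₁.natReg ∧ (∀ i, i ∉ [14] → s'.realReg i = s₁.realReg i) ∧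
        s'.realReg 14 = s₁.realReg 14 + s₁.realReg 13 := by
      refine ⟨_, rfl, ?_⟩
      simp +contextual [Op.apply]
    obtain ⟨s₂, hs₂, f₁, f₂, f₃, f₄⟩ := key
    rw [hs₂]
    have h13 := f₃ 13 (by simp)
    refine ⟨e₂.congr (fun i _ => by rw [f₂]) (fun i hi => f₃ i (by simp at hi ⊢; omega))
      (fun k _ => by rw [f₁]), α, fun j hj => by rw [f₁, e₄ j hj], ?_, ?_⟩
    · rw [h13, e₈, Finset.sum_range]
      exact hm
    · rw [f₄, h13, e₉, Finset.sum_range]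
      rfl
  · have : (ops [.natConst 3 0, .realAdd 8 10 0, .realMul 13 18 8, .realConst 14 0]).cost = 5 := rfl
    omega

/-- Computes a supporting inequality. -/
def upper : Cmd := block [relativeCoords, chooseMultipliers, writeBound]

theorem runs_upper {procs : List Cmd} (hprocs : procs[0]? = some search) {s : State}
    (h : Ready n lam w a lo hi y s) (hlam : 0 < lam)
    (hbox : (fun i : Fin n => y i) ∈ Set.Icc (fun i : Fin n => lo i) (fun i => hi i)) :
    Runs procs upper s (5110 * n + 80) (fun s' => Ready n lam w a lo hi y s' ∧
      HasBound n lam a lo hi y s') := by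
  rw [upper]
  simp only [block_cons, block_singleton]
  refine (Runs.seq (T₂ := (5020 * n + 60) + (40 * n + 10))
    ((runs_relativeCoords procs h).mono le_rfl ?_)).mono (by omega) (fun _ => id)
  rintro s₁ ⟨h₁, hmem, hb, hW, ht⟩
  rw [Finset.sum_range] at hb hW ht
  have p₁ := holds_map_range (mem := s₁.realMem) (p := 4 * n) n
    (f := fun j => (relPos (a j) (lo j) (hi j) (y j), spread (a j) (lo j) (hi j)))
    fun j hj => ⟨(hmem j hj).1, (hmem j hj).2.1⟩
  have p₂ := holds_map_range (mem := s₁.realMem) (p := 6 * n) n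
    (f := fun j => (relPos (a j) (lo j) (hi j) (y j), spread (a j) (lo j) (hi j)))
    fun j hj => ⟨(hmem j hj).2.2.1, (hmem j hj).2.2.2⟩
  refine Runs.seq ((runs_chooseMultipliers hprocs h₁ hlam hbox ⟨p₁, hb⟩ p₂ hW ht).mono le_rfl ?_)
  rintro s₂ ⟨h₂, hc, hm⟩
  exact runs_writeBound procs h₂ hc hm

end Upper

end RealRAM

/-! ### Answers to the separation problem -/

section Answers

variable {n : ℕ} {lam w : ℝ} {a lo hi y : Fin n → ℝ}

/-- Soft-thresholding is odd, so the linear map w ↦ -w carries the graph for a into the graph for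
-a, and convex hulls commute with linear images. -/
theorem mem_convexHull_softGraph_neg (hlam : 0 < lam) {q : (Fin n → ℝ) × ℝ}
    (hq : q ∈ convexHull ℝ (softGraph lam a lo hi)) :
    (q.1, -q.2) ∈ convexHull ℝ (softGraph lam (-a) lo hi) := by
  let f : ((Fin n → ℝ) × ℝ) →ₗ[ℝ] ((Fin n → ℝ) × ℝ) :=
    LinearMap.prodMap LinearMap.id (-LinearMap.id)
  have h : f q ∈ f '' convexHull ℝ (softGraph lam a lo hi) := Set.mem_image_of_mem f hq
  rw [f.image_convexHull] at h
  refine convexHull_mono ?_ h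
  rintro _ ⟨⟨z, v⟩, ⟨hz, hv⟩, rfl⟩
  refine ⟨hz, ?_⟩
  change -v = softThreshold lam (-a ⬝ᵥ z)
  rw [neg_dotProduct, softThreshold_neg hlam, neg_inj]
  exact hv

theorem mem_Icc_of_mem_convexHull {q : (Fin n → ℝ) × ℝ}
    (hq : q ∈ convexHull ℝ (softGraph lam a lo hi)) : q.1 ∈ Set.Icc lo hi := by
  have : convexHull ℝ (softGraph lam a lo hi) ⊆ Set.Icc lo hi ×ˢ Set.univ :=
    convexHull_min (fun q hq => ⟨hq.1, trivial⟩) ((convex_Icc lo hi).prod convex_univ)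
  exact (this hq).1

/-- Between (y, l) and (y, w) the violation of any inequality with coefficient ±1 changes by at most
|w - l|. A valid one starts from at most 0, and a violated one that is tight at (y, l) gains exactly
|w - l|. -/
theorem isMostViolated_of_violation_eq_zero {c : LinIneq n} {S : Set ((Fin n → ℝ) × ℝ)} {l : ℝ}
    (hc : c.ValidOn S) (hγ : |c.coefW| = 1) (hl : (y, l) ∈ S) (h₀ : c.violation (y, l) = 0)
    (hpos : 0 < c.violation (y, w)) : c.IsMostViolated S (y, w) := by
  refine ⟨hc, hγ, fun c' hc' hγ' => ?_⟩
  have e : ∀ c : LinIneq n, c.violation (y, w) = c.violation (y, l) + c.coefW * (w - l) := by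
    intro c
    simp only [LinIneq.violation]
    ring
  have h₁ := hc' _ hl
  have h₂ : c'.coefW * (w - l) ≤ |w - l| := by
    calc _ ≤ |c'.coefW * (w - l)| := le_abs_self _
      _ = _ := by rw [abs_mul, hγ', one_mul]
  have h₃ : c.coefW * (w - l) = |w - l| := by
    rw [e c, h₀, zero_add] at hpos
    rw [← abs_of_pos hpos, abs_mul, hγ, one_mul]
  rw [e c, e c', h₀, h₃]
  linarith

theorem answersSeparation_of_violated {S : Set ((Fin n → ℝ) × ℝ)} {q : (Fin n → ℝ) × ℝ}
    {s : RealRAM.State} {c : LinIneq n} (h0 : s.natReg 0 = 0) (hs : outputIneq n s = c)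
    (hc : c.ValidOn S) (hq : 0 < c.violation q)
    (hm : q.1 ∈ Set.Icc lo hi → c.IsMostViolated S q) : AnswersSeparation S lo hi q s :=
  ⟨fun h => absurd (hc q h) (not_le.2 hq), fun _ => ⟨h0, by rwa [hs], by rwa [hs], by rwa [hs]⟩⟩

theorem answersSeparation_of_mem {S : Set ((Fin n → ℝ) × ℝ)} {q : (Fin n → ℝ) × ℝ}
    {s : RealRAM.State} (h1 : s.natReg 0 = 1) (hq : q ∈ S) : AnswersSeparation S lo hi q s :=
  ⟨fun _ => h1, fun h => absurd hq h⟩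

/-- Separation by the upper bound. -/
theorem answersSeparation_of_lt {α : Fin n → ℝ} {β : ℝ} {s : RealRAM.State}
    (h : Supports lam a lo hi y α β) (hw : α ⬝ᵥ y + β < w) (h0 : s.natReg 0 = 0)
    (hs : outputIneq n s = ⟨-α, 1, β⟩) :
    AnswersSeparation (convexHull ℝ (softGraph lam a lo hi)) lo hi (y, w) s := by
  have hvalid : (⟨-α, 1, β⟩ : LinIneq n).ValidOn (convexHull ℝ (softGraph lam a lo hi)) := by
    intro q hq
    have := le_of_mem_convexHull h.bound hq
    simp only [LinIneq.violation, neg_dotProduct]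
    linarith
  have hpos : 0 < (⟨-α, 1, β⟩ : LinIneq n).violation (y, w) := by
    simp only [LinIneq.violation, neg_dotProduct]
    linarith
  refine answersSeparation_of_violated h0 hs hvalid hpos fun _ =>
    isMostViolated_of_violation_eq_zero hvalid (by simp) h.tight ?_ hpos
  simp only [LinIneq.violation, neg_dotProduct]
  ring

/-- Separation by the lower bound. -/
theorem answersSeparation_of_gt (hlam : 0 < lam) {α : Fin n → ℝ} {β : ℝ} {s : RealRAM.State}
    (h : Supports lam (-a) lo hi y α β) (hw : α ⬝ᵥ y + β < -w) (h0 : s.natReg 0 = 0)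
    (hs : outputIneq n s = ⟨-α, -1, β⟩) :
    AnswersSeparation (convexHull ℝ (softGraph lam a lo hi)) lo hi (y, w) s := by
  have hvalid : (⟨-α, -1, β⟩ : LinIneq n).ValidOn (convexHull ℝ (softGraph lam a lo hi)) := by
    intro q hq
    have := le_of_mem_convexHull h.bound (mem_convexHull_softGraph_neg hlam hq)
    simp only [LinIneq.violation, neg_dotProduct]
    linarith
  have hpos : 0 < (⟨-α, -1, β⟩ : LinIneq n).violation (y, w) := by
    simp only [LinIneq.violation, neg_dotProduct]
    linarith
  have htight := mem_convexHull_softGraph_neg hlam h.tight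
  rw [neg_neg] at htight
  refine answersSeparation_of_violated h0 hs hvalid hpos fun _ =>
    isMostViolated_of_violation_eq_zero hvalid (by simp) htight ?_ hpos
  simp only [LinIneq.violation, neg_dotProduct]
  ring

/-- A point between the lower and the upper bound belongs to the convex hull. -/
theorem mem_convexHull_of_supports (hlam : 0 < lam) {α α' : Fin n → ℝ} {β β' : ℝ}
    (h : Supports lam a lo hi y α β) (hw : w ≤ α ⬝ᵥ y + β)
    (h' : Supports lam (-a) lo hi y α' β') (hw' : -w ≤ α' ⬝ᵥ y + β') :
    (y, w) ∈ convexHull ℝ (softGraph lam a lo hi) := by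
  have htight := mem_convexHull_softGraph_neg hlam h'.tight
  rw [neg_neg] at htight
  -- The fibre over y is convex, hence contains everything between the two attained bounds.
  have hconv : Convex ℝ {v : ℝ | (y, v) ∈ convexHull ℝ (softGraph lam a lo hi)} := by
    intro u hu v hv s t hs ht hst
    have := (convex_convexHull ℝ (softGraph lam a lo hi)) hu hv hs ht hst
    rw [Prod.smul_mk, Prod.smul_mk, Prod.mk_add_mk, ← add_smul, hst, one_smul] at this
    exact this
  exact hconv.ordConnected.out htight h.tight ⟨by linarith, hw⟩

theorem boundGap_nonneg (lo hi y : ℝ) : 0 ≤ RealRAM.boundGap lo hi y := by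
  rw [RealRAM.boundGap]
  split_ifs <;> linarith

/-- Separation by the sum of the violated bounds. -/
theorem answersSeparation_of_boundGap {s : RealRAM.State}
    (hgap : 0 < ∑ i, RealRAM.boundGap (lo i) (hi i) (y i)) (h0 : s.natReg 0 = 0)
    (hs : outputIneq n s = ⟨fun i => -RealRAM.boundCoef (lo i) (hi i) (y i), 0,
      ∑ i, RealRAM.boundRhs (lo i) (hi i) (y i)⟩) :
    AnswersSeparation (convexHull ℝ (softGraph lam a lo hi)) lo hi (y, w) s := by
  refine answersSeparation_of_violated h0 hs (fun q hq => ?_) ?_ (fun hy => ?_)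
  · have hq' := mem_Icc_of_mem_convexHull hq
    simp only [LinIneq.violation, dotProduct, zero_mul, add_zero, sub_nonpos]
    refine Finset.sum_le_sum fun i _ => ?_
    have h₁ := hq'.1 i
    have h₂ := hq'.2 i
    rw [RealRAM.boundCoef, RealRAM.boundRhs]
    split_ifs <;> linarith
  · simp only [LinIneq.violation, dotProduct, zero_mul, add_zero, ← Finset.sum_sub_distrib]
    refine hgap.trans_eq (Finset.sum_congr rfl fun i _ => ?_)
    rw [RealRAM.boundCoef, RealRAM.boundRhs, RealRAM.boundGap]
    split_ifs <;> ring
  -- Inside the box all gaps vanish, so nothing has to be shown about most violated inequalities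
  -- here.
  · refine absurd hgap (not_lt.2 (Finset.sum_nonpos fun i _ => ?_))
    rw [RealRAM.boundGap, if_neg (not_lt.2 (hy.1 i)), if_neg (not_lt.2 (hy.2 i))]

theorem mem_Icc_of_sum_boundGap_le (hgap : ∑ i, RealRAM.boundGap (lo i) (hi i) (y i) ≤ 0)
    (hbox : lo ≤ hi) : y ∈ Set.Icc lo hi := by
  have h0 : ∀ i, RealRAM.boundGap (lo i) (hi i) (y i) = 0 := fun i =>
    (Finset.sum_eq_zero_iff_of_nonneg fun i _ => boundGap_nonneg _ _ _).1
      (le_antisymm hgap (Finset.sum_nonneg fun i _ => boundGap_nonneg _ _ _)) i (Finset.mem_univ i)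
  refine ⟨fun i => ?_, fun i => ?_⟩
  all_goals
    by_contra hlt
    have h₁ := h0 i
    have h₂ := hbox i
    rw [RealRAM.boundGap] at h₁
    split_ifs at h₁ <;> linarith

end Answers

namespace RealRAM

/-! ### The whole program -/

/-- Outputs the inequality whose coefficients are in the work area, with the opposite sign, whose last
coefficient is in the real register `16` and whose right-hand side is in `13`. -/
def emit : Cmd := .seq (negCopy 15) (ops [.realAdd 0 16 15, .realAdd 1 13 15, .natConst 0 0])

theorem runs_emit (procs : List Cmd) {n : ℕ} {lam w : ℝ} {a lo hi y v : ℕ → ℝ} {s : State}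
    (h : Ready n lam w a lo hi y s) (hv : ∀ j < n, s.realMem (6 * n + j) = v j) :
    Runs procs emit s (20 * n + 20) (fun s' => s'.natReg 0 = 0 ∧
      outputIneq n s' = ⟨fun i => -v i, s.realReg 16, s.realReg 13⟩) := by
  refine (Runs.seq (T₂ := 4) ((runs_negCopy procs 15 n v s (by simp)
    (by rw [h.addrWork]; exact hv) h.one h.dim h.realZero).mono le_rfl ?_)).mono (by omega)
    (fun _ => id)
  rintro s₁ ⟨e₁, -, -, e₄⟩
  refine Runs.of_straight (c := ops [.realAdd 0 16 15, .realAdd 1 13 15, .natConst 0 0]) rfl ?_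
  refine ⟨by simp [Op.apply], ?_⟩
  have e16 := e₄ 16 (by simp)
  have e13 := e₄ 13 (by simp)
  have e15 := (e₄ 15 (by simp)).trans h.realZero
  simp only [outputIneq, LinIneq.mk.injEq]
  refine ⟨funext fun i => ?_, ?_, ?_⟩
  · simp [Op.apply, e₁ i i.2]
  · simp [Op.apply, e16, e15]
  · simp [Op.apply, e13, e15]

/-- Passes from the upper to the lower bounds. -/
def reflect : Cmd := .seq (negCopy 10) (ops [.realSub 1 15 1])

theorem runs_reflect (procs : List Cmd) {n : ℕ} {lam w : ℝ} {a lo hi y : ℕ → ℝ} {s : State}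
    (h : Ready n lam w a lo hi y s) :
    Runs procs reflect s (20 * n + 20) (Ready n lam (-w) (fun j => -a j) lo hi y) := by
  refine (Runs.seq (T₂ := 2) ((runs_negCopy procs 10 n a s (by simp)
    (by rw [h.zero]; simpa using h.a_eq) h.one h.dim h.realZero).mono le_rfl ?_)).mono (by omega)
    (fun _ => id)
  rintro s₁ ⟨e₁, e₂, e₃, e₄⟩
  refine Runs.of_straight (c := ops [.realSub 1 15 1]) rfl ?_
  have key : ∃ s', (ops [.realSub 1 15 1]).run s₁ = s' ∧ s'.realMem = s₁.realMem ∧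
      s'.natReg = s₁.natReg ∧ (∀ i, i ∉ [1] → s'.realReg i = s₁.realReg i) ∧
      s'.realReg 1 = -w := by
    refine ⟨_, rfl, ?_⟩
    simp +contextual [Op.apply, e₄, h.realZero, h.w_eq]
  obtain ⟨s₂, hs₂, f₁, f₂, f₃, f₄⟩ := key
  rw [hs₂]
  have hn : ∀ i, i ∉ [3, 4] → s₂.natReg i = s.natReg i := fun i hi => by rw [f₂, e₃ i hi]
  have hr : ∀ i, i ∉ [1, 2] → s₂.realReg i = s.realReg i := fun i hi => by
    rw [f₃ i (by simp at hi ⊢; omega), e₄ i (by simp at hi ⊢; omega)]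
  exact ⟨(hn 2 (by simp)).trans h.dim, (hn 10 (by simp)).trans h.zero,
    (hn 11 (by simp)).trans h.one, (hn 12 (by simp)).trans h.addrHi,
    (hn 13 (by simp)).trans h.addrY, (hn 14 (by simp)).trans h.addrPairs,
    (hn 15 (by simp)).trans h.addrWork, (hn 26 (by simp)).trans h.searchZero,
    (hn 27 (by simp)).trans h.searchFour, (hr 0 (by simp)).trans h.lam_eq, f₄,
    (hr 15 (by simp)).trans h.realZero, fun j hj => by rw [f₁, e₁ j hj],
    fun j hj => by rw [f₁, e₂ _ (by omega), h.lo_eq j hj],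
    fun j hj => by rw [f₁, e₂ _ (by omega), h.hi_eq j hj],
    fun j hj => by rw [f₁, e₂ _ (by omega), h.y_eq j hj]⟩

/-- Outputs the inequality in the work area, with the last coefficient that the given instructions
write to the real register `16`. -/
def emitWith (os : List Op) : Cmd := .seq (ops os) emit

/-- Separation by the lower bounds. -/
def separateBelow : Cmd := block [reflect, upper,
  .cond (.realLt 14 1) (emitWith [.realConst 16 1, .realSub 16 15 16]) (ops [.natConst 0 1])]

/-- Separation by the upper and the lower bounds. -/
def separateInBox : Cmd :=
  block [upper, .cond (.realLt 14 1) (emitWith [.realConst 16 1]) separateBelow]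

/-- The separation program. -/
def separation : Program where
  main := block [setup, checkBounds,
    .cond (.realLt 15 14) (emitWith [.realConst 16 0]) separateInBox]
  procs := [search]

section Separation

variable {n : ℕ} {lam w : ℝ} {a lo hi y : ℕ → ℝ}

theorem runs_emitWith (procs : List Cmd) {v : ℕ → ℝ} {s : State} {os : List Op} {γ : ℝ}
    (hcost : (ops os).cost ≤ 5) (hstraight : (ops os).straight = true)
    (h : Ready n lam w a lo hi y s) (hv : ∀ j < n, s.realMem (6 * n + j) = v j)
    (hmem : ((ops os).run s).realMem = s.realMem) (hnat : ((ops os).run s).natReg = s.natReg)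
    (hreal : ∀ i, i ∉ [16] → ((ops os).run s).realReg i = s.realReg i)
    (hγ : ((ops os).run s).realReg 16 = γ) :
    Runs procs (emitWith os) s (20 * n + 25) (fun s' => s'.natReg 0 = 0 ∧
      outputIneq n s' = ⟨fun i => -v i, γ, s.realReg 13⟩) := by
  refine (Runs.seq (T₂ := 20 * n + 20) (Runs.of_straight hstraight ?_)).mono (by omega)
    (fun _ => id)
  have ready : Ready n lam w a lo hi y ((ops os).run s) := h.congr (fun i _ => by rw [hnat])
    (fun i hi => hreal i (by simp at hi ⊢; omega)) (fun k _ => by rw [hmem])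
  have := runs_emit procs ready (v := v) (fun j hj => by rw [hmem, hv j hj])
  rwa [hγ, hreal 13 (by simp)] at this

/-- The second pass overwrites the upper bound in the machine. It survives only as `hα` and `hw`,
which are needed to conclude membership when the lower bound is respected as well. -/
theorem runs_separateBelow {procs : List Cmd} (hprocs : procs[0]? = some search) {s : State}
    (h : Ready n lam w a lo hi y s) (hlam : 0 < lam)
    (hbox : (fun i : Fin n => y i) ∈ Set.Icc (fun i : Fin n => lo i) (fun i => hi i))
    {α : Fin n → ℝ} {β : ℝ}
    (hα : Supports lam (fun i : Fin n => a i) (fun i => lo i) (fun i => hi i) (fun i => y i) α β)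
    (hw : w ≤ α ⬝ᵥ (fun i => y i) + β) :
    Runs procs separateBelow s (5150 * n + 130) (AnswersSeparation
      (convexHull ℝ (softGraph lam (fun i : Fin n => a i) (fun i => lo i) (fun i => hi i)))
      (fun i => lo i) (fun i => hi i) (fun i => y i, w)) := by
  rw [separateBelow]
  simp only [block_cons, block_singleton]
  refine (Runs.seq (T₂ := (5110 * n + 80) + (20 * n + 26))
    ((runs_reflect procs h).mono le_rfl ?_)).mono (by omega) (fun _ => id)
  intro s₁ h₁
  refine Runs.seq ((runs_upper hprocs h₁ hlam hbox).mono le_rfl ?_)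
  rintro s₂ ⟨h₂, α', hmem, hsup, hval⟩
  refine Runs.ite (fun hb => ?_) (fun hb => ?_)
  · refine (runs_emitWith procs (v := α') (γ := -1) (by decide) rfl h₂ hmem
      (by simp [Op.apply]) (by simp [Op.apply]) (by simp +contextual [Op.apply])
      (by simp [Op.apply, h₂.realZero])).mono le_rfl ?_
    rintro s₃ ⟨h0, hout⟩
    have hlt : s₂.realReg 14 < s₂.realReg 1 := hb
    rw [hval, h₂.w_eq] at hlt
    exact answersSeparation_of_gt hlam hsup hlt h0 hout
  · refine (Runs.of_straight (c := ops [.natConst 0 1]) rfl ?_).mono (T₁ := 2) (by omega)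
      (fun _ => id)
    have hle : s₂.realReg 1 ≤ s₂.realReg 14 := not_lt.1 hb
    rw [hval, h₂.w_eq] at hle
    exact answersSeparation_of_mem (by simp [Op.apply])
      (mem_convexHull_of_supports hlam hα hw hsup hle)

theorem runs_separateInBox {procs : List Cmd} (hprocs : procs[0]? = some search) {s : State}
    (h : Ready n lam w a lo hi y s) (hlam : 0 < lam)
    (hbox : (fun i : Fin n => y i) ∈ Set.Icc (fun i : Fin n => lo i) (fun i => hi i)) :
    Runs procs separateInBox s (10300 * n + 300) (AnswersSeparation
      (convexHull ℝ (softGraph lam (fun i : Fin n => a i) (fun i => lo i) (fun i => hi i)))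
      (fun i => lo i) (fun i => hi i) (fun i => y i, w)) := by
  rw [separateInBox]
  simp only [block_cons, block_singleton]
  refine (Runs.seq (T₂ := (5150 * n + 130) + 1)
    ((runs_upper hprocs h hlam hbox).mono le_rfl ?_)).mono (by omega) (fun _ => id)
  rintro s₂ ⟨h₂, α, hmem, hsup, hval⟩
  refine Runs.ite (fun hb => ?_) (fun hb => ?_)
  · refine (runs_emitWith procs (v := α) (γ := 1) (by decide) rfl h₂ hmem
      (by simp [Op.apply]) (by simp [Op.apply]) (by simp +contextual [Op.apply])
      (by simp [Op.apply])).mono (by omega) ?_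
    rintro s₃ ⟨h0, hout⟩
    have hlt : s₂.realReg 14 < s₂.realReg 1 := hb
    rw [hval, h₂.w_eq] at hlt
    exact answersSeparation_of_lt hsup hlt h0 hout
  · have hle : s₂.realReg 1 ≤ s₂.realReg 14 := not_lt.1 hb
    rw [hval, h₂.w_eq] at hle
    exact runs_separateBelow hprocs h₂ hlam hbox hsup hle

theorem runs_separate {procs : List Cmd} (hprocs : procs[0]? = some search) {s : State}
    (h : Ready n lam w a lo hi y s) (hlam : 0 < lam)
    (hbox : (fun i : Fin n => lo i) ≤ fun i : Fin n => hi i) :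
    Runs procs (.seq checkBounds (.cond (.realLt 15 14) (emitWith [.realConst 16 0])
      separateInBox)) s (10400 * n + 400) (AnswersSeparation
      (convexHull ℝ (softGraph lam (fun i : Fin n => a i) (fun i => lo i) (fun i => hi i)))
      (fun i => lo i) (fun i => hi i) (fun i => y i, w)) := by
  refine (Runs.seq (T₂ := (10300 * n + 300) + 1)
    ((runs_checkBounds procs h).mono le_rfl ?_)).mono (by omega) (fun _ => id)
  rintro s₂ ⟨h₂, hmem, hrhs, hgap⟩
  rw [Finset.sum_range] at hrhs hgap
  refine Runs.ite (fun hb => ?_) (fun hb => ?_)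
  · have hpos : s₂.realReg 15 < s₂.realReg 14 := hb
    rw [h₂.realZero, hgap] at hpos
    refine (runs_emitWith procs (γ := 0) (by decide) rfl h₂ hmem
      (by simp [Op.apply]) (by simp [Op.apply]) (by simp +contextual [Op.apply])
      (by simp [Op.apply])).mono (by omega) ?_
    rintro s₃ ⟨h0, hout⟩
    rw [hrhs] at hout
    exact answersSeparation_of_boundGap hpos h0 hout
  · have hle : s₂.realReg 14 ≤ s₂.realReg 15 := not_lt.1 hb
    rw [h₂.realZero, hgap] at hle
    exact runs_separateInBox hprocs h₂ hlam (mem_Icc_of_sum_boundGap_le hle hbox)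

end Separation

theorem readVec_coe {n : ℕ} (x : Fin n → ℝ) : (fun i : Fin n => readVec x i) = x := by
  funext i
  simp [readVec]

end RealRAM

theorem proposition1 :
    ∃ (P : RealRAM.Program) (C : ℕ),
      ∀ (d p : ℕ), 0 < d + p →
      ∀ (lam : ℝ) (a lo hi : Fin (d + p) → ℝ), 0 < lam → lo ≤ hi →
      ∀ (y : Fin (d + p) → ℝ) (w : ℝ),
        ∃ (t : ℕ) (s : RealRAM.State),
          P.HaltsIn (separationInput d p lam a lo hi y w) t s ∧
          t ≤ C * (d + p) ∧
          AnswersSeparation (convexHull ℝ (softGraph lam a lo hi)) lo hi (y, w) s := by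
  -- The bound 10400 n + 400 for the run and the 11 steps of `setup` fit into 10900 n because n ≥ 1.
  refine ⟨RealRAM.separation, 10900, fun d p hdp lam a lo hi hlam hbox y w => ?_⟩
  have h := RealRAM.runs_separate (procs := RealRAM.separation.procs) rfl
    (RealRAM.run_setup d p lam w a lo hi y) hlam (by simpa only [RealRAM.readVec_coe] using hbox)
  simp only [RealRAM.readVec_coe] at h
  obtain ⟨t, s, hrun, ht, hans⟩ := RealRAM.Runs.seq
    (RealRAM.Runs.of_straight (c := RealRAM.setup) rfl h)
  refine ⟨t, s, hrun, ht.trans ?_, hans⟩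
  have : RealRAM.setup.cost = 11 := rfl
  omega
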